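/- Let $n\ge 1$, let $K=O(n)$, let $e_1=(1,0,\dots,0)\in\mathbb R^n$ and let $K_{e_1}$ be the stabiliser of $e_1$ in $K$. Let $(\pi,V)$ be an irreducible continuous finite-dimensional complex representation of $K$ that is spherical, i.e. there is, up to a scalar factor, exactly one non-zero vector of $V$ fixed by $K_{e_1}$; fix such a vector $v_0\neq 0$. For $s\in\mathbb C$ let $\nu_{s,\pi}:\mathbb R^n\setminus\{0\}\to V$ be the function $\nu_{s,\pi}(r\,k e_1)=r^s\pi(k)v_0$ ($r>0$, $k\in K$), and let $\mathcal H(GL_n,\pi)$ be the set of smooth compactly supported functions $\phi:GL_n(\mathbb R)\to \mathrm{End}(V)$ with $\phi(k_1gk_2)=\pi(k_1)\phi(g)\pi(k_2)$ for $k_1,k_2\in K$. Put $\lambda(\phi)F(x)=\int_{GL_n(\mathbb R)}\phi(g)F(g^{-1}x)\,d^\times g$ ($d^\times g$ a Haar measure), $\phi^*(g)=|\det g|^{-1}\phi(g^{-1})$, and let $\xi_{s,\pi}(\phi^*)$ be the scalar with $\lambda(\phi^*)\nu_{s,\pi}=\xi_{s,\pi}(\phi^*)\,\nu_{s,\pi}$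 on $\mathbb R^n\setminus\{0\}$. For $F:\mathbb R^n\to\mathrm{End}(V)$ put $M(F,s,\pi)=\int_{\mathbb R^n}F(x)\nu_{s,\pi}(x)\,\frac{dx}{\|x\|^n}$. A vector $Z\in V$ is the weak Mellin transform of $f:\mathbb R^n\to\mathbb C$ at $(s,\pi)$ if for every $\phi\in\mathcal H(GL_n,\pi)$ the integral $M(\lambda(\phi)f,s,\pi)$ converges absolutely and equals $\xi_{s-n,\pi}(\phi^*)\,Z$. Let $a\in\mathbb R\setminus\{0\}$, $b\in\mathbb R^n$, $\psi(t)=e^{-2\pi i t}$ and $f_{a,b}(x)=\psi(\tfrac12 a\,x\cdot x+b\cdot x)$. **Theorem.** There is exactly one meromorphic function $s\mapsto\zeta_{a,b}(s,\pi)$ on $\mathbb C$ with values in $V$ that is holomorphic on $\Re(s)>0$ and whose value there at $s$ is the weak Mellin transform of $f_{a,b}$ at $(s,\pi)$. Moreover: 1. if $b=0$ and $\pi$ is not the trivial representation, then $\zeta_{a,b}(s,\pi)=0$ for all $s\in\mathbb C$; 2. if $b\neq 0$, then all zeros of $\zeta_{a,b}(\cdot,\pi)$ in $\mathbb C$ lie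 on the line $\Re(s)=\frac n2$. -/

import Mathlib

namespace WeakMellin

open MeasureTheory
open scoped ContDiff

noncomputable section

/-- The Euclidean space `ℝ^n`. -/
abbrev E (n : ℕ) := EuclideanSpace ℝ (Fin n)

/-- Real `n × n` matrices. -/
abbrev Mat (n : ℕ) := Matrix (Fin n) (Fin n) ℝ

/-- The maximal compact subgroup `K = O(n)` of `GL_n(ℝ)`. -/
abbrev K (n : ℕ) := Matrix.orthogonalGroup (Fin n) ℝ

/-- The action of a matrix on `ℝ^n`. -/
def act {n : ℕ} (g : Mat n) (x : E n) : E n := Matrix.toEuclideanLin g x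

/-- The first vector `e₁ = (1, 0, …, 0)` of the standard basis. -/
def e₁ (n : ℕ) [NeZero n] : E n := EuclideanSpace.single 0 1

/-- The standard additive character `ψ(t) = exp(-2πit)` of `ℝ`. -/
def psi (t : ℝ) : ℂ := Complex.exp (-2 * Real.pi * Complex.I * t)

/-- The second degree character `f_{a,b}(x) = ψ(½ a x·x + b·x)`. -/
def secondDegree {n : ℕ} (a : ℝ) (b : E n) (x : E n) : ℂ :=
  psi (1 / 2 * a * inner ℝ x x + inner ℝ b x)

/-- `O(n)` is transitive on spheres: every `x` is `‖x‖ • k e₁` for some `k ∈ O(n)`. -/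
theorem exists_orthogonal {n : ℕ} [NeZero n] (x : E n) :
    ∃ k : K n, x = ‖x‖ • act (k : Mat n) (e₁ n) := by
  rcases eq_or_ne x 0 with rfl | hx
  · exact ⟨1, by simp only [norm_zero, zero_smul]⟩
  have hv : Orthonormal ℝ (({0} : Set (Fin n)).domRestrict (fun _ : Fin n => ‖x‖⁻¹ • x)) := by
    constructor
    · intro i
      simp [norm_smul, hx]
    · intro i j hij
      exact absurd (Subsingleton.elim i j) hij
  obtain ⟨B, hB⟩ := hv.exists_orthonormalBasis_extension_of_card_eq (by simp)
  have hB0 : B 0 = ‖x‖⁻¹ • x := hB 0 rfl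
  refine ⟨⟨(EuclideanSpace.basisFun (Fin n) ℝ).toBasis.toMatrix B,
    OrthonormalBasis.toMatrix_orthonormalBasis_mem_orthogonal _ _⟩, ?_⟩
  have key : act ((EuclideanSpace.basisFun (Fin n) ℝ).toBasis.toMatrix B) (e₁ n) = B 0 := by
    ext i
    simp [act, e₁, Module.Basis.toMatrix_apply]
  simp [key, hB0, hx]

theorem act_mul {n : ℕ} (g h : Mat n) (x : E n) : act (g * h) x = act g (act h x) := by
  simp [act, Matrix.toLpLin_apply, Matrix.mulVec_mulVec]

theorem act_smul' {n : ℕ} (g : Mat n) (r : ℝ) (x : E n) : act g (r • x) = r • act g x := by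
  simp [act]

theorem act_one' {n : ℕ} (x : E n) : act (1 : Mat n) x = x := by
  simp [act]

theorem norm_act {n : ℕ} (k : K n) (x : E n) : ‖act (k : Mat n) x‖ = ‖x‖ := by
  have h := (Matrix.mem_orthogonalGroup_iff' (Fin n) ℝ).1 k.2
  have : inner ℝ (act (k : Mat n) x) (act (k : Mat n) x) = inner ℝ x x := by
    simp only [act, EuclideanSpace.inner_eq_star_dotProduct, Matrix.toLpLin_apply, star_trivial]
    rw [Matrix.dotProduct_mulVec, Matrix.vecMul_mulVec, h]
    simp
  rw [real_inner_self_eq_norm_sq, real_inner_self_eq_norm_sq] at this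
  exact (pow_left_inj₀ (norm_nonneg _) (norm_nonneg _) two_ne_zero).1 this

section Representations

variable {n : ℕ} [NeZero n] {V : Type*} [NormedAddCommGroup V] [NormedSpace ℂ V]

/-- `v` is fixed by the stabiliser `K_{e₁}` of `e₁` in `O(n)`. -/
def IsFixedByStabilizer (π : Representation ℂ (K n) V) (v : V) : Prop :=
  ∀ k : K n, act (k : Mat n) (e₁ n) = e₁ n → π k v = v

/-- An irreducible (continuous) representation of `O(n)` is spherical if, up to a scalar factor,
it has a unique non-zero vector fixed by the stabiliser of `e₁`. -/
structure IsSpherical (π : Representation ℂ (K n) V) : Prop where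
  continuous : ∀ v : V, Continuous fun k : K n => π k v
  irreducible : π.IsIrreducible
  unique_fixed : ∃ v₀ : V, v₀ ≠ 0 ∧ IsFixedByStabilizer π v₀ ∧
    ∀ w : V, IsFixedByStabilizer π w → ∃ c : ℂ, w = c • v₀

/-- The function `ν_{s,π}` on `ℝ^n`, `ν_{s,π}(r k e₁) = r^s π(k) v₀` for `r > 0` and `k ∈ O(n)`,
where `v₀` is fixed by the stabiliser of `e₁`. -/
def nu (π : Representation ℂ (K n) V) (v₀ : V) (s : ℂ) (x : E n) : V :=
  ((‖x‖ : ℂ) ^ s) • π (exists_orthogonal x).choose v₀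

/-- `ν_{s,π}` does not depend on the choice of `k`: `ν_{s,π}(r k e₁) = r^s π(k) v₀`. -/
theorem nu_eq (π : Representation ℂ (K n) V) (v₀ : V) (hfix : IsFixedByStabilizer π v₀) (s : ℂ)
    (r : ℝ) (hr : 0 < r) (k : K n) :
    nu π v₀ s (r • act (k : Mat n) (e₁ n)) = ((r : ℂ) ^ s) • π k v₀ := by
  have hn : ‖r • act (k : Mat n) (e₁ n)‖ = r := by
    rw [norm_smul, norm_act]; simp [e₁, abs_of_pos hr]
  have hc := (exists_orthogonal (r • act (k : Mat n) (e₁ n))).choose_spec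
  set k' := (exists_orthogonal (r • act (k : Mat n) (e₁ n))).choose
  rw [hn] at hc
  have hc' : act (k : Mat n) (e₁ n) = act (k' : Mat n) (e₁ n) := smul_right_injective _ hr.ne' hc
  have h1 : act ((k⁻¹ * k' : K n) : Mat n) (e₁ n) = e₁ n := by
    rw [Submonoid.coe_mul, act_mul, ← hc', ← act_mul, ← Submonoid.coe_mul]
    simp [act_one']
  have h2 := hfix _ h1
  have : k' = k * (k⁻¹ * k') := by group
  have h3 : π k' v₀ = π k v₀ := by rw [this, map_mul, Module.End.mul_apply, h2]
  unfold nu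
  exact congrArg₂ (fun (c : ℝ) (w : V) => ((c : ℂ) ^ s) • w) hn h3

/-- `φ` is a smooth compactly supported function on `GL_n(ℝ)` with values in `End(V)`
(extended by zero to all matrices) with `φ(k₁ g k₂) = π(k₁) φ(g) π(k₂)` for `k₁, k₂ ∈ O(n)`:
an element of the `π`-spherical Hecke algebra. -/
structure IsHecke (π : Representation ℂ (K n) V) (φ : Mat n → V →L[ℂ] V) : Prop where
  smooth : ContDiff ℝ ∞ fun g : Fin n → Fin n → ℝ => φ (Matrix.of g)
  compact_support : HasCompactSupport φ
  support_subset : tsupport φ ⊆ {g | g.det ≠ 0}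
  equivariant : ∀ (k₁ k₂ : K n) (g : Mat n) (v : V),
    φ ((k₁ : Mat n) * g * (k₂ : Mat n)) v = π k₁ (φ g (π k₂ v))

/-- `λ(φ)f(x) = ∫_{GL_n(ℝ)} φ(g) f(g⁻¹x) d^×g` for scalar valued `f`; the Haar measure is
`d^×g = |det g|^{-n} dg`, with `dg` the Lebesgue measure on matrices. -/
def lamScalar (φ : Mat n → V →L[ℂ] V) (f : E n → ℂ) (x : E n) : V →L[ℂ] V :=
  ∫ g : Fin n → Fin n → ℝ, (|(Matrix.of g).det| ^ n)⁻¹ •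
    (f (act (Matrix.of g)⁻¹ x) • φ (Matrix.of g))

/-- `λ(φ)F(x) = ∫_{GL_n(ℝ)} φ(g) F(g⁻¹x) d^×g` for `V`-valued `F`. -/
def lamVector (φ : Mat n → V →L[ℂ] V) (F : E n → V) (x : E n) : V :=
  ∫ g : Fin n → Fin n → ℝ, (|(Matrix.of g).det| ^ n)⁻¹ •
    φ (Matrix.of g) (F (act (Matrix.of g)⁻¹ x))

/-- `φ*(g) = |det g|⁻¹ φ(g⁻¹)`. -/
def heckeStar (φ : Mat n → V →L[ℂ] V) (g : Mat n) : V →L[ℂ] V :=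
  |g.det|⁻¹ • φ g⁻¹

/-- `ξ` is the eigenvalue `ξ_{s,π}(φ)`: `λ(φ) ν_{s,π} = ξ ν_{s,π}` on `ℝ^n \ {0}`. -/
def IsEigenvalue (π : Representation ℂ (K n) V) (v₀ : V) (s : ℂ)
    (φ : Mat n → V →L[ℂ] V) (ξ : ℂ) : Prop :=
  ∀ x : E n, x ≠ 0 → lamVector φ (nu π v₀ s) x = ξ • nu π v₀ s x

/-- The integrand of the Mellin transform of an `End(V)`-valued function `F`. -/
def mellinIntegrand (π : Representation ℂ (K n) V) (v₀ : V) (F : E n → V →L[ℂ] V) (s : ℂ)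
    (x : E n) : V :=
  (‖x‖ ^ n)⁻¹ • F x (nu π v₀ s x)

/-- `M(F, s, π) = ∫_{ℝ^n} F(x) ν_{s,π}(x) dx / ‖x‖^n`. -/
def mellin (π : Representation ℂ (K n) V) (v₀ : V) (F : E n → V →L[ℂ] V) (s : ℂ) : V :=
  ∫ x : E n, mellinIntegrand π v₀ F s x

/-- `Z` is the weak Mellin transform `M(f, s, π)` of `f`: for every `φ` in the `π`-spherical
Hecke algebra the Mellin transform of `λ(φ)f` at `(s, π)` converges absolutely, and
`M(λ(φ)f, s, π) = ξ_{s-n,π}(φ*) Z`. -/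
def IsWeakMellin (π : Representation ℂ (K n) V) (v₀ : V) (f : E n → ℂ) (s : ℂ) (Z : V) : Prop :=
  ∀ φ : Mat n → V →L[ℂ] V, IsHecke π φ →
    Integrable (mellinIntegrand π v₀ (lamScalar φ f) s) ∧
    ∀ ξ : ℂ, IsEigenvalue π v₀ (s - n) (heckeStar φ) ξ →
      mellin π v₀ (lamScalar φ f) s = ξ • Z

/-- `ζ` is the function `s ↦ ζ_f(s, π)`: the weak Mellin transform of `f` for `Re s > 0`, where
it is holomorphic, continued meromorphically to `ℂ` (with the normalising value `0` at the poles). -/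
structure IsZeta (π : Representation ℂ (K n) V) (v₀ : V) (f : E n → ℂ) (ζ : ℂ → V) : Prop where
  weakMellin : ∀ s : ℂ, 0 < s.re → IsWeakMellin π v₀ f s (ζ s)
  holomorphic : DifferentiableOn ℂ ζ {s : ℂ | 0 < s.re}
  meromorphic : MeromorphicNFOn ζ Set.univ

/-- A zero of a meromorphic function: a point where it is holomorphic and vanishes. -/
def IsZero (ζ : ℂ → V) (s : ℂ) : Prop := AnalyticAt ℂ ζ s ∧ ζ s = 0

end Representations

end

end WeakMellin

/-!
Write `f = f_{a,b}` as the boundary value at `z = ia` of the Gaussians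
`gauss z b x = exp (-π z ‖x‖² - 2πi ⟪b, x⟫)`, `Re z > 0`. For a Gaussian with `Re z > 0` everything
converges absolutely and Fubini's theorem gives `M(λ(φ) gauss, s) = ξ ∫ gauss(x) ν_{s-n}(x) dx` with
`ξ = ξ_{s-n}(φ*)` (`mellin_lamScalar_gauss`), so the weak Mellin transform of `f` should be the
limit of these integrals as `z → ia`. The limit may be taken on the left because `λ(φ) gauss` decays
rapidly, uniformly for `z` near `ia`: in the variable `h = g⁻¹` it is an oscillatory integral whose
phase is quadratic in the first column of `h`, and repeated integration by parts in that column
applies (`IsAmplitude.exists_norm_integral_osc_le`, `exists_norm_lamScalar_gauss_le`,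
`tendsto_mellin_lamScalar_gauss`). On the right the integral is computed explicitly. Averaging over
`O(n)` and expanding the exponential leads to the moments `∫ ⟪x, k e₁⟫^m π(k) v₀ dk`. Since `π` is
spherical they are multiples `q m ‖x‖^m` of the vector `π(k_x) v₀`, where `x = ‖x‖ k_x e₁`
(`exists_moment_eq`); they vanish unless `m = l + 2j`, where `l` is the least order with `q l ≠ 0`,
and `q` satisfies a two-step recursion (`moment_recursion`, `exists_moment_formula`). With
`α = (s + l) / 2` and `β = n / 2 + l` the integral is, up to a non-zero constant,
`Γ(α) (πz)^(-α) ₁F₁(α; β; -π‖b‖²/z) ‖b‖^l π(k_b) v₀`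
(`exists_integral_gauss_smul_nu_eq_kummer`). Both sides are continuous up to `z = ia`
(`isWeakMellin_secondDegree`), and the formula provides the meromorphic continuation in `s`
(`exists_isZeta_secondDegree`).

Uniqueness holds because for each `s` some element of the Hecke algebra, concentrated near `O(n)`,
has a non-zero eigenvalue (`exists_isHecke_isEigenvalue_ne_zero`). It is close to a multiple of
`∫ π(k)² dk`, a scalar which is non-zero because the Frobenius–Schur indicator of a spherical
representation is (`exists_integral_apply_apply_eq_smul`). The values for `Re s > 0` being determined, so is
the meromorphic function (`eq_of_meromorphicNFOn_univ`).

The least order `l` is zero only for the trivial representation, so for `b = 0` and non-trivial `π`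
the factor `‖b‖^l` makes the function vanish. If `b ≠ 0`, the Gamma function and the power have no
zeros, and `₁F₁(α; β; iy)` with `y = π‖b‖²/a ≠ 0` can only vanish if `Re α = β / 2`
(`re_eq_of_kummer_eq_zero`): the twist `e^{-iyt/2} ₁F₁(α; β; iyt)` is a solution of a self-adjoint
Sturm–Liouville problem on `[0, 1]` with spectral parameter `iy(β/2 - α)`, which is therefore real.
Finally `Re α = β / 2` means `Re s = n / 2`.
-/


namespace WeakMellin

open MeasureTheory Filter Topology Set
open scoped ContDiff

noncomputable section

/-! ### The compact group `O(n)` and its Haar measure -/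

section Group

variable {n : ℕ}

instance : SecondCountableTopology (Mat n) :=
  inferInstanceAs (SecondCountableTopology (Fin n → Fin n → ℝ))

instance : SecondCountableTopology (K n) :=
  Topology.IsInducing.subtypeVal.secondCountableTopology

instance : CompactSpace (K n) := by
  refine isCompact_iff_compactSpace.1 (?_ : IsCompact (SetLike.coe (K n)))
  have hcl : IsClosed {g : Mat n | g ∈ Matrix.orthogonalGroup (Fin n) ℝ} := by
    simp only [Matrix.mem_orthogonalGroup_iff]
    exact isClosed_eq (by fun_prop) continuous_const
  have hbd : IsCompact (Set.pi univ fun _ : Fin n => Set.pi univ fun _ : Fin n =>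
      Icc (-1 : ℝ) 1) :=
    isCompact_univ_pi fun _ => isCompact_univ_pi fun _ => isCompact_Icc
  refine IsCompact.of_isClosed_subset hbd hcl fun g hg i _ j _ => ?_
  have := entry_norm_bound_of_unitary (𝕜 := ℝ) hg i j
  rwa [Real.norm_eq_abs, abs_le] at this

instance : MeasurableSpace (K n) := borel _

instance : BorelSpace (K n) := ⟨rfl⟩

/-- The Haar probability measure of `O(n)`. -/
def haarK (n : ℕ) : Measure (K n) := Measure.haarMeasure ⊤

instance : (haarK n).IsHaarMeasure := inferInstanceAs (Measure.haarMeasure ⊤).IsHaarMeasure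

instance : IsProbabilityMeasure (haarK n) := ⟨Measure.haarMeasure_self⟩

instance : (haarK n).IsMulRightInvariant := ⟨fun k => by
  have : IsProbabilityMeasure (Measure.map (· * k) (haarK n)) :=
    Measure.isProbabilityMeasure_map (measurable_mul_const k).aemeasurable
  exact Measure.isHaarMeasure_eq_of_isProbabilityMeasure _ _⟩

theorem integrable_haarK {W : Type*} [NormedAddCommGroup W] {f : K n → W} (hf : Continuous f) :
    Integrable f (haarK n) :=
  hf.integrable_of_hasCompactSupport (HasCompactSupport.of_compactSpace f)

@[simp] theorem act_coe_mul (k k' : K n) (x : E n) :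
    act ((k * k' : K n) : Mat n) x = act (k : Mat n) (act (k' : Mat n) x) := act_mul _ _ _

@[simp] theorem act_coe_one (x : E n) : act ((1 : K n) : Mat n) x = x := act_one' x

theorem act_inv_act (k : K n) (x : E n) : act ((k⁻¹ : K n) : Mat n) (act (k : Mat n) x) = x := by
  rw [← act_coe_mul, inv_mul_cancel, act_coe_one]

theorem act_act_inv (k : K n) (x : E n) : act (k : Mat n) (act ((k⁻¹ : K n) : Mat n) x) = x := by
  rw [← act_coe_mul, mul_inv_cancel, act_coe_one]

theorem coe_inv_eq_inv (k : K n) : ((k⁻¹ : K n) : Mat n) = (k : Mat n)⁻¹ := by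
  symm
  apply Matrix.inv_eq_left_inv
  rw [← Submonoid.coe_mul, inv_mul_cancel, Submonoid.coe_one]

theorem abs_det_coe (k : K n) : |(k : Mat n).det| = 1 := by
  have h := congrArg Matrix.det ((Matrix.mem_orthogonalGroup_iff' (Fin n) ℝ).1 k.2)
  have h2 : (k : Mat n).det * (k : Mat n).det = 1 := by
    simpa [Matrix.det_mul, Matrix.star_eq_conjTranspose] using h
  exact abs_eq_abs.2 (by simpa using mul_self_eq_one_iff.1 h2) |>.trans abs_one

/-- The action of an orthogonal matrix, as a linear isometry. -/
def actIso (k : K n) : E n ≃ₗᵢ[ℝ] E n where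
  toFun x := act (k : Mat n) x
  invFun x := act ((k⁻¹ : K n) : Mat n) x
  map_add' x y := by simp [act]
  map_smul' r x := act_smul' _ r x
  left_inv x := act_inv_act k x
  right_inv x := act_act_inv k x
  norm_map' x := norm_act k x

theorem inner_act_act (k : K n) (x y : E n) :
    inner ℝ (act (k : Mat n) x) (act (k : Mat n) y) = inner ℝ x y :=
  (actIso k).inner_map_map x y

theorem inner_act_left (k : K n) (x y : E n) :
    inner ℝ (act (k : Mat n) x) y = inner ℝ x (act ((k⁻¹ : K n) : Mat n) y) := by
  rw [← inner_act_act k x, act_act_inv]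

theorem continuous_act : Continuous fun p : Mat n × E n => act p.1 p.2 := by
  unfold act
  simp only [Matrix.toLpLin_apply]
  fun_prop

theorem _root_.Continuous.act {X : Type*} [TopologicalSpace X] {f : X → Mat n} {g : X → E n}
    (hf : Continuous f) (hg : Continuous g) : Continuous fun x => act (f x) (g x) :=
  continuous_act.comp (hf.prodMk hg)

/-- Every linear isometry of `ℝ^n` is the action of an orthogonal matrix. -/
theorem exists_act_eq_isometry (f : E n ≃ₗᵢ[ℝ] E n) :
    ∃ k : K n, ∀ x, act (k : Mat n) x = f x := by
  let b := EuclideanSpace.basisFun (Fin n) ℝ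
  refine ⟨⟨b.toBasis.toMatrix (b.map f),
    OrthonormalBasis.toMatrix_orthonormalBasis_mem_orthogonal _ _⟩, fun x => ?_⟩
  have : Matrix.toEuclideanLin (b.toBasis.toMatrix (b.map f)) = (f : E n →ₗ[ℝ] E n) := by
    refine b.toBasis.ext fun i => ?_
    ext j
    simp [b, Module.Basis.toMatrix_apply, Matrix.toLpLin_apply]
  exact congrArg (fun g => g x) this

theorem act_neg_one (x : E n) : act ((-1 : K n) : Mat n) x = -x := by
  have : ((-1 : K n) : Mat n) = -1 := rfl
  rw [this]
  simp [act]

variable [NeZero n]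

@[simp] theorem norm_e₁ : ‖e₁ n‖ = 1 := by simp [e₁]

theorem continuous_orbit : Continuous fun k : K n => act (k : Mat n) (e₁ n) :=
  continuous_act.comp (by fun_prop : Continuous fun k : K n => ((k : Mat n), e₁ n))

/-- The rotation part of a vector: `x = ‖x‖ • k e₁`. -/
def rot (x : E n) : K n := (exists_orthogonal x).choose

theorem norm_smul_rot (x : E n) : ‖x‖ • act (rot x : Mat n) (e₁ n) = x :=
  (exists_orthogonal x).choose_spec.symm

/-- `k⁻¹` lies in the double coset of `k` for the stabiliser of `e₁`. -/
theorem exists_inv_eq_mul_mul (k : K n) : ∃ m m' : K n, act (m : Mat n) (e₁ n) = e₁ n ∧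
    act (m' : Mat n) (e₁ n) = e₁ n ∧ k⁻¹ = m * k * m' := by
  set u := act (k : Mat n) (e₁ n)
  set v := act ((k⁻¹ : K n) : Mat n) (e₁ n)
  -- the reflection exchanging `k e₁` and `k⁻¹ e₁` fixes `e₁`
  obtain ⟨m, hm⟩ := exists_act_eq_isometry ((Submodule.span ℝ {u - v})ᗮ.reflection)
  have huv : ‖u‖ = ‖v‖ := by simp only [u, v, norm_act]
  have h1 : act (m : Mat n) u = v := by rw [hm]; exact Submodule.reflection_sub huv
  have h2 : act (m : Mat n) (e₁ n) = e₁ n := by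
    rw [hm]
    refine Submodule.reflection_mem_subspace_eq_self ?_
    rw [Submodule.mem_orthogonal_singleton_iff_inner_right, inner_sub_left, sub_eq_zero]
    simp only [u, v]
    rw [inner_act_left, real_inner_comm]
  refine ⟨m, (k * m * k)⁻¹, h2, ?_, by group⟩
  have : act ((k * m * k : K n) : Mat n) (e₁ n) = e₁ n := by
    rw [act_coe_mul, act_coe_mul]
    change act (k : Mat n) (act (m : Mat n) u) = _
    rw [h1]
    exact act_act_inv k _
  conv_lhs => rw [← this]
  rw [act_inv_act]

end Group

/-! ### The functions `ν_{s,π}` -/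

section Nu

variable {n : ℕ} [NeZero n] {V : Type*} [NormedAddCommGroup V] [NormedSpace ℂ V]
  {π : Representation ℂ (K n) V} {v₀ : V}

theorem nu_apply (s : ℂ) (x : E n) : nu π v₀ s x = ((‖x‖ : ℂ) ^ s) • π (rot x) v₀ := rfl

theorem IsFixedByStabilizer.apply_eq (hfix : IsFixedByStabilizer π v₀) {k k' : K n}
    (h : act (k : Mat n) (e₁ n) = act (k' : Mat n) (e₁ n)) : π k v₀ = π k' v₀ := by
  have h1 : act ((k⁻¹ * k' : K n) : Mat n) (e₁ n) = e₁ n := by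
    rw [act_coe_mul, ← h, act_inv_act]
  have : k' = k * (k⁻¹ * k') := by group
  rw [this, map_mul, Module.End.mul_apply, hfix _ h1]

theorem apply_rot (hfix : IsFixedByStabilizer π v₀) {r : ℝ} (hr : 0 < r) (k : K n) :
    π (rot (r • act (k : Mat n) (e₁ n))) v₀ = π k v₀ := by
  refine hfix.apply_eq (smul_right_injective _ hr.ne' ?_)
  have := norm_smul_rot (r • act (k : Mat n) (e₁ n))
  rwa [norm_smul, norm_act, norm_e₁, mul_one, Real.norm_of_nonneg hr.le] at this

theorem exists_eq_smul_act {x : E n} (hx : x ≠ 0) :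
    ∃ (r : ℝ) (k : K n), 0 < r ∧ x = r • act (k : Mat n) (e₁ n) :=
  ⟨‖x‖, rot x, norm_pos_iff.2 hx, (norm_smul_rot x).symm⟩

theorem nu_act (hfix : IsFixedByStabilizer π v₀) (s : ℂ) (k : K n) {x : E n} (hx : x ≠ 0) :
    nu π v₀ s (act (k : Mat n) x) = π k (nu π v₀ s x) := by
  obtain ⟨r, k', hr, rfl⟩ := exists_eq_smul_act hx
  rw [act_smul', ← act_coe_mul, nu_eq _ _ hfix s r hr, nu_eq _ _ hfix s r hr, map_smul, map_mul,
    Module.End.mul_apply]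

theorem nu_smul (hfix : IsFixedByStabilizer π v₀) (s : ℂ) {r : ℝ} (hr : 0 < r) {x : E n}
    (hx : x ≠ 0) : nu π v₀ s (r • x) = ((r : ℂ) ^ s) • nu π v₀ s x := by
  obtain ⟨t, k, ht, rfl⟩ := exists_eq_smul_act hx
  rw [smul_smul, nu_eq _ _ hfix s _ (mul_pos hr ht), nu_eq _ _ hfix s t ht, smul_smul,
    Complex.ofReal_mul, Complex.mul_cpow_ofReal_nonneg hr.le ht.le]

theorem norm_pow_inv_smul_nu (s : ℂ) {x : E n} (hx : x ≠ 0) :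
    (‖x‖ ^ n)⁻¹ • nu π v₀ s x = nu π v₀ (s - n) x := by
  have h : (‖x‖ : ℂ) ≠ 0 := by exact_mod_cast norm_ne_zero_iff.2 hx
  rw [nu_apply, nu_apply, ← Complex.coe_smul, smul_smul, Complex.cpow_sub _ _ h,
    Complex.cpow_natCast]
  push_cast
  congr 1
  field_simp

theorem nu_e₁ (hfix : IsFixedByStabilizer π v₀) (s : ℂ) : nu π v₀ s (e₁ n) = v₀ := by
  simpa [act_one'] using nu_eq π v₀ hfix s 1 one_pos 1

variable [FiniteDimensional ℂ V]

variable (π) in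
/-- The operators of a finite-dimensional representation, as continuous linear maps. -/
def piL (k : K n) : V →L[ℂ] V := LinearMap.toContinuousLinearMap (π k)

omit [NeZero n] in
@[simp] theorem piL_apply (k : K n) (v : V) : piL π k v = π k v := rfl

omit [NeZero n] in
theorem continuous_piL (hπ : ∀ v : V, Continuous fun k : K n => π k v) : Continuous (piL π) :=
  continuous_clm_apply.2 hπ

omit [NeZero n] in
theorem exists_norm_piL_le (hπ : ∀ v : V, Continuous fun k : K n => π k v) :
    ∃ C : ℝ, 0 < C ∧ ∀ k, ‖piL π k‖ ≤ C := by
  obtain ⟨C, hC⟩ := (isCompact_range (continuous_piL hπ)).isBounded.exists_norm_le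
  exact ⟨max C 1, lt_max_of_lt_right one_pos, fun k => (hC _ ⟨k, rfl⟩).trans (le_max_left _ _)⟩

theorem exists_norm_nu_le (hπ : ∀ v : V, Continuous fun k : K n => π k v) :
    ∃ C : ℝ, 0 < C ∧ ∀ (s : ℂ) (x : E n), x ≠ 0 → ‖nu π v₀ s x‖ ≤ C * ‖x‖ ^ s.re := by
  obtain ⟨C, hC, h⟩ := exists_norm_piL_le hπ
  refine ⟨C * (‖v₀‖ + 1), by positivity, fun s x hx => ?_⟩
  rw [nu_apply, norm_smul, Complex.norm_cpow_eq_rpow_re_of_pos (norm_pos_iff.2 hx), mul_comm]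
  gcongr
  refine ((piL π (rot x)).le_opNorm v₀).trans ?_
  have := h (rot x)
  gcongr
  linarith

omit [FiniteDimensional ℂ V] in
/-- `ν_{s,π}` is continuous off the origin: `O(n)` is compact, so the sphere carries the quotient
topology of the orbit map `k ↦ k e₁`. -/
theorem continuousOn_nu (hπ : ∀ v : V, Continuous fun k : K n => π k v)
    (hfix : IsFixedByStabilizer π v₀) (s : ℂ) : ContinuousOn (nu π v₀ s) {0}ᶜ := by
  let o : K n → Metric.sphere (0 : E n) 1 :=
    fun k => ⟨act (k : Mat n) (e₁ n), by simp [norm_act]⟩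
  have ho : Continuous o := continuous_orbit.subtype_mk _
  have hs : Function.Surjective o := fun y => ⟨rot y.1, Subtype.ext (by
    have := norm_smul_rot y.1
    rwa [mem_sphere_zero_iff_norm.1 y.2, one_smul] at this)⟩
  have hq : IsQuotientMap o := ho.isClosedMap.isQuotientMap ho hs
  have h1 : Continuous fun y : Metric.sphere (0 : E n) 1 => π (rot y.1) v₀ := by
    rw [hq.continuous_iff]
    refine (hπ v₀).congr fun k => ?_
    have := apply_rot hfix one_pos k
    rw [one_smul] at this
    exact this.symm
  rw [continuousOn_iff_continuous_domRestrict]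
  have hne : ∀ x : ({0}ᶜ : Set (E n)), ‖x.1‖ ≠ 0 := fun x => norm_ne_zero_iff.2 x.2
  have h2 : Continuous fun x : ({0}ᶜ : Set (E n)) =>
      (⟨‖x.1‖⁻¹ • x.1, by simp [norm_smul, hne x]⟩ : Metric.sphere (0 : E n) 1) := by
    refine Continuous.subtype_mk ?_ _
    exact (continuous_subtype_val.norm.inv₀ hne).smul continuous_subtype_val
  have h3 : Continuous fun x : ({0}ᶜ : Set (E n)) => ((‖x.1‖ : ℂ) ^ s) := by
    refine continuous_iff_continuousAt.2 fun x => ?_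
    exact (Complex.continuous_ofReal.comp continuous_subtype_val.norm).continuousAt.cpow
      continuousAt_const (Complex.ofReal_mem_slitPlane.2 (norm_pos_iff.2 x.2))
  refine (h3.smul (h1.comp h2)).congr fun x => ?_
  rw [domRestrict_apply, nu_apply]
  have hr := norm_pos_iff.2 x.2
  rw [← apply_rot hfix (mul_pos (inv_pos.2 hr) hr) (rot x.1), mul_smul, norm_smul_rot]
  rfl

theorem stronglyMeasurable_nu (hπ : ∀ v : V, Continuous fun k : K n => π k v)
    (hfix : IsFixedByStabilizer π v₀) (s : ℂ) : StronglyMeasurable (nu π v₀ s) := by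
  borelize V
  have := FiniteDimensional.proper ℂ V
  exact (measurable_of_continuousOn_compl_singleton 0
    (continuousOn_nu hπ hfix s)).stronglyMeasurable

end Nu

/-! ### Averaging over `O(n)` -/

section Average

variable {n : ℕ}

theorem measurePreserving_act (k : K n) :
    MeasurePreserving (fun x : E n => act (k : Mat n) x) :=
  (actIso k).measurePreserving

theorem measurePreserving_prod_act :
    MeasurePreserving (fun p : K n × E n => (p.1, act (p.1 : Mat n) p.2))
      ((haarK n).prod volume) ((haarK n).prod volume) := by
  refine MeasurePreserving.skew_product (f := id) (MeasurePreserving.id _)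
    (g := fun (k : K n) (x : E n) => act (k : Mat n) x) ?_ ?_
  · exact (continuous_act.comp (by fun_prop :
      Continuous fun p : K n × E n => ((p.1 : Mat n), p.2))).measurable
  · exact ae_of_all _ fun k => (measurePreserving_act k).map_eq

/-- An integral over `ℝ^n` may be computed by averaging over rotations first. -/
theorem integral_eq_integral_integral_act {W : Type*} [NormedAddCommGroup W] [NormedSpace ℝ W]
    [CompleteSpace W]
    {F : E n → W} (hF : Integrable F) :
    ∫ x, F x = ∫ x, ∫ k, F (act (k : Mat n) x) ∂haarK n := by
  have h2 : Integrable (fun p : K n × E n => F (act (p.1 : Mat n) p.2)) ((haarK n).prod volume) :=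
    measurePreserving_prod_act.integrable_comp_of_integrable
      (g := fun p : K n × E n => F p.2) (hF.comp_snd _)
  rw [integral_integral_swap (f := fun (x : E n) (k : K n) => F (act (k : Mat n) x)) h2.swap]
  have : ∀ k : K n, ∫ x, F (act (k : Mat n) x) = ∫ x, F x := fun k =>
    (measurePreserving_act k).integral_comp
      (actIso k).toHomeomorph.measurableEmbedding F
  simp [this]

end Average

/-! ### Lebesgue measure on matrices -/

section MatrixMeasure

variable {n : ℕ}

/-- Left and right multiplication `h ↦ g h g'` on the space of matrices. -/
def mulLR (g g' : Mat n) : (Fin n → Fin n → ℝ) →ₗ[ℝ] (Fin n → Fin n → ℝ) where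
  toFun h := g * Matrix.of h * g'
  map_add' x y := by
    change g * (Matrix.of x + Matrix.of y) * g' = g * Matrix.of x * g' + g * Matrix.of y * g'
    rw [mul_add, add_mul]
  map_smul' r x := by
    change g * (r • Matrix.of x) * g' = r • (g * Matrix.of x * g')
    rw [Matrix.mul_smul, Matrix.smul_mul]

theorem mulLR_apply (g g' : Mat n) (h : Fin n → Fin n → ℝ) :
    mulLR g g' h = Matrix.of.symm (g * Matrix.of h * g') := rfl

theorem det_mulLR_one_left (g : Mat n) : LinearMap.det (mulLR 1 g) = g.det ^ n := by
  have : mulLR 1 g = LinearMap.pi fun i : Fin n =>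
      (Matrix.toLin' g.transpose) ∘ₗ LinearMap.proj i := by
    ext h i j
    simp [mulLR_apply, Matrix.mul_apply, Matrix.mulVec, dotProduct, mul_comm]
  rw [this, LinearMap.det_pi]
  simp

theorem det_mulLR_one_right (g : Mat n) : LinearMap.det (mulLR g 1) = g.det ^ n := by
  let e : (Fin n → Fin n → ℝ) ≃ₗ[ℝ] (Fin n → Fin n → ℝ) :=
    Matrix.transposeLinearEquiv (Fin n) (Fin n) ℝ ℝ
  have : mulLR g 1 = (e : (Fin n → Fin n → ℝ) →ₗ[ℝ] _) ∘ₗ mulLR 1 g.transpose ∘ₗ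
      (e.symm : (Fin n → Fin n → ℝ) →ₗ[ℝ] _) := by
    refine LinearMap.ext fun h => ?_
    change (g * Matrix.of h * 1 : Mat n) = (1 * (Matrix.of h).transpose * g.transpose).transpose
    simp
  rw [this, LinearMap.det_conj, det_mulLR_one_left, Matrix.det_transpose]

theorem det_mulLR (g g' : Mat n) : LinearMap.det (mulLR g g') = g.det ^ n * g'.det ^ n := by
  have : mulLR g g' = mulLR g 1 ∘ₗ mulLR 1 g' := by
    refine LinearMap.ext fun h => ?_
    change (g * Matrix.of h * g' : Mat n) = g * (1 * Matrix.of h * g') * 1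
    simp [mul_assoc]
  rw [this, LinearMap.det_comp, det_mulLR_one_left, det_mulLR_one_right]

/-- Linear change of variables. -/
theorem integral_comp_linearMap {F : Type*} [NormedAddCommGroup F] [NormedSpace ℝ F]
    {X : Type*} [NormedAddCommGroup X] [NormedSpace ℝ X] [MeasurableSpace X] [BorelSpace X]
    [FiniteDimensional ℝ X] (μ : Measure X) [μ.IsAddHaarMeasure] {L : X →ₗ[ℝ] X}
    (hL : LinearMap.det L ≠ 0) (f : X → F) :
    ∫ x, f (L x) ∂μ = |LinearMap.det L|⁻¹ • ∫ x, f x ∂μ := by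
  let e := (LinearEquiv.ofIsUnitDet (f := L) (v := Module.finBasis ℝ X)
    (v' := Module.finBasis ℝ X) (by rw [LinearMap.det_toMatrix]; exact hL.isUnit)).toContinuousLinearEquiv
  have h1 : Measure.map L μ = ENNReal.ofReal |(LinearMap.det L)⁻¹| • μ :=
    Measure.map_linearMap_addHaar_eq_smul_addHaar μ hL
  have h2 : ∫ x, f (L x) ∂μ = ∫ x, f x ∂(Measure.map L μ) :=
    (e.toHomeomorph.measurableEmbedding.integral_map f).symm
  rw [h2, h1, integral_smul_measure, ENNReal.toReal_ofReal (abs_nonneg _), abs_inv]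

theorem integral_comp_mul_orthogonal {F : Type*} [NormedAddCommGroup F] [NormedSpace ℝ F]
    (k k' : K n) (f : Mat n → F) :
    ∫ h : Fin n → Fin n → ℝ, f ((k : Mat n) * Matrix.of h * (k' : Mat n)) =
      ∫ h : Fin n → Fin n → ℝ, f (Matrix.of h) := by
  have hd : |LinearMap.det (mulLR (k : Mat n) (k' : Mat n))| = 1 := by
    rw [det_mulLR, abs_mul, abs_pow, abs_pow, abs_det_coe, abs_det_coe]; simp
  have := integral_comp_linearMap (volume : Measure (Fin n → Fin n → ℝ))
    (L := mulLR (k : Mat n) (k' : Mat n)) (by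
      intro h; rw [h] at hd; simp at hd) (fun h => f (Matrix.of h))
  rw [hd, inv_one, one_smul] at this
  exact this

theorem integral_comp_act {F : Type*} [NormedAddCommGroup F] [NormedSpace ℝ F]
    {h : Mat n} (hh : h.det ≠ 0) (f : E n → F) :
    ∫ x, f (act h x) = |h.det|⁻¹ • ∫ x, f x := by
  have hd : LinearMap.det (Matrix.toEuclideanLin h) = h.det := by
    rw [show Matrix.toEuclideanLin h = _ from
      congrArg (fun f => f h) (Matrix.toLpLin_eq_toLin 2 2), LinearMap.det_toLin]
  have := integral_comp_linearMap (volume : Measure (E n)) (L := Matrix.toEuclideanLin h)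
    (by rwa [hd]) f
  rwa [hd] at this

section Inversion

attribute [local instance] Matrix.linftyOpNormedRing Matrix.linftyOpNormedAlgebra

theorem hasFDerivAt_matrix_inv {h : Mat n} (hh : h.det ≠ 0) :
    HasFDerivAt (fun g : Fin n → Fin n → ℝ => (Matrix.of.symm (Matrix.of g)⁻¹ : Fin n → Fin n → ℝ))
      (-(LinearMap.toContinuousLinearMap (mulLR h⁻¹ h⁻¹))) (Matrix.of.symm h) := by
  let e : (Fin n → Fin n → ℝ) ≃L[ℝ] Mat n :=
    (Matrix.ofLinearEquiv ℝ).toContinuousLinearEquiv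
  have hu : IsUnit h := (Matrix.isUnit_iff_isUnit_det h).2 hh.isUnit
  have h1 := hasFDerivAt_ringInverse (𝕜 := ℝ) hu.unit
  have h2 : HasFDerivAt (Ring.inverse : Mat n → Mat n) _ (e (Matrix.of.symm h)) := h1
  have h3 := (e.symm.hasFDerivAt).comp (Matrix.of.symm h) (h2.comp _ e.hasFDerivAt)
  refine (h3.congr_fderiv ?_).congr_of_eventuallyEq ?_
  · ext1 H
    change -(((hu.unit⁻¹ : (Mat n)ˣ) : Mat n) * Matrix.of H * ((hu.unit⁻¹ : (Mat n)ˣ) : Mat n))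
      = -(h⁻¹ * Matrix.of H * h⁻¹)
    rw [Matrix.coe_units_inv]
    rfl
  · refine Eventually.of_forall fun g => ?_
    change _ = Ring.inverse (Matrix.of g)
    rw [← Matrix.nonsing_inv_eq_ringInverse]
    rfl

end Inversion

/-- The measure `|det g|^{-n} dg` on matrices is invariant under inversion. -/
theorem integral_comp_inv [NeZero n] {F : Type*} [NormedAddCommGroup F] [NormedSpace ℝ F]
    (f : Mat n → F) :
    ∫ g : Fin n → Fin n → ℝ, (|(Matrix.of g).det| ^ n)⁻¹ • f (Matrix.of g)⁻¹ =
      ∫ h : Fin n → Fin n → ℝ, (|(Matrix.of h).det| ^ n)⁻¹ • f (Matrix.of h) := by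
  set S : Set (Fin n → Fin n → ℝ) := {g | (Matrix.of g).det ≠ 0} with hS
  have hcont : Continuous fun g : Fin n → Fin n → ℝ => (Matrix.of g).det := by
    have : Continuous fun g : Fin n → Fin n → ℝ => (Matrix.of g : Mat n) := continuous_id
    exact this.matrix_det
  have hSm : MeasurableSet S := (hcont.isOpen_preimage _ isOpen_ne).measurableSet
  -- the weight vanishes on singular matrices, since `n ≥ 1`
  have hzero : ∀ (u : (Fin n → Fin n → ℝ) → F) (g), g ∉ S →
      (|(Matrix.of g).det| ^ n)⁻¹ • u g = 0 := by
    intro u g hg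
    have : (Matrix.of g).det = 0 := by simpa [hS] using hg
    simp [this, NeZero.ne n]
  let ι : (Fin n → Fin n → ℝ) → (Fin n → Fin n → ℝ) :=
    fun g => Matrix.of.symm (Matrix.of g)⁻¹
  have hιι : ∀ g ∈ S, ι (ι g) = g := fun g hg =>
    congrArg Matrix.of.symm (Matrix.nonsing_inv_nonsing_inv _ (Ne.isUnit hg))
  have hιS : ∀ g ∈ S, ι g ∈ S := fun g hg =>
    ((Matrix.isUnit_nonsing_inv_det _ (Ne.isUnit hg))).ne_zero
  have himg : ι '' S = S := by
    refine Subset.antisymm (image_subset_iff.2 hιS) fun g hg => ⟨ι g, hιS g hg, hιι g hg⟩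
  have hinj : InjOn ι S := fun g hg g' hg' h => by rw [← hιι g hg, h, hιι g' hg']
  have key := integral_image_eq_integral_abs_det_fderiv_smul
    (volume : Measure (Fin n → Fin n → ℝ)) hSm
    (fun g hg => (hasFDerivAt_matrix_inv (h := Matrix.of g) hg).hasFDerivWithinAt) hinj
    (fun h => (|(Matrix.of h).det| ^ n)⁻¹ • f (Matrix.of h))
  have e2 : ∀ u : (Fin n → Fin n → ℝ) → F,
      ∫ g in S, (|(Matrix.of g).det| ^ n)⁻¹ • u g = ∫ g, (|(Matrix.of g).det| ^ n)⁻¹ • u g :=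
    fun u => setIntegral_eq_integral_of_forall_compl_eq_zero fun g hg => hzero u g hg
  change ∫ x in ι '' S, _ = _ at key
  rw [himg, e2 (fun h => f (Matrix.of h))] at key
  rw [key, ← e2 (fun g => f (Matrix.of g)⁻¹)]
  refine setIntegral_congr_fun hSm fun g hg => ?_
  have hd : |(-(LinearMap.toContinuousLinearMap
      (mulLR (Matrix.of g)⁻¹ (Matrix.of g)⁻¹))).det| = ((|(Matrix.of g).det| ^ n)⁻¹) ^ 2 := by
    rw [ContinuousLinearMap.det, ContinuousLinearMap.toLinearMap_neg,
      LinearMap.coe_toContinuousLinearMap, ← neg_one_smul ℝ, LinearMap.det_smul, det_mulLR, Matrix.det_nonsing_inv,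
      Ring.inverse_eq_inv', abs_mul, abs_pow, abs_mul, abs_pow, abs_inv]
    simp [sq]
  have hg' : |(Matrix.of g).det| ^ n ≠ 0 := pow_ne_zero _ (abs_ne_zero.2 hg)
  beta_reduce
  rw [hd, smul_smul]
  change _ = (((|(Matrix.of g).det| ^ n)⁻¹) ^ 2 * (|((Matrix.of g)⁻¹).det| ^ n)⁻¹) •
    f (Matrix.of g)⁻¹
  rw [Matrix.det_nonsing_inv, Ring.inverse_eq_inv', abs_inv, inv_pow |(Matrix.of g).det|, inv_inv]
  congr 1
  field_simp

end MatrixMeasure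

/-! ### Oscillatory integrals over matrices -/

section Decay

variable {n : ℕ} [NeZero n] {W : Type*} [NormedAddCommGroup W] [NormedSpace ℂ W]

/-- Smooth compactly supported amplitudes on the space of matrices whose support consists of
matrices with non-zero first column. -/
structure IsAmplitude (Φ : (Fin n → Fin n → ℝ) → W) : Prop where
  smooth : ContDiff ℝ ∞ Φ
  compact_support : HasCompactSupport Φ
  support_subset : tsupport Φ ⊆ {h | ∑ i, (h i 0) ^ 2 ≠ 0}

/-- The exponential of minus the quadratic function `w y·y + c·y` of the first column `y`. -/
def osc (w : ℂ) (c : Fin n → ℂ) (h : Fin n → Fin n → ℝ) : ℂ :=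
  Complex.exp (-(w * ∑ i, (h i 0 : ℂ) ^ 2) - ∑ i, c i * (h i 0 : ℂ))

/-- The coordinate direction of the `i`-th entry of the first column. -/
def colDir (i : Fin n) : Fin n → Fin n → ℝ := Pi.single i (Pi.single 0 1)

theorem continuous_osc (w : ℂ) (c : Fin n → ℂ) : Continuous (osc w c) := by
  unfold osc; fun_prop

theorem hasLineDerivAt_osc (w : ℂ) (c : Fin n → ℂ) (i : Fin n) (h : Fin n → Fin n → ℝ) :
    HasLineDerivAt ℝ (osc w c) ((-(2 * w * h i 0) - c i) * osc w c h) h (colDir i) := by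
  unfold HasLineDerivAt osc
  have hj : ∀ j, HasDerivAt (fun t : ℝ => (((h + t • colDir i) j 0 : ℝ) : ℂ))
      (if j = i then 1 else 0) 0 := by
    intro j
    have : (fun t : ℝ => (((h + t • colDir i) j 0 : ℝ) : ℂ)) =
        fun t : ℝ => (h j 0 : ℂ) + (t : ℂ) * (if j = i then 1 else 0) := by
      funext t
      by_cases hji : j = i
      · subst hji; simp [colDir]
      · simp [colDir, hji]
    rw [this]
    refine (((Complex.ofRealCLM.hasDerivAt (x := 0)).mul_const
      (if j = i then (1 : ℂ) else 0)).const_add (h j 0 : ℂ)).congr_deriv ?_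
    simp
  have h0 : ∀ j, (((h + (0 : ℝ) • colDir i) j 0 : ℝ) : ℂ) = h j 0 := by simp
  have h1 : HasDerivAt (fun t : ℝ => -(w * ∑ j, (((h + t • colDir i) j 0 : ℝ) : ℂ) ^ 2) -
      ∑ j, c j * (((h + t • colDir i) j 0 : ℝ) : ℂ))
      (-(2 * w * h i 0) - c i) 0 := by
    have hq := HasDerivAt.fun_sum (u := Finset.univ) fun j _ => (hj j).fun_pow 2
    have hl := HasDerivAt.fun_sum (u := Finset.univ) fun j _ => (hj j).const_mul (c j)
    refine (((hq.const_mul w).fun_neg).fun_sub hl).congr_deriv ?_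
    simp only [h0]
    simp
    ring
  refine (h1.cexp).congr_deriv ?_
  simp only [h0]
  ring

theorem IsAmplitude.continuous {Φ : (Fin n → Fin n → ℝ) → W} (hΦ : IsAmplitude Φ) :
    Continuous Φ := hΦ.smooth.continuous

theorem IsAmplitude.integrable_mul {Φ : (Fin n → Fin n → ℝ) → W} (hΦ : IsAmplitude Φ)
    {u : (Fin n → Fin n → ℝ) → ℂ} (hu : Continuous u) : Integrable fun h => u h • Φ h :=
  (hu.smul hΦ.continuous).integrable_of_hasCompactSupport hΦ.compact_support.smul_left

omit [NeZero n] in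
theorem contDiff_entry (i j : Fin n) : ContDiff ℝ ∞ fun h : Fin n → Fin n → ℝ => h i j :=
  contDiff_apply_apply ℝ ℝ i j

omit [NeZero n] in
theorem contDiff_of_contDiffAt_tsupport {X F : Type*} [NormedAddCommGroup X] [NormedSpace ℝ X]
    [NormedAddCommGroup F] [NormedSpace ℝ F] {f : X → F}
    (hf : ∀ x ∈ tsupport f, ContDiffAt ℝ ∞ f x) : ContDiff ℝ ∞ f := by
  refine contDiff_iff_contDiffAt.2 fun x => ?_
  by_cases hx : x ∈ tsupport f
  · exact hf x hx
  · exact contDiffAt_const.congr_of_eventuallyEq (notMem_tsupport_iff_eventuallyEq.1 hx)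

/-- Multiplying an amplitude by `y_i / (2 y·y)`, where `y` is the first column. -/
theorem IsAmplitude.smul_entry {Φ : (Fin n → Fin n → ℝ) → W} (hΦ : IsAmplitude Φ) (i : Fin n) :
    IsAmplitude fun h => (h i 0 / (2 * ∑ j, (h j 0) ^ 2)) • Φ h := by
  have hs := tsupport_smul_subset_right (fun h : Fin n → Fin n → ℝ =>
    h i 0 / (2 * ∑ j, (h j 0) ^ 2)) Φ
  refine ⟨contDiff_of_contDiffAt_tsupport fun h hh => ?_, hΦ.compact_support.smul_left,
    hs.trans hΦ.support_subset⟩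
  have h1 : ContDiffAt ℝ ∞ (fun h : Fin n → Fin n → ℝ => h i 0 / (2 * ∑ j, (h j 0) ^ 2)) h :=
    (contDiff_entry i 0).contDiffAt.div
      (contDiff_const.mul (ContDiff.sum fun j _ => (contDiff_entry j 0).pow 2)).contDiffAt
      (mul_ne_zero two_ne_zero (hΦ.support_subset (hs hh)))
  exact h1.smul hΦ.smooth.contDiffAt

theorem IsAmplitude.fderiv_apply {Φ : (Fin n → Fin n → ℝ) → W} (hΦ : IsAmplitude Φ)
    (v : Fin n → Fin n → ℝ) : IsAmplitude fun h => fderiv ℝ Φ h v where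
  smooth := (hΦ.smooth.fderiv_right (m := ∞) (by simp)).clm_apply contDiff_const
  compact_support := hΦ.compact_support.fderiv_apply ℝ v
  support_subset := (tsupport_fderiv_apply_subset ℝ v).trans hΦ.support_subset

theorem IsAmplitude.integral_osc_deriv {Ψ : (Fin n → Fin n → ℝ) → W} (hΨ : IsAmplitude Ψ)
    (w : ℂ) (c : Fin n → ℂ) (i : Fin n) :
    ∫ h, ((-(2 * w * h i 0) - c i) * osc w c h) • Ψ h =
      -∫ h, osc w c h • fderiv ℝ Ψ h (colDir i) := by
  have hco := continuous_osc w c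
  have h1 : Continuous fun h : Fin n → Fin n → ℝ => (-(2 * w * h i 0) - c i) * osc w c h := by
    fun_prop
  have hd := hΨ.fderiv_apply (colDir i)
  refine integral_bilinear_hasLineDerivAt_right_eq_neg_left_of_integrable
    (B := (ContinuousLinearMap.lsmul ℝ ℂ (E := W)).flip) (f := Ψ) (g := osc w c) (v := colDir i)
    (hd.integrable_mul hco) (hΨ.integrable_mul h1) (hΨ.integrable_mul hco) (fun h _ => ?_)
    fun h _ => hasLineDerivAt_osc w c i h
  exact ((hΨ.smooth.differentiable (by simp)) h).hasFDerivAt.hasLineDerivAt _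

/-- Integration by parts against the vector field `y / (2 y·y)` in the first column `y`, along
which the quadratic phase has constant derivative. -/
theorem IsAmplitude.integral_osc_eq {Φ : (Fin n → Fin n → ℝ) → W} (hΦ : IsAmplitude Φ)
    (w : ℂ) (c : Fin n → ℂ) :
    w • ∫ h, osc w c h • Φ h =
      ∑ i, (∫ h, osc w c h • fderiv ℝ
        (fun h => (h i 0 / (2 * ∑ j, (h j 0) ^ 2)) • Φ h) h (colDir i)) -
      ∑ i, c i • ∫ h, osc w c h • ((h i 0 / (2 * ∑ j, (h j 0) ^ 2)) • Φ h) := by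
  have hco := continuous_osc w c
  have key : ∀ i : Fin n, ∫ h, osc w c h • fderiv ℝ
        (fun h => (h i 0 / (2 * ∑ j, (h j 0) ^ 2)) • Φ h) h (colDir i) =
      ∫ h, ((2 * w * h i 0 + c i) * osc w c h) • ((h i 0 / (2 * ∑ j, (h j 0) ^ 2)) • Φ h) := by
    intro i
    have := (hΦ.smul_entry i).integral_osc_deriv w c i
    rw [eq_neg_iff_add_eq_zero, add_comm, ← eq_neg_iff_add_eq_zero] at this
    rw [this, ← integral_neg]
    congr 1
    funext h
    rw [← neg_smul]
    congr 1
    ring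
  have hi1 : ∀ i : Fin n, Integrable fun h : Fin n → Fin n → ℝ =>
      ((2 * w * h i 0 + c i) * osc w c h) • ((h i 0 / (2 * ∑ j, (h j 0) ^ 2)) • Φ h) := fun i =>
    (hΦ.smul_entry i).integrable_mul (by fun_prop)
  have hi2 : ∀ i : Fin n, Integrable fun h : Fin n → Fin n → ℝ =>
      c i • (osc w c h • ((h i 0 / (2 * ∑ j, (h j 0) ^ 2)) • Φ h)) := fun i =>
    ((hΦ.smul_entry i).integrable_mul hco).smul (c i)
  simp_rw [key, ← integral_smul]
  rw [← integral_finsetSum _ fun i _ => hi1 i, ← integral_finsetSum _ fun i _ => hi2 i,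
    ← integral_sub (integrable_finsetSum _ fun i _ => hi1 i)
      (integrable_finsetSum _ fun i _ => hi2 i)]
  congr 1
  funext h
  rw [← Finset.sum_sub_distrib]
  by_cases hh : h ∈ tsupport Φ
  · have hne : ((∑ j, (h j 0 : ℂ) ^ 2)) ≠ 0 := by exact_mod_cast hΦ.support_subset hh
    have : ∀ i, ((2 * w * h i 0 + c i) * osc w c h) • ((h i 0 / (2 * ∑ j, (h j 0) ^ 2)) • Φ h) -
        c i • (osc w c h • ((h i 0 / (2 * ∑ j, (h j 0) ^ 2)) • Φ h)) =
        ((h i 0 : ℂ) ^ 2) • ((w * osc w c h / (∑ j, (h j 0 : ℂ) ^ 2)) • Φ h) := by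
      intro i
      simp only [← Complex.coe_smul, smul_smul, ← sub_smul]
      congr 1
      push_cast
      field_simp
      ring
    simp_rw [this, ← Finset.sum_smul, smul_smul]
    congr 1
    field_simp
  · simp [image_eq_zero_of_notMem_tsupport hh]

theorem norm_osc_le {w : ℂ} (hw : 0 ≤ w.re) {c : Fin n → ℂ} (hc : ∀ i, (c i).re = 0)
    (h : Fin n → Fin n → ℝ) : ‖osc w c h‖ ≤ 1 := by
  rw [osc, Complex.norm_exp, Real.exp_le_one_iff]
  have h1 : ((∑ i, (h i 0 : ℂ) ^ 2)) = ((∑ i, (h i 0) ^ 2 : ℝ) : ℂ) := by push_cast; rfl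
  rw [h1, Complex.sub_re, Complex.neg_re, Complex.re_mul_ofReal, Complex.re_sum]
  simp only [Complex.re_mul_ofReal, hc, zero_mul, Finset.sum_const_zero, sub_zero]
  have : 0 ≤ ∑ i, (h i 0) ^ 2 := Finset.sum_nonneg fun i _ => sq_nonneg _
  nlinarith [mul_nonneg hw this]

/-- Non-stationary phase: rapid decay in the scale `r`, uniformly in the quadratic
coefficient `z`. -/
theorem IsAmplitude.exists_norm_integral_osc_le {δ : ℝ} (hδ : 0 < δ) {c : Fin n → ℂ}
    (hc : ∀ i, (c i).re = 0) (N : ℕ) :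
    ∀ {Φ : (Fin n → Fin n → ℝ) → W}, IsAmplitude Φ → ∃ C : ℝ, 0 ≤ C ∧
      ∀ z : ℂ, 0 ≤ z.re → δ ≤ ‖z‖ → ∀ r : ℝ, 1 ≤ r →
      ‖∫ h, osc (z * r ^ 2) (fun i => r * c i) h • Φ h‖ ≤ C / r ^ N := by
  have hre : ∀ {z : ℂ} {r : ℝ}, 0 ≤ z.re → 0 ≤ (z * (r : ℂ) ^ 2).re := fun {z r} hz => by
    rw [← Complex.ofReal_pow, Complex.re_mul_ofReal]; positivity
  have hcr : ∀ (r : ℝ) i, ((r : ℂ) * c i).re = 0 := fun r i => by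
    rw [Complex.re_ofReal_mul, hc, mul_zero]
  induction N with
  | zero =>
    intro Φ hΦ
    refine ⟨∫ h, ‖Φ h‖, integral_nonneg fun h => norm_nonneg _, fun z hz _ r hr => ?_⟩
    rw [pow_zero, div_one]
    refine norm_integral_le_of_norm_le
      (hΦ.continuous.norm.integrable_of_hasCompactSupport hΦ.compact_support.norm)
      (ae_of_all _ fun h => ?_)
    rw [norm_smul]
    exact mul_le_of_le_one_left (norm_nonneg _) (norm_osc_le (hre hz) (hcr r) h)
  | succ N ih =>
    intro Φ hΦ
    choose A hA0 hA using fun i => ih ((hΦ.smul_entry i).fderiv_apply (colDir i))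
    choose B hB0 hB using fun i => ih (hΦ.smul_entry i)
    refine ⟨(∑ i, A i + ∑ i, ‖c i‖ * B i) / δ, div_nonneg (add_nonneg (Finset.sum_nonneg fun i _ => hA0 i)
      (Finset.sum_nonneg fun i _ => mul_nonneg (norm_nonneg _) (hB0 i))) hδ.le, fun z hz hzδ r hr => ?_⟩
    have hr0 : 0 < r := one_pos.trans_le hr
    have h1 := congrArg norm (hΦ.integral_osc_eq (z * r ^ 2) (fun i => r * c i))
    rw [norm_smul, norm_mul, norm_pow, Complex.norm_real, Real.norm_of_nonneg hr0.le] at h1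
    set I := ‖∫ h, osc (z * r ^ 2) (fun i => r * c i) h • Φ h‖
    have h2 : ‖z‖ * r ^ 2 * I ≤ ∑ i, A i / r ^ N + ∑ i, r * ‖c i‖ * (B i / r ^ N) := by
      rw [h1]
      refine (norm_sub_le _ _).trans (add_le_add ?_ ?_)
      · exact (norm_sum_le _ _).trans (Finset.sum_le_sum fun i _ => hA i z hz hzδ r hr)
      · refine (norm_sum_le _ _).trans (Finset.sum_le_sum fun i _ => ?_)
        rw [norm_smul, norm_mul, Complex.norm_real, Real.norm_of_nonneg hr0.le]
        gcongr
        exact hB i z hz hzδ r hr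
    have h3 : ∑ i, A i / r ^ N + ∑ i, r * ‖c i‖ * (B i / r ^ N) ≤
        r * ((∑ i, A i + ∑ i, ‖c i‖ * B i) / r ^ N) := by
      rw [add_div, mul_add, Finset.sum_div, Finset.sum_div, Finset.mul_sum, Finset.mul_sum]
      refine add_le_add (Finset.sum_le_sum fun i _ => ?_) (le_of_eq (Finset.sum_congr rfl
        fun i _ => by ring))
      exact le_mul_of_one_le_left (div_nonneg (hA0 i) (by positivity)) hr
    have h4 : δ * r ^ 2 * I ≤ r * ((∑ i, A i + ∑ i, ‖c i‖ * B i) / r ^ N) :=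
      (mul_le_mul_of_nonneg_right (mul_le_mul_of_nonneg_right hzδ (by positivity))
        (norm_nonneg _)).trans (h2.trans h3)
    rw [div_div, le_div_iff₀ (by positivity), pow_succ]
    rw [← mul_div_assoc, le_div_iff₀ (by positivity)] at h4
    refine le_of_mul_le_mul_left (le_of_eq_of_le ?_ h4) hr0
    ring

end Decay

/-! ### Gaussian test functions and Hecke operators in the inverted variable -/

section Hecke

variable {n : ℕ}

/-- The function `x ↦ exp(-π z x·x - 2πi b·x)`. -/
def gauss (z : ℂ) (b x : E n) : ℂ :=
  Complex.exp (-(Real.pi * z * ‖x‖ ^ 2) - 2 * Real.pi * Complex.I * (inner ℝ b x : ℝ))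

theorem secondDegree_eq_gauss (a : ℝ) (b : E n) :
    secondDegree a b = gauss (Complex.I * a) b := by
  funext x
  rw [secondDegree, psi, gauss, real_inner_self_eq_norm_sq]
  congr 1
  push_cast
  ring

theorem continuous_gauss (z : ℂ) (b : E n) : Continuous (gauss z b) := by
  unfold gauss
  fun_prop

theorem norm_gauss (z : ℂ) (b x : E n) :
    ‖gauss z b x‖ = Real.exp (-(Real.pi * z.re * ‖x‖ ^ 2)) := by
  rw [gauss, Complex.norm_exp]
  congr 1
  have h1 : (Real.pi * z * (‖x‖ : ℂ) ^ 2 : ℂ) = z * ((Real.pi * ‖x‖ ^ 2 : ℝ) : ℂ) := by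
    push_cast; ring
  have h2 : (2 * Real.pi * Complex.I * (inner ℝ b x : ℝ) : ℂ) =
      ((2 * Real.pi * inner ℝ b x : ℝ) : ℂ) * Complex.I := by push_cast; ring
  rw [h1, h2, Complex.sub_re, Complex.neg_re, Complex.re_mul_ofReal, Complex.re_ofReal_mul,
    Complex.I_re]
  ring

theorem norm_gauss_le_one {z : ℂ} (hz : 0 ≤ z.re) (b x : E n) : ‖gauss z b x‖ ≤ 1 := by
  rw [norm_gauss, Real.exp_le_one_iff]
  have := Real.pi_pos
  have : 0 ≤ Real.pi * z.re * ‖x‖ ^ 2 := by positivity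
  linarith

theorem continuous_gauss_left (b x : E n) : Continuous fun z => gauss z b x := by
  unfold gauss
  fun_prop

theorem gauss_smul_act_e₁ [NeZero n] (z : ℂ) (b : E n) (r : ℝ) (h : Mat n) :
    gauss z b (r • act h (e₁ n)) =
      osc (Real.pi * z * r ^ 2) (fun i => r * (2 * Real.pi * Complex.I * b i)) h := by
  have hcoord : ∀ i, act h (e₁ n) i = h i 0 := fun i => by
    simp [act, e₁, Matrix.toLpLin_apply]
  have h1 : (‖r • act h (e₁ n)‖ : ℂ) ^ 2 = r ^ 2 * ∑ i, (h i 0 : ℂ) ^ 2 := by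
    have : ‖r • act h (e₁ n)‖ ^ 2 = r ^ 2 * ∑ i, (h i 0) ^ 2 := by
      rw [norm_smul, mul_pow, EuclideanSpace.norm_sq_eq]
      simp [hcoord]
    exact_mod_cast this
  have h2 : inner ℝ b (r • act h (e₁ n)) = r * ∑ i, b i * h i 0 := by
    rw [inner_smul_right, PiLp.inner_apply]
    simp [hcoord, mul_comm]
  unfold gauss osc
  rw [h1, h2]
  congr 1
  push_cast
  simp only [Finset.mul_sum]
  congr 1
  · congr 1
    exact Finset.sum_congr rfl fun i _ => by ring
  · exact Finset.sum_congr rfl fun i _ => by ring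

/-- An invertible matrix distorts norms by factors that are bounded on compact sets. -/
theorem exists_norm_act_bounds {S : Set (Mat n)} (hS : IsCompact S)
    (hdet : ∀ h ∈ S, h.det ≠ 0) :
    ∃ m M : ℝ, 0 < m ∧ 0 < M ∧ ∀ h ∈ S, ∀ x : E n, m * ‖x‖ ≤ ‖act h x‖ ∧ ‖act h x‖ ≤ M * ‖x‖ := by
  have hK : IsCompact (S ×ˢ Metric.sphere (0 : E n) 1) := hS.prod (isCompact_sphere _ _)
  have hc : ContinuousOn (fun p : Mat n × E n => ‖act p.1 p.2‖) (S ×ˢ Metric.sphere (0 : E n) 1) :=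
    continuous_act.norm.continuousOn
  have hpos : ∀ p ∈ S ×ˢ Metric.sphere (0 : E n) 1, 0 < ‖act p.1 p.2‖ := by
    rintro ⟨h, x⟩ ⟨hh, hx⟩
    refine norm_pos_iff.2 fun h0 => ?_
    have : x = 0 := by
      have h1 := act_mul h⁻¹ h x
      rw [Matrix.nonsing_inv_mul _ (Ne.isUnit (hdet h hh)), act_one', show act h x = 0 from h0] at h1
      rw [h1]; simp [act]
    simp [this] at hx
  obtain ⟨m, hm, hmle⟩ : ∃ m : ℝ, 0 < m ∧ ∀ p ∈ S ×ˢ Metric.sphere (0 : E n) 1,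
      m ≤ ‖act p.1 p.2‖ := hK.exists_forall_le' hc hpos
  obtain ⟨M, hM⟩ := hK.bddAbove_image hc
  refine ⟨m, max M 1, hm, by positivity, fun h hh x => ?_⟩
  rcases eq_or_ne x 0 with rfl | hx
  · simp [act]
  have hx' := norm_pos_iff.2 hx
  have hu : ‖x‖⁻¹ • x ∈ Metric.sphere (0 : E n) 1 := by simp [norm_smul, hx'.ne']
  have he : ‖act h x‖ = ‖act h (‖x‖⁻¹ • x)‖ * ‖x‖ := by
    rw [act_smul', norm_smul, norm_inv, norm_norm]; field_simp
  rw [he]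
  constructor
  · gcongr
    exact hmle (h, _) ⟨hh, hu⟩
  · gcongr
    exact (hM ⟨(h, _), ⟨hh, hu⟩, rfl⟩).trans (le_max_left _ _)

theorem measurable_act_inv :
    Measurable fun p : E n × (Fin n → Fin n → ℝ) => act (Matrix.of p.2)⁻¹ p.1 := by
  have h1 : (fun p : E n × (Fin n → Fin n → ℝ) => act (Matrix.of p.2)⁻¹ p.1) =
      fun p => (Matrix.of p.2).det⁻¹ • act (Matrix.of p.2).adjugate p.1 := by
    funext p
    rw [Matrix.inv_def, Ring.inverse_eq_inv']
    simp [act]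
  have hof : Continuous fun p : E n × (Fin n → Fin n → ℝ) => (Matrix.of p.2 : Mat n) :=
    continuous_snd
  rw [h1]
  exact hof.matrix_det.measurable.inv.smul (hof.matrix_adjugate.act continuous_fst).measurable

theorem continuous_act_left (x : E n) :
    Continuous fun h : Fin n → Fin n → ℝ => act (Matrix.of h : Mat n) x :=
  Continuous.act (f := fun h : Fin n → Fin n → ℝ => (Matrix.of h : Mat n)) continuous_id
    continuous_const

theorem continuous_act_right (h : Mat n) : Continuous fun x : E n => act h x :=
  Continuous.act continuous_const continuous_id

theorem continuous_act_swap :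
    Continuous fun p : E n × (Fin n → Fin n → ℝ) => act (Matrix.of p.2 : Mat n) p.1 :=
  Continuous.act (f := fun p : E n × (Fin n → Fin n → ℝ) => (Matrix.of p.2 : Mat n)) continuous_snd
    continuous_fst

section Smooth

attribute [local instance] Matrix.linftyOpNormedRing Matrix.linftyOpNormedAlgebra

theorem contDiffAt_matrix_inv {h : Fin n → Fin n → ℝ} (hh : (Matrix.of h).det ≠ 0) :
    ContDiffAt ℝ ∞ (fun g : Fin n → Fin n → ℝ =>
      (Matrix.of.symm (Matrix.of g)⁻¹ : Fin n → Fin n → ℝ)) h := by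
  let e : (Fin n → Fin n → ℝ) ≃L[ℝ] Mat n :=
    (Matrix.ofLinearEquiv ℝ).toContinuousLinearEquiv
  have hu : IsUnit (Matrix.of h) := (Matrix.isUnit_iff_isUnit_det _).2 hh.isUnit
  have h1 : ContDiffAt ℝ ∞ (Ring.inverse : Mat n → Mat n) (e h) :=
    contDiffAt_ringInverse ℝ hu.unit
  have h3 := e.symm.contDiff.contDiffAt.comp h (h1.comp h e.contDiff.contDiffAt)
  refine h3.congr_of_eventuallyEq (Eventually.of_forall fun g => ?_)
  change _ = Ring.inverse (Matrix.of g)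
  rw [← Matrix.nonsing_inv_eq_ringInverse]
  rfl

end Smooth

theorem contDiff_matrix_det : ContDiff ℝ ∞ fun h : Fin n → Fin n → ℝ => (Matrix.of h).det := by
  simp only [Matrix.det_apply]
  refine ContDiff.sum fun σ _ => ContDiff.const_smul _ ?_
  exact contDiff_prod fun i _ => contDiff_entry _ _

variable [NeZero n] {V : Type*} [NormedAddCommGroup V] [NormedSpace ℂ V]
  {π : Representation ℂ (K n) V} {v₀ : V} {φ : Mat n → V →L[ℂ] V}

/-- The density `|det h|^{-n} φ(h⁻¹)` of a Hecke operator in the variable `h = g⁻¹`. -/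
def invDensity (φ : Mat n → V →L[ℂ] V) (h : Fin n → Fin n → ℝ) : V →L[ℂ] V :=
  (|(Matrix.of h).det| ^ n)⁻¹ • φ (Matrix.of h)⁻¹

omit [NeZero n] in
theorem exists_compact_support_invDensity (hφ : IsHecke π φ) :
    ∃ S : Set (Fin n → Fin n → ℝ), IsCompact S ∧ (∀ h ∈ S, (Matrix.of h).det ≠ 0) ∧
      tsupport (invDensity φ) ⊆ S := by
  let ι : (Fin n → Fin n → ℝ) → (Fin n → Fin n → ℝ) :=
    fun g => Matrix.of.symm (Matrix.of g)⁻¹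
  have hcomp : IsCompact (ι '' (tsupport φ)) := by
    refine IsCompact.image_of_continuousOn (s := (tsupport φ : Set (Fin n → Fin n → ℝ)))
      hφ.compact_support fun g hg => ?_
    exact (contDiffAt_matrix_inv (hφ.support_subset hg)).continuousAt.continuousWithinAt
  refine ⟨_, hcomp, ?_, closure_minimal ?_ hcomp.isClosed⟩
  · rintro _ ⟨g, hg, rfl⟩
    exact (Matrix.isUnit_nonsing_inv_det _ (Ne.isUnit (hφ.support_subset hg))).ne_zero
  · intro h hh
    have h1 : (Matrix.of h)⁻¹ ∈ tsupport φ := by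
      refine subset_tsupport _ fun h0 => hh ?_
      simp [invDensity, h0]
    have h2 : IsUnit (Matrix.of h).det :=
      (Matrix.isUnit_nonsing_inv_det_iff).1 (Ne.isUnit (hφ.support_subset h1))
    exact ⟨_, h1, congrArg Matrix.of.symm (Matrix.nonsing_inv_nonsing_inv _ h2)⟩

theorem isAmplitude_invDensity (hφ : IsHecke π φ) : IsAmplitude (invDensity φ) := by
  obtain ⟨S, hS, hdet, hsub⟩ := exists_compact_support_invDensity hφ
  refine ⟨contDiff_of_contDiffAt_tsupport fun h hh => ?_,
    hS.of_isClosed_subset (isClosed_tsupport _) hsub, fun h hh h0 => ?_⟩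
  · have hd := hdet h (hsub hh)
    have h1 : ContDiffAt ℝ ∞ (fun h : Fin n → Fin n → ℝ => (|(Matrix.of h).det| ^ n)⁻¹) h :=
      ((ContDiffAt.abs contDiff_matrix_det.contDiffAt hd).pow n).inv
        (pow_ne_zero _ (abs_ne_zero.2 hd))
    exact h1.smul (hφ.smooth.contDiffAt.comp h (contDiffAt_matrix_inv hd))
  · refine hdet h (hsub hh) (Matrix.det_eq_zero_of_column_eq_zero 0 fun i => ?_)
    have := (Finset.sum_eq_zero_iff_of_nonneg fun i _ => sq_nonneg (h i 0)).1 h0 i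
      (Finset.mem_univ i)
    exact pow_eq_zero_iff two_ne_zero |>.1 this

theorem lamScalar_eq (φ : Mat n → V →L[ℂ] V) (f : E n → ℂ) (x : E n) :
    lamScalar φ f x = ∫ h : Fin n → Fin n → ℝ, f (act (Matrix.of h) x) • invDensity φ h := by
  have := integral_comp_inv (n := n) fun g => f (act g x) • φ g⁻¹
  rw [lamScalar]
  simp_rw [invDensity, smul_comm (f _) ((_ : ℝ)) (_ : V →L[ℂ] V)]
  rw [← this]
  congr 1
  funext g
  by_cases hg : (Matrix.of g).det = 0
  · simp [hg, NeZero.ne n]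
  · rw [Matrix.nonsing_inv_nonsing_inv _ (Ne.isUnit hg)]

omit [NeZero n] in
theorem lamVector_heckeStar_eq (φ : Mat n → V →L[ℂ] V) (F : E n → V) (x : E n) :
    lamVector (heckeStar φ) F x = ∫ h : Fin n → Fin n → ℝ,
      |(Matrix.of h).det|⁻¹ • invDensity φ h (F (act (Matrix.of h)⁻¹ x)) := by
  rw [lamVector]
  congr 1
  funext h
  simp only [heckeStar, invDensity, smul_apply]
  rw [smul_comm]

variable [FiniteDimensional ℂ V]

omit [NeZero n] in
theorem invDensity_mul_inv (hφ : IsHecke π φ) (k : K n) (h : Fin n → Fin n → ℝ) :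
    invDensity φ (Matrix.of h * ((k⁻¹ : K n) : Mat n)) = piL π k ∘L invDensity φ h := by
  ext v
  have h1 := hφ.equivariant k 1 (Matrix.of h)⁻¹ v
  have h2 : |(Matrix.of h * ((k⁻¹ : K n) : Mat n)).det| = |(Matrix.of h).det| := by
    rw [Matrix.det_mul, abs_mul, abs_det_coe, mul_one]
  have h3 : (Matrix.of h * ((k⁻¹ : K n) : Mat n))⁻¹ = (k : Mat n) * (Matrix.of h)⁻¹ := by
    rw [Matrix.mul_inv_rev, ← coe_inv_eq_inv, inv_inv]
  change ((|(Matrix.of h * ((k⁻¹ : K n) : Mat n)).det| ^ n)⁻¹ •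
    φ (Matrix.of h * ((k⁻¹ : K n) : Mat n))⁻¹) v = π k ((_ • φ _) v)
  rw [h2, h3, smul_apply, smul_apply,
    ← Complex.coe_smul, ← Complex.coe_smul, map_smul]
  simpa using congrArg _ h1

theorem lamScalar_gauss_smul_act (hφ : IsHecke π φ) (z : ℂ) (b : E n) (r : ℝ) (k : K n) :
    lamScalar φ (gauss z b) (r • act (k : Mat n) (e₁ n)) =
      piL π k ∘L ∫ h : Fin n → Fin n → ℝ,
        osc (Real.pi * z * r ^ 2) (fun i => r * (2 * Real.pi * Complex.I * b i)) h •
          invDensity φ h := by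
  have := FiniteDimensional.complete ℂ V
  rw [lamScalar_eq]
  refine (integral_comp_mul_orthogonal 1 k⁻¹ fun h : Mat n =>
    gauss z b (act h (r • act (k : Mat n) (e₁ n))) • invDensity φ h).symm.trans ?_
  have hi := (isAmplitude_invDensity hφ).integrable_mul (continuous_osc (Real.pi * z * r ^ 2)
    (fun i => r * (2 * Real.pi * Complex.I * b i)))
  refine Eq.trans ?_ (ContinuousLinearMap.integral_comp_comm
    (ContinuousLinearMap.compL ℂ V V V (piL π k)) hi)
  congr 1
  funext h
  rw [Submonoid.coe_one, one_mul, invDensity_mul_inv hφ, act_smul', ← act_mul, mul_assoc,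
    ← Submonoid.coe_mul, inv_mul_cancel, Submonoid.coe_one, mul_one, gauss_smul_act_e₁]
  simp
  rfl

/-- `λ(φ)` of a Gaussian decays rapidly, uniformly as the Gaussian degenerates to a second degree
character. -/
theorem exists_norm_lamScalar_gauss_le (hπ : ∀ v : V, Continuous fun k : K n => π k v)
    (hφ : IsHecke π φ) (b : E n) {δ : ℝ} (hδ : 0 < δ) (N : ℕ) :
    ∃ C : ℝ, 0 ≤ C ∧ ∀ z : ℂ, 0 ≤ z.re → δ ≤ ‖z‖ → ∀ x : E n, x ≠ 0 →
      ‖lamScalar φ (gauss z b) x‖ ≤ C * min 1 (‖x‖ ^ N)⁻¹ := by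
  obtain ⟨A, hA, hAk⟩ := exists_norm_piL_le hπ
  have hamp := isAmplitude_invDensity hφ
  obtain ⟨B, hB, hBz⟩ := hamp.exists_norm_integral_osc_le (mul_pos Real.pi_pos hδ)
    (c := fun i => 2 * Real.pi * Complex.I * b i) (by simp) N
  have hint : 0 ≤ ∫ h, ‖invDensity φ h‖ := integral_nonneg fun h => norm_nonneg _
  refine ⟨max (A * B) (∫ h, ‖invDensity φ h‖), le_max_of_le_right hint, fun z hz hzδ x hx0 => ?_⟩
  have h0 : ‖lamScalar φ (gauss z b) x‖ ≤ ∫ h, ‖invDensity φ h‖ := by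
    rw [lamScalar_eq]
    refine norm_integral_le_of_norm_le
      (hamp.continuous.norm.integrable_of_hasCompactSupport hamp.compact_support.norm)
      (ae_of_all _ fun h => ?_)
    rw [norm_smul]
    exact mul_le_of_le_one_left (norm_nonneg _) (norm_gauss_le_one hz b _)
  rcases le_or_gt ‖x‖ 1 with hx | hx
  · rw [min_eq_left ((one_le_inv₀ (by positivity)).2 (pow_le_one₀ (norm_nonneg _) hx)), mul_one]
    exact h0.trans (le_max_right _ _)
  · have h1 := hBz (Real.pi * z) (by rw [Complex.re_ofReal_mul]; have := Real.pi_pos; positivity)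
      (by rw [norm_mul, Complex.norm_real, Real.norm_of_nonneg Real.pi_pos.le]; gcongr) ‖x‖ hx.le
    rw [min_eq_right (inv_le_one_of_one_le₀ (one_le_pow₀ hx.le)), ← div_eq_mul_inv]
    conv_lhs => rw [← norm_smul_rot x, lamScalar_gauss_smul_act hφ]
    refine (ContinuousLinearMap.opNorm_comp_le _ _).trans ?_
    calc _ ≤ A * (B / ‖x‖ ^ N) := mul_le_mul (hAk _) h1 (norm_nonneg _) hA.le
      _ ≤ _ := by rw [← mul_div_assoc]; gcongr; exact le_max_left _ _

end Hecke

/-! ### The weak Mellin transform of a Gaussian -/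

section Mellin

variable {n : ℕ} [NeZero n]

theorem ae_ne_zero : ∀ᵐ x : E n, x ≠ 0 := by
  have : Nontrivial (E n) := ⟨⟨e₁ n, 0, fun h => by simpa [h] using norm_e₁ (n := n)⟩⟩
  exact measure_eq_zero_iff_ae_notMem.1 (measure_singleton (0 : E n))

theorem integrable_norm_rpow_mul {σ : ℝ} {f : ℝ → ℝ}
    (hf : IntegrableOn (fun y => y ^ (σ - 1) * f y) (Ioi 0)) :
    Integrable fun x : E n => ‖x‖ ^ (σ - n) * f ‖x‖ := by
  have : Nontrivial (E n) := ⟨⟨e₁ n, 0, fun h => by simpa [h] using norm_e₁ (n := n)⟩⟩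
  refine (integrable_fun_norm_addHaar (volume : Measure (E n))
    (f := fun y => y ^ (σ - n) * f y)).2 (hf.congr_fun (fun y hy => ?_) measurableSet_Ioi)
  have h1 : 1 ≤ n := NeZero.one_le
  rw [smul_eq_mul, ← mul_assoc, finrank_euclideanSpace_fin, ← Real.rpow_natCast,
    ← Real.rpow_add hy]
  push_cast [h1]
  congr 2
  ring

theorem integrable_norm_rpow_mul_min {σ : ℝ} (hσ : 0 < σ) {N : ℕ} (hN : σ < N) :
    Integrable fun x : E n => ‖x‖ ^ (σ - n) * min 1 (‖x‖ ^ N)⁻¹ := by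
  refine integrable_norm_rpow_mul (f := fun y => min 1 (y ^ N)⁻¹) ?_
  rw [← Ioc_union_Ioi_eq_Ioi (zero_le_one' ℝ)]
  have hN' : N ≠ 0 := by rintro rfl; simp at hN; linarith
  refine IntegrableOn.union ?_ ?_
  · have h1 : IntegrableOn (fun y : ℝ => y ^ (σ - 1)) (Ioc 0 1) :=
      (intervalIntegrable_iff_integrableOn_Ioc_of_le zero_le_one).1
        (intervalIntegral.intervalIntegrable_rpow' (by linarith))
    refine h1.congr_fun (fun y hy => ?_) measurableSet_Ioc
    rw [min_eq_left ((one_le_inv₀ (pow_pos hy.1 _)).2 (pow_le_one₀ hy.1.le hy.2)), mul_one]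
  · have h1 : IntegrableOn (fun y : ℝ => y ^ (σ - 1 - N)) (Ioi 1) :=
      integrableOn_Ioi_rpow_of_lt (by linarith) one_pos
    refine h1.congr_fun (fun y (hy : 1 < y) => ?_) measurableSet_Ioi
    beta_reduce
    rw [min_eq_right (inv_le_one_of_one_le₀ (one_le_pow₀ hy.le)),
      Real.rpow_sub (by linarith), Real.rpow_natCast, div_eq_mul_inv]

theorem integrable_norm_rpow_mul_exp {σ c : ℝ} (hσ : 0 < σ) (hc : 0 < c) :
    Integrable fun x : E n => ‖x‖ ^ (σ - n) * Real.exp (-c * ‖x‖ ^ 2) :=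
  integrable_norm_rpow_mul (f := fun y => Real.exp (-c * y ^ 2))
    (integrableOn_rpow_mul_exp_neg_mul_sq hc (by linarith))

variable {V : Type*} [NormedAddCommGroup V] [NormedSpace ℂ V] [FiniteDimensional ℂ V]
  {π : Representation ℂ (K n) V} {v₀ : V} {φ : Mat n → V →L[ℂ] V}

theorem continuous_lamScalar (hφ : IsHecke π φ) {f : E n → ℂ} (hf : Continuous f)
    (hf1 : ∀ x, ‖f x‖ ≤ 1) : Continuous (lamScalar φ f) := by
  have hamp := isAmplitude_invDensity hφ
  have he : lamScalar φ f = fun x => ∫ h : Fin n → Fin n → ℝ,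
      f (act (Matrix.of h) x) • invDensity φ h := funext fun x => lamScalar_eq φ f x
  rw [he]
  refine continuous_of_dominated (bound := fun h => ‖invDensity φ h‖) (fun x => ?_) (fun x => ?_)
    (hamp.continuous.norm.integrable_of_hasCompactSupport hamp.compact_support.norm)
    (ae_of_all _ fun h => ?_)
  · exact ((hf.comp (continuous_act_left x)).smul
      hamp.continuous).aestronglyMeasurable
  · refine ae_of_all _ fun h => ?_
    rw [norm_smul]
    exact mul_le_of_le_one_left (norm_nonneg _) (hf1 _)
  · exact (hf.comp (continuous_act_right (Matrix.of h))).smul continuous_const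

theorem aestronglyMeasurable_mellinIntegrand (hπ : ∀ v : V, Continuous fun k : K n => π k v)
    (hfix : IsFixedByStabilizer π v₀) {F : E n → V →L[ℂ] V} (hF : Continuous F) (s : ℂ) :
    AEStronglyMeasurable (mellinIntegrand π v₀ F s) := by
  have h1 : Measurable fun x : E n => (‖x‖ ^ n)⁻¹ := by fun_prop
  exact (h1.stronglyMeasurable.smul (isBoundedBilinearMap_apply.continuous.comp_stronglyMeasurable
    (hF.stronglyMeasurable.prodMk (stronglyMeasurable_nu hπ hfix s)))).aestronglyMeasurable

omit [FiniteDimensional ℂ V] in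
theorem norm_mellinIntegrand_le {C : ℝ}
    (hC : ∀ (s : ℂ) (x : E n), x ≠ 0 → ‖nu π v₀ s x‖ ≤ C * ‖x‖ ^ s.re)
    (F : E n → V →L[ℂ] V) (s : ℂ) {x : E n} (hx : x ≠ 0) :
    ‖mellinIntegrand π v₀ F s x‖ ≤ ‖F x‖ * (C * ‖x‖ ^ (s.re - n)) := by
  rw [mellinIntegrand, ← ContinuousLinearMap.map_smul_of_tower, norm_pow_inv_smul_nu s hx]
  refine ((F x).le_opNorm _).trans ?_
  gcongr
  simpa using hC (s - n) x hx

/-- The Mellin integrands of `λ(φ)` of Gaussians have a common integrable majorant. -/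
theorem exists_bound_mellinIntegrand (hπ : ∀ v : V, Continuous fun k : K n => π k v)
    (hφ : IsHecke π φ) (b : E n) {δ : ℝ} (hδ : 0 < δ) {s : ℂ} (hs : 0 < s.re) :
    ∃ B : E n → ℝ, Integrable B ∧ ∀ z : ℂ, 0 ≤ z.re → δ ≤ ‖z‖ → ∀ᵐ x : E n,
      ‖mellinIntegrand π v₀ (lamScalar φ (gauss z b)) s x‖ ≤ B x := by
  obtain ⟨N, hN⟩ := exists_nat_gt s.re
  obtain ⟨C, hC, hCnu⟩ := exists_norm_nu_le (v₀ := v₀) hπ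
  obtain ⟨A, hA, hAz⟩ := exists_norm_lamScalar_gauss_le hπ hφ b hδ N
  refine ⟨fun x => A * C * (‖x‖ ^ (s.re - n) * min 1 (‖x‖ ^ N)⁻¹),
    (integrable_norm_rpow_mul_min hs hN).const_mul _, fun z hz hzδ => ?_⟩
  filter_upwards [ae_ne_zero] with x hx
  calc _ ≤ ‖lamScalar φ (gauss z b) x‖ * (C * ‖x‖ ^ (s.re - n)) :=
        norm_mellinIntegrand_le hCnu _ s hx
    _ ≤ (A * min 1 (‖x‖ ^ N)⁻¹) * (C * ‖x‖ ^ (s.re - n)) := by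
        gcongr
        exact hAz z hz hzδ x hx
    _ = _ := by ring

theorem integrable_mellinIntegrand (hπ : ∀ v : V, Continuous fun k : K n => π k v)
    (hfix : IsFixedByStabilizer π v₀) (hφ : IsHecke π φ) (b : E n) {z : ℂ} (hz : 0 ≤ z.re)
    (hz0 : z ≠ 0) {s : ℂ} (hs : 0 < s.re) :
    Integrable (mellinIntegrand π v₀ (lamScalar φ (gauss z b)) s) := by
  obtain ⟨B, hB, hBz⟩ := exists_bound_mellinIntegrand (v₀ := v₀) hπ hφ b (norm_pos_iff.2 hz0) hs
  exact hB.mono' (aestronglyMeasurable_mellinIntegrand hπ hfix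
    (continuous_lamScalar hφ (continuous_gauss z b) (norm_gauss_le_one hz b)) s) (hBz z hz le_rfl)

/-- The Mellin transform of `λ(φ)` of a Gaussian is continuous up to the imaginary axis. -/
theorem tendsto_mellin_lamScalar_gauss (hπ : ∀ v : V, Continuous fun k : K n => π k v)
    (hfix : IsFixedByStabilizer π v₀) (hφ : IsHecke π φ) (b : E n) {z : ℂ} {u : ℕ → ℂ}
    (hu : Tendsto u atTop (𝓝 z)) (hz0 : z ≠ 0) (hure : ∀ j, 0 ≤ (u j).re)
    {s : ℂ} (hs : 0 < s.re) :
    Tendsto (fun j => mellin π v₀ (lamScalar φ (gauss (u j) b)) s) atTop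
      (𝓝 (mellin π v₀ (lamScalar φ (gauss z b)) s)) := by
  have hzn := norm_pos_iff.2 hz0
  have hamp := isAmplitude_invDensity hφ
  obtain ⟨B, hB, hBz⟩ := exists_bound_mellinIntegrand (v₀ := v₀) hπ hφ b (half_pos hzn) hs
  have hev : ∀ᶠ j in atTop, ‖z‖ / 2 ≤ ‖u j‖ :=
    (hu.norm.eventually (lt_mem_nhds (half_lt_self hzn))).mono fun j h => h.le
  refine tendsto_integral_filter_of_dominated_convergence B (Eventually.of_forall fun j => ?_)
    (hev.mono fun j hj => hBz (u j) (hure j) hj) hB (ae_of_all _ fun x => ?_)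
  · exact aestronglyMeasurable_mellinIntegrand hπ hfix
      (continuous_lamScalar hφ (continuous_gauss _ b) (norm_gauss_le_one (hure j) b)) s
  · have h1 : Tendsto (fun j => lamScalar φ (gauss (u j) b) x) atTop
        (𝓝 (lamScalar φ (gauss z b) x)) := by
      simp_rw [lamScalar_eq]
      refine tendsto_integral_of_dominated_convergence (fun h => ‖invDensity φ h‖) (fun j => ?_)
        (hamp.continuous.norm.integrable_of_hasCompactSupport hamp.compact_support.norm)
        (fun j => ae_of_all _ fun h => ?_) (ae_of_all _ fun h => ?_)
      · exact (((continuous_gauss (u j) b).comp (continuous_act_left x)).smul hamp.continuous).aestronglyMeasurable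
      · rw [norm_smul]
        exact mul_le_of_le_one_left (norm_nonneg _) (norm_gauss_le_one (hure j) b _)
      · exact (((continuous_gauss_left b _).tendsto z).comp hu).smul_const _
    exact ((ContinuousLinearMap.apply ℂ V (nu π v₀ s x)).continuous.tendsto _ |>.comp h1).const_smul
      ((‖x‖ ^ n)⁻¹ : ℝ)

theorem integrable_gauss_mul {b : E n} {z : ℂ} (hz : 0 < z.re) {σ : ℝ} (hσ : 0 < σ) :
    Integrable fun x : E n => ‖gauss z b x‖ * ‖x‖ ^ (σ - n) := by
  have h := integrable_norm_rpow_mul_exp (n := n) hσ (mul_pos Real.pi_pos hz)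
  refine h.congr (ae_of_all _ fun x => ?_)
  beta_reduce
  rw [norm_gauss]
  ring_nf

theorem rpow_le_add_of_mem_Icc {a b t : ℝ} (ha : 0 < a) (h1 : a ≤ t) (h2 : t ≤ b) (p : ℝ) :
    t ^ p ≤ a ^ p + b ^ p := by
  rcases le_total 0 p with hp | hp
  · exact (Real.rpow_le_rpow (ha.le.trans h1) h2 hp).trans
      (le_add_of_nonneg_left (Real.rpow_nonneg ha.le _))
  · exact (Real.rpow_le_rpow_of_nonpos ha h1 hp).trans
      (le_add_of_nonneg_right (Real.rpow_nonneg (ha.le.trans (h1.trans h2)) _))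

theorem integrable_gauss_act_smul_nu
    (hπ : ∀ v : V, Continuous fun k : K n => π k v)
    (hfix : IsFixedByStabilizer π v₀) (hφ : IsHecke π φ) (b : E n) {z : ℂ} (hz : 0 < z.re)
    {s : ℂ} (hs : 0 < s.re) :
    Integrable (fun p : E n × (Fin n → Fin n → ℝ) =>
      gauss z b (act (Matrix.of p.2) p.1) • invDensity φ p.2 (nu π v₀ (s - n) p.1))
      (volume.prod volume) := by
  have hamp := isAmplitude_invDensity hφ
  obtain ⟨S, hS, hdet, hsub⟩ := exists_compact_support_invDensity hφ
  obtain ⟨m, M, hm, hM, hbd⟩ := exists_norm_act_bounds (n := n) hS hdet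
  obtain ⟨C, hC, hCnu⟩ := exists_norm_nu_le (v₀ := v₀) hπ
  have hCnu' : ∀ x : E n, x ≠ 0 → ‖nu π v₀ (s - n) x‖ ≤ C * ‖x‖ ^ (s.re - n) := fun x hx => by
    simpa using hCnu (s - n) x hx
  have hΦ0 : ∀ h, h ∉ S → invDensity φ h = 0 := fun h hh =>
    image_eq_zero_of_notMem_tsupport fun h' => hh (hsub h')
  have hΦi : Integrable fun h => ‖invDensity φ h‖ :=
    hamp.continuous.norm.integrable_of_hasCompactSupport hamp.compact_support.norm
  have hΦm : StronglyMeasurable fun p : E n × (Fin n → Fin n → ℝ) => invDensity φ p.2 :=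
    (hamp.continuous.comp continuous_snd).stronglyMeasurable
  have hnum := stronglyMeasurable_nu hπ hfix (s - n)
  have hne : ∀ᵐ p : E n × (Fin n → Fin n → ℝ) ∂(volume.prod volume), p.1 ≠ 0 :=
    Measure.quasiMeasurePreserving_fst.ae ae_ne_zero
  have hb := ((integrable_norm_rpow_mul_exp (n := n) hs
    (show 0 < Real.pi * z.re * m ^ 2 by have := Real.pi_pos; positivity)).const_mul C).mul_prod hΦi
  refine hb.mono' ?_ (hne.mono fun p hp => ?_)
  · refine ((((continuous_gauss z b).comp continuous_act_swap).stronglyMeasurable).smul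
      (isBoundedBilinearMap_apply.continuous.comp_stronglyMeasurable
        (hΦm.prodMk (hnum.comp_measurable measurable_fst)))).aestronglyMeasurable
  · by_cases hpS : p.2 ∈ S
    · rw [norm_smul, norm_gauss]
      have h1 := (hbd p.2 hpS p.1).1
      have h2 : Real.pi * z.re * m ^ 2 * ‖p.1‖ ^ 2 ≤
          Real.pi * z.re * ‖act (Matrix.of p.2) p.1‖ ^ 2 := by
        rw [mul_assoc, ← mul_pow]
        have := Real.pi_pos
        gcongr
        exact h1
      calc _ ≤ Real.exp (-(Real.pi * z.re * m ^ 2) * ‖p.1‖ ^ 2) *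
            (‖invDensity φ p.2‖ * (C * ‖p.1‖ ^ (s.re - n))) := by
            gcongr
            · linarith
            · exact (ContinuousLinearMap.le_opNorm _ _).trans (by gcongr; exact hCnu' _ hp)
        _ = _ := by ring
    · simp [hΦ0 _ hpS]

theorem integrable_gauss_smul_nu_act_inv
    (hπ : ∀ v : V, Continuous fun k : K n => π k v)
    (hfix : IsFixedByStabilizer π v₀) (hφ : IsHecke π φ) (b : E n) {z : ℂ} (hz : 0 < z.re)
    {s : ℂ} (hs : 0 < s.re) :
    Integrable (fun p : E n × (Fin n → Fin n → ℝ) =>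
      |(Matrix.of p.2).det|⁻¹ • gauss z b p.1 •
        invDensity φ p.2 (nu π v₀ (s - n) (act (Matrix.of p.2)⁻¹ p.1))) (volume.prod volume) := by
  have hamp := isAmplitude_invDensity hφ
  obtain ⟨S, hS, hdet, hsub⟩ := exists_compact_support_invDensity hφ
  obtain ⟨m, M, hm, hM, hbd⟩ := exists_norm_act_bounds (n := n) hS hdet
  obtain ⟨C, hC, hCnu⟩ := exists_norm_nu_le (v₀ := v₀) hπ
  have hCnu' : ∀ x : E n, x ≠ 0 → ‖nu π v₀ (s - n) x‖ ≤ C * ‖x‖ ^ (s.re - n) := fun x hx => by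
    simpa using hCnu (s - n) x hx
  have hΦ0 : ∀ h, h ∉ S → invDensity φ h = 0 := fun h hh =>
    image_eq_zero_of_notMem_tsupport fun h' => hh (hsub h')
  have hΦi : Integrable fun h => ‖invDensity φ h‖ :=
    hamp.continuous.norm.integrable_of_hasCompactSupport hamp.compact_support.norm
  have hΦm : StronglyMeasurable fun p : E n × (Fin n → Fin n → ℝ) => invDensity φ p.2 :=
    (hamp.continuous.comp continuous_snd).stronglyMeasurable
  have hnum := stronglyMeasurable_nu hπ hfix (s - n)
  have hne : ∀ᵐ p : E n × (Fin n → Fin n → ℝ) ∂(volume.prod volume), p.1 ≠ 0 :=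
    Measure.quasiMeasurePreserving_fst.ae ae_ne_zero
  have hgm : StronglyMeasurable fun p : E n × (Fin n → Fin n → ℝ) => gauss z b p.1 :=
    ((continuous_gauss z b).comp continuous_fst).stronglyMeasurable
  have hdc : Continuous fun h : Fin n → Fin n → ℝ => (Matrix.of h).det :=
    contDiff_matrix_det.continuous
  obtain ⟨D, hD⟩ := hS.bddAbove_image (f := fun h => |(Matrix.of h).det|⁻¹)
    (hdc.abs.continuousOn.inv₀ fun h hh => abs_ne_zero.2 (hdet h hh))
  set A := (M⁻¹) ^ (s.re - n) + (m⁻¹) ^ (s.re - n)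
  have hA : 0 ≤ A := by positivity
  have hb := ((integrable_gauss_mul (b := b) hz hs).const_mul (D * C * A)).mul_prod hΦi
  refine hb.mono' ?_ (hne.mono fun p hp => ?_)
  · have h1 : Measurable fun p : E n × (Fin n → Fin n → ℝ) => |(Matrix.of p.2).det|⁻¹ :=
      ((hdc.comp continuous_snd).abs.measurable).inv
    have h2 : StronglyMeasurable fun p : E n × (Fin n → Fin n → ℝ) =>
        nu π v₀ (s - n) (act (Matrix.of p.2)⁻¹ p.1) := hnum.comp_measurable measurable_act_inv
    have h3 : StronglyMeasurable fun p : E n × (Fin n → Fin n → ℝ) =>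
        invDensity φ p.2 (nu π v₀ (s - n) (act (Matrix.of p.2)⁻¹ p.1)) :=
      isBoundedBilinearMap_apply.continuous.comp_stronglyMeasurable (hΦm.prodMk h2)
    exact (h1.stronglyMeasurable.smul (hgm.smul h3)).aestronglyMeasurable
  · by_cases hpS : p.2 ∈ S
    · have hb1 := hbd p.2 hpS (act (Matrix.of p.2)⁻¹ p.1)
      have hinv : act (Matrix.of p.2) (act (Matrix.of p.2)⁻¹ p.1) = p.1 := by
        rw [← act_mul, Matrix.mul_nonsing_inv _ (Ne.isUnit (hdet _ hpS)), act_one']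
      rw [show act p.2 (act (Matrix.of p.2)⁻¹ p.1) = p.1 from hinv] at hb1
      set y := act (Matrix.of p.2)⁻¹ p.1
      have hpn := norm_pos_iff.2 hp
      have hy : y ≠ 0 := by
        intro hy; rw [hy, norm_zero, mul_zero] at hb1; linarith [hb1.2]
      have hyb : ‖y‖ ^ (s.re - n) ≤ A * ‖p.1‖ ^ (s.re - n) := by
        have h1 : ‖y‖ = (‖y‖ / ‖p.1‖) * ‖p.1‖ := by field_simp
        rw [h1, Real.mul_rpow (by positivity) (norm_nonneg _)]
        gcongr
        refine rpow_le_add_of_mem_Icc (by positivity) ?_ ?_ _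
        · rw [inv_le_iff_one_le_mul₀ hM, div_mul_eq_mul_div, le_div_iff₀ hpn]
          linarith [hb1.2]
        · rw [div_le_iff₀ hpn, inv_mul_eq_div, le_div_iff₀ hm]
          linarith [hb1.1]
      have hD' : |(Matrix.of p.2).det|⁻¹ ≤ D := hD ⟨p.2, hpS, rfl⟩
      have hD0 : 0 ≤ D := le_trans (by positivity) hD'
      rw [norm_smul, norm_smul, Real.norm_of_nonneg (by positivity)]
      calc _ ≤ D * (‖gauss z b p.1‖ * (‖invDensity φ p.2‖ * (C * (A * ‖p.1‖ ^ (s.re - n))))) := by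
            gcongr
            refine (ContinuousLinearMap.le_opNorm _ _).trans ?_
            gcongr
            exact (hCnu' _ hy).trans (by gcongr)
        _ = _ := by ring
    · simp [hΦ0 _ hpS]

/-- For Gaussians the weak Mellin transform is the Mellin transform: Fubini's theorem. -/
theorem mellin_lamScalar_gauss (hπ : ∀ v : V, Continuous fun k : K n => π k v)
    (hfix : IsFixedByStabilizer π v₀) (hφ : IsHecke π φ) (b : E n) {z : ℂ} (hz : 0 < z.re)
    {s : ℂ} (hs : 0 < s.re) {ξ : ℂ} (hξ : IsEigenvalue π v₀ (s - n) (heckeStar φ) ξ) :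
    mellin π v₀ (lamScalar φ (gauss z b)) s = ξ • ∫ x : E n, gauss z b x • nu π v₀ (s - n) x := by
  have := FiniteDimensional.complete ℂ V
  have hamp := isAmplitude_invDensity hφ
  obtain ⟨S, hS, hdet, hsub⟩ := exists_compact_support_invDensity hφ
  have hΦ0 : ∀ h, h ∉ S → invDensity φ h = 0 := fun h hh =>
    image_eq_zero_of_notMem_tsupport fun h' => hh (hsub h')
  have hstep1 : mellin π v₀ (lamScalar φ (gauss z b)) s =
      ∫ x : E n, ∫ h : Fin n → Fin n → ℝ,
        gauss z b (act (Matrix.of h) x) • invDensity φ h (nu π v₀ (s - n) x) := by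
    rw [mellin]
    refine integral_congr_ae (ae_ne_zero.mono fun x hx => ?_)
    beta_reduce
    rw [mellinIntegrand, ← ContinuousLinearMap.map_smul_of_tower, norm_pow_inv_smul_nu s hx,
      lamScalar_eq, ContinuousLinearMap.integral_apply]
    · rfl
    · have h1 : Continuous fun h : Fin n → Fin n → ℝ => gauss z b (act (Matrix.of h) x) :=
        (continuous_gauss z b).comp (continuous_act_left x)
      exact hamp.integrable_mul h1
  have hstep2 : ∀ h : Fin n → Fin n → ℝ,
      ∫ x : E n, gauss z b (act (Matrix.of h) x) • invDensity φ h (nu π v₀ (s - n) x) =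
      ∫ x : E n, |(Matrix.of h).det|⁻¹ • gauss z b x •
        invDensity φ h (nu π v₀ (s - n) (act (Matrix.of h)⁻¹ x)) := by
    intro h
    by_cases hh : h ∈ S
    · rw [integral_smul, ← integral_comp_act (hdet h hh) fun x => gauss z b x •
        invDensity φ h (nu π v₀ (s - n) (act (Matrix.of h)⁻¹ x))]
      congr 1
      funext x
      rw [← act_mul, Matrix.nonsing_inv_mul _ (Ne.isUnit (hdet h hh)), act_one']
    · simp [hΦ0 h hh]
  rw [hstep1, integral_integral_swap (integrable_gauss_act_smul_nu hπ hfix hφ b hz hs)]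
  simp_rw [hstep2]
  rw [← integral_integral_swap (integrable_gauss_smul_nu_act_inv hπ hfix hφ b hz hs), ← integral_smul]
  refine integral_congr_ae (ae_ne_zero.mono fun x hx => ?_)
  beta_reduce
  rw [smul_comm ξ, ← hξ x hx, lamVector_heckeStar_eq, ← integral_smul]
  congr 1
  funext h
  rw [smul_comm]

end Mellin

/-! ### Kummer's confluent hypergeometric function -/

section Kummer

theorem summable_mul_pow_div_factorial (M D : ℝ) :
    Summable fun j : ℕ => M * D ^ j / j.factorial := by
  simpa only [mul_div_assoc] using (Real.summable_pow_div_factorial D).mul_left M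

theorem summable_coeff_mul_pow {c : ℕ → ℂ} {M D : ℝ}
    (hc : ∀ j, ‖c j‖ ≤ M * D ^ j / j.factorial) (w : ℂ) : Summable fun j => c j * w ^ j := by
  refine Summable.of_norm_bounded (summable_mul_pow_div_factorial M (D * ‖w‖)) fun j => ?_
  rw [norm_mul, norm_pow, mul_pow, ← mul_assoc, mul_div_right_comm]
  exact mul_le_mul_of_nonneg_right (hc j) (by positivity)

theorem norm_succ_mul_coeff_le {c : ℕ → ℂ} {M D : ℝ}
    (hc : ∀ j, ‖c j‖ ≤ M * D ^ j / j.factorial) (j : ℕ) :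
    ‖((j : ℂ) + 1) * c (j + 1)‖ ≤ (M * D) * D ^ j / j.factorial := by
  have h1 : ‖((j : ℂ) + 1)‖ = j + 1 := by
    rw [← Nat.cast_succ, Complex.norm_natCast]; push_cast; rfl
  rw [norm_mul, h1]
  refine (mul_le_mul_of_nonneg_left (hc (j + 1)) (by positivity)).trans (le_of_eq ?_)
  rw [Nat.factorial_succ]
  push_cast
  field_simp
  ring

/-- Termwise differentiation of a power series with coefficients of exponential type. -/
theorem hasDerivAt_tsum_coeff_mul_pow {c : ℕ → ℂ} {M D : ℝ}
    (hc : ∀ j, ‖c j‖ ≤ M * D ^ j / j.factorial) (w : ℂ) :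
    HasDerivAt (fun w => ∑' j, c j * w ^ j) (∑' j : ℕ, (((j : ℂ) + 1) * c (j + 1)) * w ^ j) w := by
  set R := ‖w‖ + 1
  have hR : 0 ≤ R := by positivity
  have hu : Summable fun j : ℕ => ‖c j‖ * (j * R ^ (j - 1)) := by
    rw [← summable_nat_add_iff 1]
    refine Summable.of_nonneg_of_le (fun j => by positivity) (fun j => ?_)
      (summable_mul_pow_div_factorial (M * D) (D * R))
    have h := mul_le_mul_of_nonneg_right (norm_succ_mul_coeff_le hc j) (pow_nonneg hR j)
    have h1 : ‖((j : ℂ) + 1)‖ = j + 1 := by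
      rw [← Nat.cast_succ, Complex.norm_natCast]; push_cast; rfl
    rw [norm_mul, h1] at h
    calc _ = (j + 1) * ‖c (j + 1)‖ * R ^ j := by
          rw [Nat.add_sub_cancel]; push_cast; ring
      _ ≤ _ := h.trans (le_of_eq (by rw [mul_pow]; ring))
  have key := hasDerivAt_tsum_of_isPreconnected (g := fun j w => c j * w ^ j)
    (g' := fun j w => c j * (j * w ^ (j - 1))) hu Metric.isOpen_ball
    (convex_ball (0 : ℂ) R).isPreconnected
    (fun j y _ => (hasDerivAt_pow j y).const_mul (c j)) (fun j y hy => ?_)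
    (Metric.mem_ball_self (by positivity)) (summable_coeff_mul_pow hc 0)
    (show w ∈ Metric.ball 0 R by simp [R])
  · refine key.congr_deriv ?_
    have hs : Summable fun j : ℕ => c j * (j * w ^ (j - 1)) := by
      refine Summable.of_norm_bounded hu fun j => ?_
      rw [norm_mul, norm_mul, norm_pow, Complex.norm_natCast]
      gcongr
      simp [R]
    rw [hs.tsum_eq_zero_add]
    simp only [Nat.cast_zero, zero_mul, mul_zero, zero_add, Nat.add_sub_cancel]
    exact tsum_congr fun j => by push_cast; ring
  · rw [norm_mul, norm_mul, norm_pow, Complex.norm_natCast]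
    gcongr
    exact (mem_ball_zero_iff.1 hy).le

/-- The coefficient `(α)_j / ((β)_j j!)` of Kummer's function. -/
def kummerCoeff (α : ℂ) (β : ℝ) (j : ℕ) : ℂ :=
  ∏ i ∈ Finset.range j, (α + i) / ((β + i) * (i + 1))

/-- Kummer's function `₁F₁(α; β; w)`. -/
def kummer (α : ℂ) (β : ℝ) (w : ℂ) : ℂ := ∑' j, kummerCoeff α β j * w ^ j

theorem kummerCoeff_zero (α : ℂ) (β : ℝ) : kummerCoeff α β 0 = 1 := by simp [kummerCoeff]

theorem kummerCoeff_succ (α : ℂ) {β : ℝ} (hβ : 0 < β) (j : ℕ) :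
    (j + 1) * (β + j) * kummerCoeff α β (j + 1) = (α + j) * kummerCoeff α β j := by
  have h1 : (j + 1 : ℂ) ≠ 0 := by exact_mod_cast j.succ_ne_zero
  have h2 : (β + j : ℂ) ≠ 0 := by
    have : (β + j : ℝ) ≠ 0 := by positivity
    exact_mod_cast this
  rw [kummerCoeff, Finset.prod_range_succ, ← kummerCoeff]
  field_simp

theorem norm_kummerCoeff_le {α : ℂ} {A β : ℝ} (hα : ‖α‖ ≤ A) (hβ : 0 < β) (j : ℕ) :
    ‖kummerCoeff α β j‖ ≤ 1 * (max 1 (A / β)) ^ j / j.factorial := by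
  induction j with
  | zero => simp [kummerCoeff_zero]
  | succ j ih =>
    rw [kummerCoeff, Finset.prod_range_succ, ← kummerCoeff, norm_mul, Nat.factorial_succ, pow_succ]
    have h1 : ‖(α + j) / ((β + j) * (j + 1))‖ ≤ max 1 (A / β) / (j + 1) := by
      have h2 : ‖(β + j : ℂ)‖ = β + j := by
        have : (β + j : ℂ) = ((β + j : ℝ) : ℂ) := by push_cast; rfl
        rw [this, Complex.norm_real, Real.norm_of_nonneg (by positivity)]
      have h3 : ‖((j : ℂ) + 1)‖ = j + 1 := by
        rw [← Nat.cast_succ, Complex.norm_natCast]; push_cast; rfl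
      rw [norm_div, norm_mul, h2, h3, ← div_div]
      gcongr
      rw [div_le_iff₀ (by positivity)]
      have h4 : ‖α + j‖ ≤ A + j := (norm_add_le _ _).trans (by
        rw [Complex.norm_natCast]; linarith)
      refine h4.trans ?_
      rw [mul_add]
      refine add_le_add ?_ (le_mul_of_one_le_left (Nat.cast_nonneg _) (le_max_left _ _))
      calc A = A / β * β := by field_simp
        _ ≤ _ := by gcongr; exact le_max_right _ _
    refine (mul_le_mul ih h1 (norm_nonneg _) (by positivity)).trans (le_of_eq ?_)
    push_cast
    field_simp

theorem hasSum_kummer (α : ℂ) {β : ℝ} (hβ : 0 < β) (w : ℂ) :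
    HasSum (fun j => kummerCoeff α β j * w ^ j) (kummer α β w) :=
  (summable_coeff_mul_pow (norm_kummerCoeff_le le_rfl hβ) w).hasSum

theorem kummer_zero (α : ℂ) (β : ℝ) : kummer α β 0 = 1 := by
  rw [kummer, tsum_eq_single 0 fun j hj => by simp [hj]]
  simp [kummerCoeff_zero]

theorem continuous_kummer (α : ℂ) {β : ℝ} (hβ : 0 < β) : Continuous (kummer α β) :=
  continuous_iff_continuousAt.2 fun w =>
    (hasDerivAt_tsum_coeff_mul_pow (norm_kummerCoeff_le le_rfl hβ) w).continuousAt

theorem differentiable_kummer_left {β : ℝ} (hβ : 0 < β) (w : ℂ) :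
    Differentiable ℂ fun α => kummer α β w := by
  intro α
  have hα : α ∈ Metric.ball (0 : ℂ) (‖α‖ + 1) := by simp
  refine (Complex.differentiableOn_tsum_of_summable_norm
    (summable_mul_pow_div_factorial 1 (max 1 ((‖α‖ + 1) / β) * ‖w‖)) (fun j => ?_)
    Metric.isOpen_ball (fun j a ha => ?_)).differentiableAt (Metric.isOpen_ball.mem_nhds hα)
  · unfold kummerCoeff
    fun_prop
  · rw [norm_mul, norm_pow, mul_pow, ← mul_assoc, mul_div_right_comm]
    gcongr
    exact norm_kummerCoeff_le (mem_ball_zero_iff.1 ha).le hβ j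

/-- Kummer's differential equation, with the derivatives written as power series. -/
theorem exists_kummer_deriv (α : ℂ) {β : ℝ} (hβ : 0 < β) :
    ∃ K₁ K₂ : ℂ → ℂ, (∀ w, HasDerivAt (kummer α β) (K₁ w) w) ∧ (∀ w, HasDerivAt K₁ (K₂ w) w) ∧
      ∀ w, w * K₂ w + (β - w) * K₁ w = α * kummer α β w := by
  have h0 := norm_kummerCoeff_le (le_refl ‖α‖) hβ
  have h1 := norm_succ_mul_coeff_le h0
  have h2 := norm_succ_mul_coeff_le h1
  refine ⟨_, _, fun w => hasDerivAt_tsum_coeff_mul_pow h0 w,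
    fun w => hasDerivAt_tsum_coeff_mul_pow h1 w, fun w => ?_⟩
  have s0 := summable_coeff_mul_pow h0 w
  have s1 := summable_coeff_mul_pow h1 w
  have s2 := summable_coeff_mul_pow h2 w
  set c := kummerCoeff α β
  -- `w K₂` and `w K₁` as power series with shifted indices
  have e2 : w * ∑' j : ℕ, (((j : ℂ) + 1) * ((((j + 1 : ℕ) : ℂ) + 1) * c (j + 1 + 1))) * w ^ j =
      ∑' j : ℕ, ((j : ℂ) * ((j + 1) * c (j + 1))) * w ^ j := by
    have hs : Summable fun j : ℕ => ((j : ℂ) * ((j + 1) * c (j + 1))) * w ^ j := by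
      rw [← summable_nat_add_iff 1]
      refine (s2.mul_left w).congr fun j => ?_
      push_cast
      ring
    rw [hs.tsum_eq_zero_add, ← tsum_mul_left]
    simp only [Nat.cast_zero, zero_mul, zero_add]
    exact tsum_congr fun j => by push_cast; ring
  have hs3 : Summable fun j : ℕ => ((j : ℂ) * c j) * w ^ j := by
    rw [← summable_nat_add_iff 1]
    refine (s1.mul_left w).congr fun j => ?_
    push_cast
    ring
  have e1 : w * ∑' j : ℕ, (((j : ℂ) + 1) * c (j + 1)) * w ^ j =
      ∑' j : ℕ, ((j : ℂ) * c j) * w ^ j := by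
    rw [hs3.tsum_eq_zero_add, ← tsum_mul_left]
    simp only [Nat.cast_zero, zero_mul, zero_add]
    exact tsum_congr fun j => by push_cast; ring
  have hs4 : Summable fun j : ℕ => ((j : ℂ) * ((j + 1) * c (j + 1))) * w ^ j := by
    rw [← summable_nat_add_iff 1]
    refine (s2.mul_left w).congr fun j => ?_
    push_cast
    ring
  rw [sub_mul, e1, e2, kummer, ← tsum_mul_left, ← tsum_mul_left,
    ← (s1.mul_left (β : ℂ)).tsum_sub hs3, ← hs4.tsum_add ((s1.mul_left (β : ℂ)).sub hs3)]
  refine tsum_congr fun j => ?_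
  linear_combination w ^ j * kummerCoeff_succ α hβ j

/-- The zeros in `α` of `₁F₁(α; β; iy)`, for real `y ≠ 0`, lie on the line `Re α = β / 2`.
The function `G(t) = e^{-iyt/2} ₁F₁(α; β; iyt)` solves the Sturm–Liouville equation
`(t^β G')' + t^{β-1} (y²t/4 + iy(β/2 - α)) G = 0` with spectral parameter `iy(β/2 - α)`, so a zero
at `t = 1` forces this parameter to be real. -/
theorem re_eq_of_kummer_eq_zero {α : ℂ} {β y : ℝ} (hβ : 0 < β) (hy : y ≠ 0)
    (h0 : kummer α β (Complex.I * y) = 0) : α.re = β / 2 := by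
  obtain ⟨K₁, K₂, hK, hK₁, hode⟩ := exists_kummer_deriv α hβ
  set c : ℂ := Complex.I * y with hc
  have hcc : c ^ 2 = -((y ^ 2 : ℝ) : ℂ) := by
    rw [hc, mul_pow, Complex.I_sq]; push_cast; ring
  have hlin : ∀ t : ℝ, HasDerivAt (fun t : ℝ => c * (t : ℂ)) c t := fun t => by
    simpa using (Complex.ofRealCLM.hasDerivAt (x := t)).const_mul c
  have hexp : ∀ t : ℝ, HasDerivAt (fun t : ℝ => Complex.exp (-(c * t) / 2))
      (Complex.exp (-(c * t) / 2) * (-c / 2)) t := fun t => ((hlin t).fun_neg.div_const 2).cexp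
  let G : ℝ → ℂ := fun t => Complex.exp (-(c * t) / 2) * kummer α β (c * t)
  let G₁ : ℝ → ℂ := fun t => Complex.exp (-(c * t) / 2) *
    (-c / 2 * kummer α β (c * t) + c * K₁ (c * t))
  let G₂ : ℝ → ℂ := fun t => Complex.exp (-(c * t) / 2) *
    (c ^ 2 / 4 * kummer α β (c * t) - c ^ 2 * K₁ (c * t) + c ^ 2 * K₂ (c * t))
  have hG : ∀ t, HasDerivAt G (G₁ t) t := fun t => by
    refine ((hexp t).mul ((hK (c * t)).comp t (hlin t))).congr_deriv ?_
    simp only [G₁, Function.comp]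
    ring
  have hG₁ : ∀ t, HasDerivAt G₁ (G₂ t) t := fun t => by
    refine ((hexp t).mul ((((hK (c * t)).comp t (hlin t)).const_mul (-c / 2)).add
      (((hK₁ (c * t)).comp t (hlin t)).const_mul c))).congr_deriv ?_
    simp only [G₂, Function.comp, Pi.add_apply]
    ring
  have hGode : ∀ t : ℝ, β * G₁ t + t * G₂ t = (c * (α - β / 2) + t * c ^ 2 / 4) * G t := by
    intro t
    simp only [G, G₁, G₂]
    linear_combination Complex.exp (-(c * t) / 2) * c * hode (c * t)
  by_contra hne
  set κ : ℝ := y * (α.re - β / 2) with hκ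
  have hκ0 : κ ≠ 0 := mul_ne_zero hy (sub_ne_zero.2 hne)
  have hcim : ∀ t : ℝ, (c * (α - β / 2) + t * c ^ 2 / 4).im = κ := by
    intro t
    rw [hcc, hc]
    have : (Complex.I * y * (α - β / 2) + t * -((y ^ 2 : ℝ) : ℂ) / 4) =
        Complex.I * (y : ℂ) * (α - ((β / 2 : ℝ) : ℂ)) - ((t * y ^ 2 / 4 : ℝ) : ℂ) := by
      push_cast; ring
    rw [this, Complex.sub_im, Complex.ofReal_im, sub_zero, mul_assoc, Complex.I_mul_im,
      Complex.re_ofReal_mul, Complex.sub_re, Complex.ofReal_re]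
  let p : ℝ → ℝ := fun t => (G₁ t * (starRingEnd ℂ) (G t)).im
  have hp : ∀ t, HasDerivAt p ((G₂ t * (starRingEnd ℂ) (G t)).im) t := fun t => by
    have h1 : HasDerivAt (fun t => G₁ t * (starRingEnd ℂ) (G t))
        (G₂ t * (starRingEnd ℂ) (G t) + G₁ t * (starRingEnd ℂ) (G₁ t)) t :=
      (hG₁ t).mul ((hG t).star)
    have h2 := (Complex.imCLM.hasFDerivAt (x := G₁ t * (starRingEnd ℂ) (G t))).comp_hasDerivAt t h1
    refine h2.congr_deriv ?_
    simp only [Complex.imCLM_apply, Complex.add_im, Complex.mul_conj, Complex.ofReal_im, add_zero]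
  let v : ℝ → ℝ := fun t => κ⁻¹ * (t ^ β * p t)
  have hv : ∀ t : ℝ, 0 < t → HasDerivAt v (t ^ (β - 1) * Complex.normSq (G t)) t := by
    intro t ht
    have h1 := ((Real.hasDerivAt_rpow_const (p := β) (Or.inl ht.ne')).mul (hp t)).const_mul κ⁻¹
    refine h1.congr_deriv ?_
    have h2 : β * (G₁ t * (starRingEnd ℂ) (G t)).im + t * (G₂ t * (starRingEnd ℂ) (G t)).im =
        κ * Complex.normSq (G t) := by
      have h5 : ((β * G₁ t + t * G₂ t) * (starRingEnd ℂ) (G t)).im =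
          β * (G₁ t * (starRingEnd ℂ) (G t)).im + t * (G₂ t * (starRingEnd ℂ) (G t)).im := by
        rw [add_mul, mul_assoc (β : ℂ), mul_assoc (t : ℂ), Complex.add_im, Complex.im_ofReal_mul,
          Complex.im_ofReal_mul]
      rw [← h5, hGode, mul_assoc, Complex.mul_conj, Complex.im_mul_ofReal, hcim]
    have h3 : t ^ β = t ^ (β - 1) * t := by
      rw [← Real.rpow_add_one ht.ne']; ring_nf
    have h4 : κ⁻¹ * κ = 1 := inv_mul_cancel₀ hκ0
    rw [h3]
    simp only [p]
    linear_combination κ⁻¹ * t ^ (β - 1) * h2 + t ^ (β - 1) * Complex.normSq (G t) * h4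
  have hpc : Continuous p := continuous_iff_continuousAt.2 fun t => (hp t).continuousAt
  have hvc : Continuous v :=
    continuous_const.mul ((Real.continuous_rpow_const hβ.le).mul hpc)
  have hmono : MonotoneOn v (Icc 0 1) := by
    refine monotoneOn_of_deriv_nonneg (convex_Icc 0 1) hvc.continuousOn (fun t ht => ?_)
      fun t ht => ?_
    · rw [interior_Icc] at ht
      exact (hv t ht.1).differentiableAt.differentiableWithinAt
    · rw [interior_Icc] at ht
      rw [(hv t ht.1).deriv]
      exact mul_nonneg (Real.rpow_nonneg ht.1.le _) (Complex.normSq_nonneg _)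
  have hv0 : v 0 = 0 := by simp [v, Real.zero_rpow hβ.ne']
  have hv1 : v 1 = 0 := by
    have : G 1 = 0 := by simp [G, h0]
    simp [v, p, this]
  have hvz : ∀ t ∈ Ioo (0 : ℝ) 1, v t = 0 := fun t ht =>
    le_antisymm (hv1 ▸ hmono ⟨ht.1.le, ht.2.le⟩ ⟨zero_le_one, le_rfl⟩ ht.2.le)
      (hv0 ▸ hmono ⟨le_rfl, zero_le_one⟩ ⟨ht.1.le, ht.2.le⟩ ht.1.le)
  have hGz : ∀ t ∈ Ioo (0 : ℝ) 1, G t = 0 := fun t ht => by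
    have h1 : v =ᶠ[𝓝 t] fun _ => 0 :=
      eventually_of_mem (isOpen_Ioo.mem_nhds ht) hvz
    have h2 := (hv t ht.1).unique ((hasDerivAt_const t (0 : ℝ)).congr_of_eventuallyEq h1)
    have h3 := (mul_eq_zero.1 h2).resolve_left (Real.rpow_pos_of_pos ht.1 _).ne'
    exact Complex.normSq_eq_zero.1 h3
  have hGc : Continuous G := continuous_iff_continuousAt.2 fun t => (hG t).continuousAt
  have hG0 : G 0 = 0 := by
    have hcl : IsClosed {t | G t = 0} := isClosed_eq hGc continuous_const
    have : (0 : ℝ) ∈ closure (Ioo (0 : ℝ) 1) := by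
      rw [closure_Ioo zero_ne_one]; exact ⟨le_rfl, zero_le_one⟩
    exact hcl.closure_subset_iff.2 hGz this
  simp [G, kummer_zero] at hG0

end Kummer

/-! ### Radial Gaussian integrals -/

section Radial

theorem integrableOn_cpow_mul_cexp {s z : ℂ} (hs : 0 < s.re) (hz : 0 < z.re) :
    IntegrableOn (fun t : ℝ => (t : ℂ) ^ (s - 1) * Complex.exp (-(z * t))) (Ioi 0) := by
  have h := integrableOn_rpow_mul_exp_neg_mul_rpow (p := 1) (s := s.re - 1) (b := z.re)
    (by linarith) one_pos hz
  refine Integrable.mono' h ?_ ?_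
  · refine ContinuousOn.aestronglyMeasurable ?_ measurableSet_Ioi
    refine ContinuousOn.mul ?_ (by fun_prop)
    exact fun t ht => (Complex.continuousAt_ofReal_cpow_const _ _
      (Or.inr (ne_of_gt ht))).continuousWithinAt
  · filter_upwards [ae_restrict_mem measurableSet_Ioi] with t ht
    rw [norm_mul, Complex.norm_cpow_eq_rpow_re_of_pos ht, Complex.norm_exp, Complex.sub_re,
      Complex.one_re, Complex.neg_re, Complex.re_mul_ofReal, Real.rpow_one, neg_mul]

/-- The Mellin transform of `t ↦ e^{-zt}` for complex `z` with `Re z > 0`, obtained from the case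
of a positive real `z` by analytic continuation. -/
theorem integral_cpow_mul_cexp {s z : ℂ} (hs : 0 < s.re) (hz : 0 < z.re) :
    ∫ t in Ioi (0 : ℝ), (t : ℂ) ^ (s - 1) * Complex.exp (-(z * t)) =
      z ^ (-s) * Complex.Gamma s := by
  have hopen : IsOpen {z : ℂ | 0 < z.re} := isOpen_lt continuous_const Complex.continuous_re
  have hL : DifferentiableOn ℂ (fun z : ℂ => ∫ t in Ioi (0 : ℝ),
      (t : ℂ) ^ (s - 1) * Complex.exp (-(z * t))) {z : ℂ | 0 < z.re} := by
    intro z (hz : 0 < z.re)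
    have hint : IntegrableOn (fun t : ℝ => ‖(t : ℂ) ^ ((s + 1) - 1) *
        Complex.exp (-(((z.re / 2 : ℝ) : ℂ) * t))‖) (Ioi 0) :=
      (integrableOn_cpow_mul_cexp (s := s + 1) (by simp; linarith) (by simpa using hz)).norm
    refine (hasDerivAt_integral_of_dominated_loc_of_deriv_le
      (F := fun (w : ℂ) (t : ℝ) => (t : ℂ) ^ (s - 1) * Complex.exp (-(w * t)))
      (F' := fun (w : ℂ) (t : ℝ) => (t : ℂ) ^ (s - 1) * (Complex.exp (-(w * t)) * (-t)))
      (s := {w : ℂ | z.re / 2 < w.re}) (bound := fun t : ℝ => ‖(t : ℂ) ^ ((s + 1) - 1) *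
        Complex.exp (-(((z.re / 2 : ℝ) : ℂ) * t))‖)
      ((isOpen_lt continuous_const Complex.continuous_re).mem_nhds (by
        show z.re / 2 < z.re; linarith)) ?_ (integrableOn_cpow_mul_cexp hs hz) ?_ ?_
      hint ?_).2.differentiableAt.differentiableWithinAt
    · filter_upwards [hopen.mem_nhds hz] with w hw
      exact (integrableOn_cpow_mul_cexp hs hw).aestronglyMeasurable
    · refine ContinuousOn.aestronglyMeasurable ?_ measurableSet_Ioi
      refine ContinuousOn.mul ?_ (by fun_prop)
      exact fun t ht => (Complex.continuousAt_ofReal_cpow_const _ _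
        (Or.inr (ne_of_gt ht))).continuousWithinAt
    · filter_upwards [ae_restrict_mem measurableSet_Ioi] with t ht w hw
      have ht' : (0 : ℝ) < t := ht
      have hw' : z.re / 2 < w.re := hw
      rw [norm_mul, norm_mul, norm_mul, Complex.norm_cpow_eq_rpow_re_of_pos ht,
        Complex.norm_cpow_eq_rpow_re_of_pos ht, Complex.norm_exp, Complex.norm_exp]
      have h1 : ‖(-t : ℂ)‖ = t := by simp [abs_of_pos ht']
      have h2 : t ^ ((s + 1 - 1).re) = t ^ (s - 1).re * t := by
        rw [← Real.rpow_add_one ht'.ne']; congr 1; simp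
      rw [h1, h2, mul_assoc, mul_comm t]
      refine mul_le_mul_of_nonneg_left (mul_le_mul_of_nonneg_right (Real.exp_le_exp.2 ?_) ht'.le)
        (Real.rpow_nonneg ht'.le _)
      rw [Complex.neg_re, Complex.neg_re, Complex.re_mul_ofReal, Complex.re_mul_ofReal,
        Complex.ofReal_re]
      nlinarith
    · refine ae_of_all _ fun t w _ => ?_
      have h : HasDerivAt (fun w : ℂ => -(w * t)) (-t : ℂ) w := by
        simpa using ((hasDerivAt_id w).mul_const (t : ℂ)).fun_neg
      exact h.cexp.const_mul _
  have hR : DifferentiableOn ℂ (fun z : ℂ => z ^ (-s) * Complex.Gamma s) {z : ℂ | 0 < z.re} :=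
    fun z hz => ((differentiableAt_id.cpow (differentiableAt_const _) (Or.inl hz)).mul_const
      _).differentiableWithinAt
  refine AnalyticOnNhd.eqOn_of_preconnected_of_frequently_eq (z₀ := 1)
    (hL.analyticOnNhd hopen) (hR.analyticOnNhd hopen)
    (convex_halfSpace_re_gt 0).isPreconnected (by simp) ?_ hz
  have hseq : Tendsto (fun j : ℕ => ((1 + 1 / ((j : ℝ) + 1) : ℝ) : ℂ)) atTop (𝓝[≠] 1) := by
    refine tendsto_nhdsWithin_iff.2 ⟨?_, Eventually.of_forall fun j => ?_⟩
    · have := (tendsto_one_div_add_atTop_nhds_zero_nat (𝕜 := ℝ)).const_add 1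
      simpa [Function.comp_def] using (Complex.continuous_ofReal.tendsto _).comp this
    · have : (0 : ℝ) < 1 / ((j : ℝ) + 1) := by positivity
      simp only [mem_compl_iff, mem_singleton_iff, ← Complex.ofReal_one, Complex.ofReal_inj]
      linarith
  refine hseq.frequently (Frequently.of_forall fun j => ?_)
  set r : ℝ := 1 + 1 / ((j : ℝ) + 1)
  have hr : 0 < r := by positivity
  rw [Complex.integral_cpow_mul_exp_neg_mul_Ioi hs hr, one_div, ← Complex.ofReal_inv,
    Complex.cpow_neg, Complex.ofReal_inv, Complex.inv_cpow]
  rw [Complex.arg_ofReal_of_nonneg hr.le]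
  exact Real.pi_pos.ne

/-- The Mellin transform of `‖x‖ ↦ e^{-πz‖x‖²}` on `ℝ^n`. -/
theorem integral_cpow_norm_mul_gauss {n : ℕ} [NeZero n] {s z : ℂ} (hs : 0 < s.re)
    (hz : 0 < z.re) :
    ∫ x : E n, (‖x‖ : ℂ) ^ (s - n) * Complex.exp (-(Real.pi * z * ‖x‖ ^ 2)) =
      n * (volume : Measure (E n)).real (Metric.ball 0 1) / 2 *
        ((Real.pi * z) ^ (-(s / 2)) * Complex.Gamma (s / 2)) := by
  have hn : 1 ≤ n := NeZero.one_le
  have := integral_fun_norm_addHaar (volume : Measure (E n))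
    (fun t : ℝ => (t : ℂ) ^ (s - n) * Complex.exp (-(Real.pi * z * t ^ 2)))
  rw [this, finrank_euclideanSpace_fin]
  have hz' : 0 < (Real.pi * z).re := by
    rw [Complex.re_ofReal_mul]; exact mul_pos Real.pi_pos hz
  have h2 := mellin_comp_rpow (fun t : ℝ => Complex.exp (-(Real.pi * z * t))) s 2
  rw [_root_.mellin, _root_.mellin] at h2
  simp only [smul_eq_mul] at h2
  have h3 : (s / ((2 : ℝ) : ℂ)) = s / 2 := by norm_num
  rw [h3, integral_cpow_mul_cexp (by simpa using hs) hz'] at h2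
  have h4 : ∫ y in Ioi (0 : ℝ), y ^ (n - 1) • ((y : ℂ) ^ (s - n) *
      Complex.exp (-(Real.pi * z * y ^ 2))) =
      ∫ t in Ioi (0 : ℝ), (t : ℂ) ^ (s - 1) * Complex.exp (-(Real.pi * z * (t ^ (2 : ℝ) : ℝ))) := by
    refine setIntegral_congr_fun measurableSet_Ioi fun y hy => ?_
    have hy' : (y : ℂ) ≠ 0 := by exact_mod_cast ne_of_gt hy
    rw [Real.rpow_two, ← Complex.coe_smul, smul_eq_mul, ← mul_assoc]
    push_cast
    rw [← Complex.cpow_natCast, ← Complex.cpow_add _ _ hy']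
    push_cast [Nat.cast_sub hn]
    congr 2
    ring
  rw [h4, h2]
  simp only [Complex.real_smul, nsmul_eq_mul, abs_two]
  push_cast
  ring

end Radial

/-! ### Moments of the spherical vector -/

section Moments

variable {n : ℕ} [NeZero n] {V : Type*} [NormedAddCommGroup V] [NormedSpace ℂ V]
  {π : Representation ℂ (K n) V} {v₀ : V}

theorem IsSpherical.exists_eq_smul (hπ : IsSpherical π) (hv₀ : v₀ ≠ 0)
    (hfix : IsFixedByStabilizer π v₀) {w : V} (hw : IsFixedByStabilizer π w) :
    ∃ c : ℂ, w = c • v₀ := by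
  obtain ⟨u, hu, -, huniq⟩ := hπ.unique_fixed
  obtain ⟨c, rfl⟩ := huniq v₀ hfix
  obtain ⟨d, rfl⟩ := huniq w hw
  have hc : c ≠ 0 := fun h => hv₀ (by rw [h, zero_smul])
  exact ⟨d / c, by rw [smul_smul, div_mul_cancel₀ _ hc]⟩

theorem continuous_inner_orbit (x : E n) :
    Continuous fun k : K n => (inner ℝ x (act (k : Mat n) (e₁ n)) : ℝ) :=
  continuous_const.inner continuous_orbit

theorem abs_inner_orbit_le (x : E n) (k : K n) :
    |(inner ℝ x (act (k : Mat n) (e₁ n)) : ℝ)| ≤ ‖x‖ := by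
  simpa [norm_act] using abs_real_inner_le_norm x (act (k : Mat n) (e₁ n))

theorem act_e₁_eq_of_inner_eq_one {k : K n}
    (h : (inner ℝ (e₁ n) (act (k : Mat n) (e₁ n)) : ℝ) = 1) : act (k : Mat n) (e₁ n) = e₁ n :=
  ((inner_eq_one_iff_of_norm_eq_one (𝕜 := ℝ) norm_e₁ (by rw [norm_act, norm_e₁])).1 h).symm

variable (π v₀) in
/-- The vector valued polynomial `x ↦ ∫_K ⟪x, k e₁⟫^m π(k) v₀ dk`. -/
def moment (m : ℕ) (x : E n) : V :=
  ∫ k, (((inner ℝ x (act (k : Mat n) (e₁ n)) : ℝ) : ℂ) ^ m) • π k v₀ ∂haarK n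

theorem continuous_moment_integrand (hc : ∀ v : V, Continuous fun k : K n => π k v) (m : ℕ)
    (x : E n) : Continuous fun k : K n =>
      (((inner ℝ x (act (k : Mat n) (e₁ n)) : ℝ) : ℂ) ^ m) • π k v₀ :=
  ((Complex.continuous_ofReal.comp (continuous_inner_orbit x)).pow m).smul (hc v₀)

theorem moment_smul (m : ℕ) (r : ℝ) (x : E n) :
    moment π v₀ m (r • x) = ((r : ℂ) ^ m) • moment π v₀ m x := by
  rw [moment, moment, ← integral_smul]
  congr 1
  funext k
  rw [real_inner_smul_left, Complex.ofReal_mul, mul_pow, mul_smul]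

variable [FiniteDimensional ℂ V]

theorem moment_act (hc : ∀ v : V, Continuous fun k : K n => π k v) (m : ℕ) (k : K n) (x : E n) :
    moment π v₀ m (act (k : Mat n) x) = π k (moment π v₀ m x) := by
  have := FiniteDimensional.complete ℂ V
  rw [moment, moment, ← piL_apply,
    ← ContinuousLinearMap.integral_comp_comm _ (integrable_haarK (continuous_moment_integrand hc m x)),
    ← integral_mul_left_eq_self _ k]
  congr 1
  funext k'
  rw [inner_act_left, ← act_coe_mul, inv_mul_cancel_left, map_smul, piL_apply, map_mul,
    Module.End.mul_apply]

/-- Sphericity makes every moment at `e₁` a multiple of `v₀`; homogeneity and equivariance do the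
rest. -/
theorem exists_moment_eq (hπ : IsSpherical π) (hv₀ : v₀ ≠ 0) (hfix : IsFixedByStabilizer π v₀) :
    ∃ q : ℕ → ℂ, ∀ m x, moment π v₀ m x = (q m * (‖x‖ : ℂ) ^ m) • π (rot x) v₀ := by
  have h : ∀ m, ∃ c : ℂ, moment π v₀ m (e₁ n) = c • v₀ := fun m =>
    hπ.exists_eq_smul hv₀ hfix fun k hk => by rw [← moment_act hπ.continuous, hk]
  choose q hq using h
  refine ⟨q, fun m x => ?_⟩
  conv_lhs => rw [← norm_smul_rot x]
  rw [moment_smul, moment_act hπ.continuous, hq, map_smul, smul_smul, mul_comm]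

/-- If every scalar moment of a continuous `F` on `K` against `⟪e₁, k e₁⟫` vanishes, so does the
integral of `u(⟪e₁, k e₁⟫) F(k)` for every continuous `u`, by polynomial approximation. -/
theorem integral_comp_inner_mul_eq_zero {F : K n → ℂ} (hF : Continuous F)
    (h : ∀ m : ℕ, ∫ k, ((inner ℝ (e₁ n) (act (k : Mat n) (e₁ n)) : ℝ) : ℂ) ^ m * F k ∂haarK n = 0)
    {u : ℝ → ℝ} (hu : Continuous u) :
    ∫ k, (u (inner ℝ (e₁ n) (act (k : Mat n) (e₁ n))) : ℂ) * F k ∂haarK n = 0 := by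
  set t : K n → ℝ := fun k => inner ℝ (e₁ n) (act (k : Mat n) (e₁ n)) with ht
  have htc : Continuous t := continuous_inner_orbit _
  have hpoly : ∀ p : Polynomial ℝ, ∫ k, ((p.eval (t k) : ℝ) : ℂ) * F k ∂haarK n = 0 := by
    intro p
    have h1 : ∀ k, ((p.eval (t k) : ℝ) : ℂ) * F k =
        ∑ i ∈ Finset.range (p.natDegree + 1), (p.coeff i : ℂ) * ((t k : ℂ) ^ i * F k) := by
      intro k
      rw [Polynomial.eval_eq_sum_range]
      push_cast
      rw [Finset.sum_mul]
      simp only [mul_assoc]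
    simp only [h1]
    rw [integral_finsetSum]
    · refine Finset.sum_eq_zero fun i _ => ?_
      rw [integral_const_mul, h i, mul_zero]
    · intro i _
      exact integrable_haarK (by fun_prop)
  obtain ⟨C, hC⟩ := isCompact_univ.exists_bound_of_continuousOn hF.continuousOn
  have hC0 : 0 ≤ C := (norm_nonneg _).trans (hC 1 (mem_univ _))
  refine norm_le_zero_iff.1 (le_of_forall_pos_le_add fun ε hε => ?_)
  obtain ⟨p, hp⟩ := exists_polynomial_near_of_continuousOn (-1) 1 u hu.continuousOn (ε / (C + 1))
    (by positivity)
  have h2 : ∫ k, (u (t k) : ℂ) * F k ∂haarK n =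
      ∫ k, ((u (t k) : ℂ) - ((p.eval (t k) : ℝ) : ℂ)) * F k ∂haarK n := by
    simp only [sub_mul]
    rw [integral_sub (integrable_haarK (by fun_prop)) (integrable_haarK ?_), hpoly, sub_zero]
    exact (Complex.continuous_ofReal.comp (p.continuous.comp htc)).mul hF
  rw [h2, zero_add]
  refine (norm_integral_le_of_norm_le_const (C := ε / (C + 1) * C) (ae_of_all _ fun k => ?_)).trans ?_
  · rw [norm_mul, ← Complex.ofReal_sub, Complex.norm_real, Real.norm_eq_abs, abs_sub_comm]
    have := hp (t k) (abs_le.1 (by simpa using abs_inner_orbit_le (e₁ n) k))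
    gcongr
    exact hC k (mem_univ _)
  · rw [probReal_univ, mul_one, div_mul_eq_mul_div, div_le_iff₀ (by positivity)]
    nlinarith

/-- Some moment is non-zero: `u(⟪e₁, k e₁⟫)` concentrates near the stabiliser of `e₁`, where
`π(k) v₀` is close to `v₀`. -/
theorem exists_moment_ne_zero (hc : ∀ v : V, Continuous fun k : K n => π k v) (hv₀ : v₀ ≠ 0)
    (hfix : IsFixedByStabilizer π v₀) : ∃ m, moment π v₀ m (e₁ n) ≠ 0 := by
  have := FiniteDimensional.complete ℂ V
  by_contra! hcon
  obtain ⟨θ, hθ⟩ := SeparatingDual.exists_eq_one (R := ℂ) hv₀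
  set t : K n → ℝ := fun k => inner ℝ (e₁ n) (act (k : Mat n) (e₁ n)) with ht
  have htc : Continuous t := continuous_inner_orbit _
  set F : K n → ℂ := fun k => θ (π k v₀) with hFdef
  have hF : Continuous F := θ.continuous.comp (hc v₀)
  have hmom : ∀ m : ℕ, ∫ k, (t k : ℂ) ^ m * F k ∂haarK n = 0 := by
    intro m
    have h := congrArg θ (hcon m)
    rw [moment, map_zero, ← ContinuousLinearMap.integral_comp_comm _
      (integrable_haarK (continuous_moment_integrand hc m _))] at h
    simpa only [map_smul, smul_eq_mul] using h
  have hlt : ∀ k, (F k).re ≤ 1 / 2 → t k < 1 := by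
    intro k hk
    refine lt_of_le_of_ne ((le_abs_self _).trans (by simpa using abs_inner_orbit_le (e₁ n) k))
      fun h1 => ?_
    have h2 : F k = 1 := by
      simp only [hFdef]; rw [hfix k (act_e₁_eq_of_inner_eq_one h1), hθ]
    rw [h2] at hk
    norm_num at hk
  obtain ⟨ρ, hρ1, hρ⟩ : ∃ ρ < 1, ∀ k, (F k).re ≤ 1 / 2 → t k ≤ ρ := by
    have hcpt : IsCompact {k | (F k).re ≤ 1 / 2} :=
      (isClosed_le (Complex.continuous_re.comp hF) continuous_const).isCompact
    rcases eq_empty_or_nonempty {k | (F k).re ≤ 1 / 2} with he | hne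
    · exact ⟨0, one_pos, fun k hk => absurd (show k ∈ {k | (F k).re ≤ 1 / 2} from hk)
        (he ▸ notMem_empty k)⟩
    · obtain ⟨k₀, hk₀, hmax⟩ := hcpt.exists_isMaxOn hne htc.continuousOn
      exact ⟨t k₀, hlt k₀ hk₀, fun k hk => hmax hk⟩
  have hu : Continuous fun x : ℝ => max 0 (x - ρ) := by fun_prop
  have h0 := integral_comp_inner_mul_eq_zero hF hmom hu
  have h1 : ∫ k, max 0 (t k - ρ) * (F k).re ∂haarK n = 0 := by
    have h2 := congrArg Complex.re h0
    rw [Complex.zero_re, ← Complex.reCLM_apply, ← ContinuousLinearMap.integral_comp_comm _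
      (integrable_haarK ?_)] at h2
    · simpa only [Complex.reCLM_apply, Complex.re_ofReal_mul] using h2
    · exact (Complex.continuous_ofReal.comp (hu.comp htc)).mul hF
  have hcont : Continuous fun k => max 0 (t k - ρ) * (F k).re :=
    (hu.comp htc).mul (Complex.continuous_re.comp hF)
  refine absurd h1 (ne_of_gt ?_)
  refine hcont.integral_pos_of_hasCompactSupport_nonneg_nonzero
    (HasCompactSupport.of_compactSpace _) (fun k => ?_) (x := 1) ?_
  · rcases le_or_gt (F k).re (1 / 2) with h | h
    · simp [hρ k h]
    · exact mul_nonneg (le_max_left _ _) (by linarith)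
  · have h3 : t 1 = 1 := by simp [ht, act_one']
    have h4 : F 1 = 1 := by simp [hFdef, hθ]
    rw [h3, h4, max_eq_right (by linarith)]
    simp only [Complex.one_re, mul_one]
    linarith

end Moments

/-! ### The recursion of the moments -/

section Recursion

open Polynomial in
theorem coeff_one_add_mul_X_add_X_sq_pow (δ : ℂ) (j : ℕ) :
    ((1 + C (2 * δ) * X + X ^ 2 : ℂ[X]) ^ j).coeff 0 = 1 ∧
    ((1 + C (2 * δ) * X + X ^ 2 : ℂ[X]) ^ j).coeff 1 = 2 * δ * j ∧
    ((1 + C (2 * δ) * X + X ^ 2 : ℂ[X]) ^ j).coeff 2 = j + 2 * δ ^ 2 * j * (j - 1) := by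
  have h0 : (1 + C (2 * δ) * X + X ^ 2 : ℂ[X]).coeff 0 = 1 := by simp
  have h1 : (1 + C (2 * δ) * X + X ^ 2 : ℂ[X]).coeff 1 = 2 * δ := by
    simp [coeff_one, coeff_X_pow]
  have h2 : (1 + C (2 * δ) * X + X ^ 2 : ℂ[X]).coeff 2 = 1 := by
    simp [coeff_one, coeff_X_pow]
  generalize (1 + C (2 * δ) * X + X ^ 2 : ℂ[X]) = Q at h0 h1 h2
  induction j with
  | zero => simp [coeff_one]
  | succ j ih =>
    obtain ⟨i0, i1, i2⟩ := ih
    have a1 : Finset.HasAntidiagonal.antidiagonal 1 = {(0, 1), (1, 0)} := by decide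
    have a2 : Finset.HasAntidiagonal.antidiagonal 2 = {(0, 2), (1, 1), (2, 0)} := by decide
    refine ⟨?_, ?_, ?_⟩
    · rw [pow_succ, mul_coeff_zero, i0, h0, one_mul]
    · rw [pow_succ, coeff_mul, a1]
      simp [i0, i1, h0, h1]
      ring
    · rw [pow_succ, coeff_mul, a2]
      simp [i0, i1, i2, h0, h1, h2]
      ring

variable {n : ℕ} [NeZero n] {V : Type*} [NormedAddCommGroup V] [NormedSpace ℂ V]
  [FiniteDimensional ℂ V] {π : Representation ℂ (K n) V} {v₀ : V}

open Polynomial in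
/-- If the moments `q m` vanish for `m < l`, then they satisfy a two-step recursion above `l`.
It is obtained by expanding `∫ ⟪e₁ + X e_i, k e₁⟫^m θ(π(k) v₀) dk = q m ‖e₁ + X e_i‖^m θ(…)` in
powers of `X`, comparing the orders `m = l + 2j` and `l`, and summing the coefficients of `X²`
over `i`. -/
theorem moment_recursion (hc : ∀ v : V, Continuous fun k : K n => π k v) (hv₀ : v₀ ≠ 0)
    {q : ℕ → ℂ} (hfix : IsFixedByStabilizer π v₀)
    (hq : ∀ m x, moment π v₀ m x = (q m * (‖x‖ : ℂ) ^ m) • π (rot x) v₀) {l : ℕ}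
    (hl : q l ≠ 0) (hlt : ∀ m < l, q m = 0) (j : ℕ) :
    ((l + 2 * j).choose 2 : ℂ) * q (l + 2 * j - 2) =
      q (l + 2 * j) * (j * (n + 2 * j - 2 + 2 * l)) := by
  have := FiniteDimensional.complete ℂ V
  obtain ⟨θ, hθ⟩ := SeparatingDual.exists_eq_one (R := ℂ) hv₀
  let ε : Fin n → E n := fun i => EuclideanSpace.single i 1
  let κ : Fin n → K n → ℂ := fun i k => ((inner ℝ (ε i) (act (k : Mat n) (e₁ n)) : ℝ) : ℂ)
  have hκc : ∀ i, Continuous (κ i) := fun i =>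
    Complex.continuous_ofReal.comp (continuous_inner_orbit _)
  let F : K n → ℂ := fun k => θ (π k v₀)
  have hF : Continuous F := θ.continuous.comp (hc v₀)
  have hmom : ∀ m x, ∫ k, ((inner ℝ x (act (k : Mat n) (e₁ n)) : ℝ) : ℂ) ^ m * F k ∂haarK n =
      q m * (‖x‖ : ℂ) ^ m * θ (π (rot x) v₀) := by
    intro m x
    have h := congrArg θ (hq m x)
    rw [moment, ← ContinuousLinearMap.integral_comp_comm _
      (integrable_haarK (continuous_moment_integrand hc m _))] at h
    simpa only [map_smul, smul_eq_mul] using h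
  have hrot : π (rot (e₁ n)) v₀ = v₀ := by
    refine hfix _ ?_
    simpa using norm_smul_rot (e₁ n)
  have hq0 : ∀ m, ∫ k, κ 0 k ^ m * F k ∂haarK n = q m := by
    intro m
    have h := hmom m (e₁ n)
    rw [hrot, hθ, norm_e₁, Complex.ofReal_one, one_pow, mul_one, mul_one] at h
    exact h
  let A : ℕ → ℕ → Fin n → ℂ := fun m p i => ∫ k, κ 0 k ^ (m - p) * κ i k ^ p * F k ∂haarK n
  let P : ℕ → Fin n → ℂ[X] := fun m i =>
    ∑ p ∈ Finset.range (m + 1), C ((m.choose p : ℂ) * A m p i) * X ^ p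
  have hPcoeff : ∀ m i p, (P m i).coeff p = (m.choose p : ℂ) * A m p i := by
    intro m i p
    simp only [P, finsetSum_coeff, coeff_C_mul_X_pow, Finset.sum_ite_eq, Finset.mem_range]
    split_ifs with h
    · rfl
    · rw [Nat.choose_eq_zero_of_lt (by omega), Nat.cast_zero, zero_mul]
  have hPeval : ∀ m i (r : ℝ), (P m i).eval (r : ℂ) =
      q m * (‖e₁ n + r • ε i‖ : ℂ) ^ m * θ (π (rot (e₁ n + r • ε i)) v₀) := by
    intro m i r
    rw [← hmom]
    have h1 : ∀ k : K n, ((inner ℝ (e₁ n + r • ε i) (act (k : Mat n) (e₁ n)) : ℝ) : ℂ) ^ m * F k =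
        ∑ p ∈ Finset.range (m + 1), (r ^ p * (m.choose p : ℂ)) *
          (κ 0 k ^ (m - p) * κ i k ^ p * F k) := by
      intro k
      rw [inner_add_left, real_inner_smul_left, Complex.ofReal_add, Complex.ofReal_mul, add_comm,
        add_pow, Finset.sum_mul]
      refine Finset.sum_congr rfl fun p _ => ?_
      simp only [κ, ε, e₁, mul_pow]
      ring
    simp only [h1]
    rw [integral_finsetSum _ fun p _ => integrable_haarK (by fun_prop)]
    simp only [P, eval_finsetSum, eval_mul, eval_C, eval_pow, eval_X, integral_const_mul]
    refine Finset.sum_congr rfl fun p _ => ?_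
    simp only [A]
    ring
  let δ : Fin n → ℂ := fun i => if i = 0 then 1 else 0
  have hnorm : ∀ i (r : ℝ), (‖e₁ n + r • ε i‖ : ℂ) ^ 2 = 1 + 2 * δ i * r + r ^ 2 := by
    intro i r
    have h1 : ‖e₁ n + r • ε i‖ ^ 2 = 1 + 2 * (if i = 0 then 1 else 0) * r + r ^ 2 := by
      rw [norm_add_sq_real, norm_e₁, norm_smul, real_inner_smul_right, one_pow]
      have : (inner ℝ (e₁ n) (ε i) : ℝ) = if i = 0 then 1 else 0 := by
        simp [e₁, ε, EuclideanSpace.inner_single_left, eq_comm]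
      rw [this, mul_pow, mul_comm r, ← mul_assoc]
      simp [ε]
    rw [← Complex.ofReal_pow, h1]
    simp only [δ]
    split_ifs <;> push_cast <;> rfl
  set m := l + 2 * j with hm
  have hpoly : ∀ i, C (q l) * P m i =
      C (q m) * ((1 + C (2 * δ i) * X + X ^ 2) ^ j * P l i) := by
    intro i
    refine Polynomial.eq_of_infinite_eval_eq _ _
      ((Set.infinite_range_of_injective Complex.ofReal_injective).mono ?_)
    rintro _ ⟨r, rfl⟩
    simp only [mem_ofPred_eq, eval_mul, eval_C, eval_pow, eval_add, eval_one, eval_X, hPeval,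
      ← hnorm]
    rw [hm, pow_add, pow_mul]
    ring
  have hcoeff : ∀ i, q l * ((m.choose 2 : ℂ) * A m 2 i) = q m * ((l.choose 2 : ℂ) * A l 2 i +
      2 * j * l * (δ i * A l 1 i) + (j + 2 * δ i ^ 2 * j * (j - 1)) * A l 0 i) := by
    intro i
    have h := congrArg (fun p => coeff p 2) (hpoly i)
    simp only [coeff_C_mul] at h
    have a2 : Finset.HasAntidiagonal.antidiagonal 2 = {(0, 2), (1, 1), (2, 0)} := by decide
    obtain ⟨c0, c1, c2⟩ := coeff_one_add_mul_X_add_X_sq_pow (δ i) j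
    rw [coeff_mul, a2] at h
    simp only [hPcoeff, Finset.mem_singleton, Finset.mem_insert, Prod.mk.injEq, OfNat.zero_ne_ofNat,
      zero_ne_one, not_false_eq_true, Finset.sum_insert, Finset.sum_singleton, c0, c1, c2,
      Nat.choose_one_right, Nat.choose_zero_right, Nat.cast_one, false_and, or_self,
      OfNat.one_ne_ofNat] at h
    rw [h]
    ring
  have hsq : ∀ k : K n, ∑ i, κ i k ^ 2 = 1 := by
    intro k
    have h1 : ‖act (k : Mat n) (e₁ n)‖ ^ 2 = 1 := by rw [norm_act, norm_e₁, one_pow]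
    rw [EuclideanSpace.real_norm_sq_eq] at h1
    have h2 : ∀ i, κ i k = ((act (k : Mat n) (e₁ n)) i : ℂ) := by
      intro i; simp [κ, ε, EuclideanSpace.inner_single_left]
    simp only [h2]
    exact_mod_cast h1
  have hA2 : ∀ m, ∑ i, A m 2 i = q (m - 2) := by
    intro m
    rw [← hq0, ← integral_finsetSum _ fun p _ => integrable_haarK (by fun_prop)]
    congr 1
    funext k
    rw [← Finset.sum_mul, ← Finset.mul_sum, hsq, mul_one]
  have hA0 : ∀ i, A l 0 i = q l := by
    intro i; rw [← hq0]; simp [A]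
  have hl2 : (l.choose 2 : ℂ) * q (l - 2) = 0 := by
    rcases lt_or_ge l 2 with h | h
    · rw [Nat.choose_eq_zero_of_lt h]; simp
    · rw [hlt (l - 2) (by omega), mul_zero]
  have hA1 : (l : ℂ) * A l 1 0 = l * q l := by
    rcases Nat.eq_zero_or_pos l with h | h
    · simp [h]
    · congr 1
      rw [← hq0]
      simp only [A, pow_one]
      congr 1
      funext k
      rw [← pow_succ, Nat.sub_add_cancel h]
  have hδ1 : ∑ i, δ i * A l 1 i = A l 1 0 := by simp [δ]
  have hδ2 : ∑ i, δ i ^ 2 = 1 := by simp [δ, ite_pow]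
  have hsum := Finset.sum_congr rfl fun i (_ : i ∈ Finset.univ) => hcoeff i
  simp only [hA0] at hsum
  rw [← Finset.mul_sum, ← Finset.mul_sum, ← Finset.mul_sum, hA2, Finset.sum_add_distrib,
    Finset.sum_add_distrib, ← Finset.mul_sum, hA2, ← Finset.mul_sum, hδ1, ← Finset.sum_mul,
    Finset.sum_add_distrib, hl2] at hsum
  have h3 : ∑ i, 2 * δ i ^ 2 * (j : ℂ) * (j - 1) = 2 * (j : ℂ) * (j - 1) := by
    rw [← Finset.sum_mul, ← Finset.sum_mul, ← Finset.mul_sum, hδ2]; ring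
  rw [h3] at hsum
  refine mul_left_cancel₀ hl (hsum.trans ?_)
  simp only [Finset.sum_const, Finset.card_univ, Fintype.card_fin, nsmul_eq_mul]
  linear_combination q m * 2 * j * hA1

/-- The moments are determined up to a scalar: for some `l`, the non-zero ones are among those of
degree `l + 2j`, and these are the Taylor coefficients of a Bessel function. -/
theorem exists_moment_formula (hπ : IsSpherical π) (hv₀ : v₀ ≠ 0)
    (hfix : IsFixedByStabilizer π v₀) : ∃ (l : ℕ) (q : ℕ → ℂ), q l ≠ 0 ∧
      (∀ m < l, q m = 0) ∧ (∀ m x, moment π v₀ m x = (q m * (‖x‖ : ℂ) ^ m) • π (rot x) v₀) ∧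
      (∀ m, (∀ j, m ≠ l + 2 * j) → q m = 0) ∧
      ∀ j, q (l + 2 * j) / (l + 2 * j).factorial = q l / l.factorial *
        ∏ i ∈ Finset.range j, (4 * ((i : ℂ) + 1) * (((n / 2 + l : ℝ) : ℂ) + i))⁻¹ := by
  classical
  obtain ⟨q, hq⟩ := exists_moment_eq hπ hv₀ hfix
  have hrot : π (rot (e₁ n)) v₀ = v₀ := by
    refine hfix _ ?_
    simpa using norm_smul_rot (e₁ n)
  have hqe : ∀ m, moment π v₀ m (e₁ n) = q m • v₀ := fun m => by
    rw [hq, hrot, norm_e₁]; simp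
  have hex : ∃ m, q m ≠ 0 := by
    obtain ⟨m, hm⟩ := exists_moment_ne_zero hπ.continuous hv₀ hfix
    exact ⟨m, fun h => hm (by rw [hqe, h, zero_smul])⟩
  obtain ⟨l, hl, hlt⟩ : ∃ l, q l ≠ 0 ∧ ∀ m < l, q m = 0 :=
    ⟨Nat.find hex, Nat.find_spec hex, fun m hm => not_not.1 (Nat.find_min hex hm)⟩
  have hneg : ∀ m, q m • π (-1) v₀ = (q m * (-1) ^ m) • v₀ := by
    intro m
    have h1 := moment_act hπ.continuous (v₀ := v₀) m (-1) (e₁ n)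
    rw [act_neg_one, ← neg_one_smul ℝ, moment_smul, hqe, map_smul, smul_smul] at h1
    rw [← h1, mul_comm]
    simp
  refine ⟨l, q, hl, hlt, hq, fun m hm => ?_, fun j => ?_⟩
  · rcases lt_or_ge m l with h | h
    · exact hlt m h
    obtain ⟨d, rfl⟩ := Nat.exists_eq_add_of_le h
    have hd : Odd d := by
      rw [← Nat.not_even_iff_odd]
      rintro ⟨j, hj⟩
      exact hm j (by omega)
    have h1 : π (-1) v₀ = ((-1 : ℂ) ^ l) • v₀ := by
      have h2 := hneg l
      rw [mul_smul] at h2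
      exact smul_right_injective _ hl h2
    have h2 := hneg (l + d)
    rw [h1, smul_smul] at h2
    have h3 := smul_left_injective ℂ hv₀ h2
    simp only [pow_add, hd.neg_one_pow] at h3
    have h4 : (-1 : ℂ) ^ l ≠ 0 := pow_ne_zero _ (by norm_num)
    have h5 : q (l + d) * (-1) ^ l * 2 = 0 := by linear_combination h3
    simpa [h4] using h5
  · induction j with
    | zero => simp
    | succ j ih =>
      have hrec := moment_recursion hπ.continuous hv₀ hfix hq hl hlt (j + 1)
      rw [show l + 2 * (j + 1) - 2 = l + 2 * j by omega, Nat.cast_choose_two] at hrec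
      rw [Finset.prod_range_succ, ← mul_assoc, ← ih,
        show l + 2 * (j + 1) = l + 2 * j + 1 + 1 by ring, Nat.factorial_succ, Nat.factorial_succ]
      rw [show l + 2 * (j + 1) = l + 2 * j + 1 + 1 by ring] at hrec
      have f1 : ((l + 2 * j).factorial : ℂ) ≠ 0 := by exact_mod_cast Nat.factorial_ne_zero _
      have f2 : ((l : ℂ) + 2 * j + 1) ≠ 0 := by exact_mod_cast Nat.succ_ne_zero (l + 2 * j)
      have f3 : ((l : ℂ) + 2 * j + 1 + 1) ≠ 0 := by exact_mod_cast Nat.succ_ne_zero (l + 2 * j + 1)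
      have f4 : ((j : ℂ) + 1) ≠ 0 := by exact_mod_cast Nat.succ_ne_zero j
      have f5 : ((n : ℂ) + 2 * l + 2 * j) ≠ 0 := by
        have := NeZero.pos n
        exact_mod_cast (by omega : n + 2 * l + 2 * j ≠ 0)
      have f6 : (((n / 2 + l : ℝ) : ℂ) + j) ≠ 0 := by
        intro h
        apply f5
        push_cast at h
        linear_combination 2 * h
      push_cast at hrec f6 ⊢
      field_simp
      field_simp at f6
      have f7 : (n : ℂ) + l * 2 + 2 * j ≠ 0 := by rwa [mul_comm (l : ℂ)]
      rw [eq_div_iff f7]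
      linear_combination -4 * hrec

end Recursion

/-! ### Evaluation of the Mellin transform of a Gaussian -/

section GaussMellin

variable {n : ℕ} [NeZero n] {V : Type*} [NormedAddCommGroup V] [NormedSpace ℂ V]
  [FiniteDimensional ℂ V] {π : Representation ℂ (K n) V} {v₀ : V}

theorem integrable_gauss_smul_nu (hc : ∀ v : V, Continuous fun k : K n => π k v)
    (hfix : IsFixedByStabilizer π v₀) (b : E n) {z : ℂ} (hz : 0 < z.re) {s : ℂ} (hs : 0 < s.re) :
    Integrable fun x : E n => gauss z b x • nu π v₀ (s - n) x := by
  obtain ⟨C, hC, hnu⟩ := exists_norm_nu_le (v₀ := v₀) hc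
  refine ((integrable_gauss_mul (b := b) hz hs).const_mul C).mono'
    ((continuous_gauss z b).aestronglyMeasurable.smul
      (stronglyMeasurable_nu hc hfix _).aestronglyMeasurable) ?_
  filter_upwards [ae_ne_zero] with x hx
  rw [norm_smul]
  have := hnu (s - n) x hx
  rw [Complex.sub_re, Complex.natCast_re] at this
  calc ‖gauss z b x‖ * ‖nu π v₀ (s - n) x‖ ≤ ‖gauss z b x‖ * (C * ‖x‖ ^ (s.re - n)) := by gcongr
    _ = _ := by ring

/-- The Fourier transform of the spherical vector, as a power series in the moments. -/
theorem hasSum_moment (hc : ∀ v : V, Continuous fun k : K n => π k v) (c : ℂ) (b : E n) :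
    HasSum (fun m : ℕ => (c ^ m / m.factorial) • moment π v₀ m b)
      (∫ k, Complex.exp (c * (inner ℝ b (act (k : Mat n) (e₁ n)) : ℝ)) • π k v₀ ∂haarK n) := by
  have := FiniteDimensional.complete ℂ V
  obtain ⟨C, hC, hpi⟩ := exists_norm_piL_le hc
  have hsum : Summable fun m : ℕ => (‖c‖ * ‖b‖) ^ m / m.factorial * (C * ‖v₀‖) :=
    (Real.summable_pow_div_factorial _).mul_right _
  have key := hasSum_integral_of_dominated_convergence (μ := haarK n)
    (F := fun (m : ℕ) (k : K n) => (c ^ m / m.factorial) •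
      ((((inner ℝ b (act (k : Mat n) (e₁ n)) : ℝ) : ℂ) ^ m) • π k v₀))
    (f := fun k : K n => Complex.exp (c * (inner ℝ b (act (k : Mat n) (e₁ n)) : ℝ)) • π k v₀)
    (fun m _ => (‖c‖ * ‖b‖) ^ m / m.factorial * (C * ‖v₀‖))
    (fun m => ((continuous_moment_integrand hc m b).const_smul _).aestronglyMeasurable)
    (fun m => ae_of_all _ fun k => ?_) (ae_of_all _ fun k => hsum) (integrable_const _)
    (ae_of_all _ fun k => ?_)
  · simp only [integral_smul] at key
    exact key
  · rw [norm_smul, norm_smul, norm_div, norm_pow, norm_pow, Complex.norm_natCast, Complex.norm_real,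
      Real.norm_eq_abs, mul_pow, div_mul_eq_mul_div, div_mul_eq_mul_div, mul_assoc]
    have h1 := abs_inner_orbit_le b k
    have h2 : ‖π k v₀‖ ≤ C * ‖v₀‖ := ((piL π k).le_opNorm v₀).trans (by gcongr; exact hpi k)
    gcongr
  · have h := NormedSpace.expSeries_div_hasSum_exp
      (c * ((inner ℝ b (act (k : Mat n) (e₁ n)) : ℝ) : ℂ))
    rw [← Complex.exp_eq_exp_ℂ] at h
    convert! h.smul_const (π k v₀) using 2 with m
    rw [smul_smul, mul_pow, div_mul_eq_mul_div]

/-- Averaging over `O(n)` replaces the integrand on each sphere by its mean value. -/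
theorem integral_gauss_smul_nu_eq (hc : ∀ v : V, Continuous fun k : K n => π k v)
    (hfix : IsFixedByStabilizer π v₀) (b : E n) {z : ℂ} (hz : 0 < z.re) {s : ℂ} (hs : 0 < s.re) :
    ∫ x : E n, gauss z b x • nu π v₀ (s - n) x =
      ∫ x : E n, ((‖x‖ : ℂ) ^ (s - n) * Complex.exp (-(Real.pi * z * ‖x‖ ^ 2))) •
        ∫ k, Complex.exp ((-2 * Real.pi * Complex.I * ‖x‖) *
          (inner ℝ b (act (k : Mat n) (e₁ n)) : ℝ)) • π k v₀ ∂haarK n := by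
  have := FiniteDimensional.complete ℂ V
  rw [integral_eq_integral_integral_act (integrable_gauss_smul_nu hc hfix b hz hs)]
  refine integral_congr_ae ?_
  filter_upwards [ae_ne_zero] with x hx
  obtain ⟨r, k₀, hr, rfl⟩ := exists_eq_smul_act hx
  have hn : ‖r • act (k₀ : Mat n) (e₁ n)‖ = r := by
    rw [norm_smul, norm_act, norm_e₁, mul_one, Real.norm_of_nonneg hr.le]
  rw [hn, ← integral_smul]
  conv_rhs => rw [← integral_mul_right_eq_self _ k₀]
  refine integral_congr_ae (ae_of_all _ fun k => ?_)
  beta_reduce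
  rw [act_smul', ← act_coe_mul, nu_eq π v₀ hfix _ _ hr, gauss, smul_smul, smul_smul,
    norm_smul, norm_act, norm_e₁, mul_one, Real.norm_of_nonneg hr.le, real_inner_smul_right,
    sub_eq_add_neg, Complex.exp_add]
  congr 1
  push_cast
  ring_nf

/-- Expanding the exponential and integrating radially, the integral becomes a series of moments. -/
theorem hasSum_integral_gauss_smul_nu (hc : ∀ v : V, Continuous fun k : K n => π k v)
    (hfix : IsFixedByStabilizer π v₀) (b : E n) {z : ℂ} (hz : 0 < z.re) {s : ℂ} (hs : 0 < s.re) :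
    HasSum (fun m : ℕ => ((n * (volume : Measure (E n)).real (Metric.ball 0 1) / 2 *
        ((Real.pi * z) ^ (-((s + m) / 2)) * Complex.Gamma ((s + m) / 2))) *
          ((-2 * Real.pi * Complex.I) ^ m / m.factorial)) • moment π v₀ m b)
      (∫ x : E n, gauss z b x • nu π v₀ (s - n) x) := by
  have := FiniteDimensional.complete ℂ V
  obtain ⟨C, hC, hpi⟩ := exists_norm_piL_le hc
  set D : ℝ := C * ‖v₀‖
  have hmom : ∀ m, ‖moment π v₀ m b‖ ≤ ‖b‖ ^ m * D := by
    intro m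
    refine (norm_integral_le_of_norm_le_const (C := ‖b‖ ^ m * D) (ae_of_all _ fun k => ?_)).trans ?_
    · rw [norm_smul, norm_pow, Complex.norm_real, Real.norm_eq_abs]
      have h1 := abs_inner_orbit_le b k
      have h2 : ‖π k v₀‖ ≤ D := ((piL π k).le_opNorm v₀).trans (by
        exact mul_le_mul_of_nonneg_right (hpi k) (norm_nonneg _))
      gcongr
    · rw [probReal_univ, mul_one]
  set c : ℝ := 2 * Real.pi * ‖b‖ with hcdef
  rw [integral_gauss_smul_nu_eq hc hfix b hz hs]
  set G : E n → ℂ := fun x => (‖x‖ : ℂ) ^ (s - n) * Complex.exp (-(Real.pi * z * ‖x‖ ^ 2)) with hG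
  have hGm : Measurable G := by fun_prop
  have hGn : ∀ x : E n, x ≠ 0 → ‖G x‖ = ‖x‖ ^ (s.re - n) * Real.exp (-(Real.pi * z.re) * ‖x‖ ^ 2) := by
    intro x hx
    simp only [hG]
    rw [norm_mul, Complex.norm_cpow_eq_rpow_re_of_pos (norm_pos_iff.2 hx), Complex.norm_exp,
      Complex.sub_re, Complex.natCast_re, Complex.neg_re, ← Complex.ofReal_pow,
      Complex.re_mul_ofReal, Complex.re_ofReal_mul, neg_mul]
  have hexp : ∀ y : ℝ, HasSum (fun m : ℕ => (c * y) ^ m / m.factorial) (Real.exp (c * y)) := by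
    intro y
    rw [Real.exp_eq_exp_ℝ]
    exact NormedSpace.expSeries_div_hasSum_exp _
  have key := hasSum_integral_of_dominated_convergence (μ := (volume : Measure (E n)))
    (F := fun (m : ℕ) (x : E n) => (G x * ((-2 * Real.pi * Complex.I * ‖x‖) ^ m / m.factorial)) •
      moment π v₀ m b)
    (f := fun x : E n => G x • ∫ k, Complex.exp ((-2 * Real.pi * Complex.I * ‖x‖) *
          (inner ℝ b (act (k : Mat n) (e₁ n)) : ℝ)) • π k v₀ ∂haarK n)
    (fun m x => ‖G x‖ * D * ((c * ‖x‖) ^ m / m.factorial))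
    (fun m => ?_) (fun m => ae_of_all _ fun x => ?_)
    (ae_of_all _ fun x => (hexp ‖x‖).summable.mul_left _) ?_ (ae_of_all _ fun x => ?_)
  · refine key.congr_fun fun m => ?_
    have hsm : 0 < (s + m).re := by
      rw [Complex.add_re, Complex.natCast_re]; positivity
    rw [integral_smul_const, ← integral_cpow_norm_mul_gauss hsm hz, ← integral_mul_const]
    congr 1
    refine integral_congr_ae ?_
    filter_upwards [ae_ne_zero] with x hx
    have hx' : (‖x‖ : ℂ) ≠ 0 := by exact_mod_cast norm_ne_zero_iff.2 hx
    simp only [hG]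
    rw [add_sub_right_comm, Complex.cpow_add _ _ hx', Complex.cpow_natCast, mul_pow _ (‖x‖ : ℂ)]
    ring
  · exact (hGm.mul (by fun_prop)).aestronglyMeasurable.smul aestronglyMeasurable_const
  · rw [norm_smul, norm_mul, norm_div, norm_pow, Complex.norm_natCast]
    have h1 : ‖-2 * (Real.pi : ℂ) * Complex.I * (‖x‖ : ℂ)‖ = 2 * Real.pi * ‖x‖ := by
      simp [abs_of_pos Real.pi_pos]
    rw [h1]
    calc _ ≤ ‖G x‖ * ((2 * Real.pi * ‖x‖) ^ m / m.factorial) * (‖b‖ ^ m * D) := by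
          gcongr; exact hmom m
      _ = _ := by rw [hcdef]; ring
  · simp only [tsum_mul_left, (hexp _).tsum_eq]
    have h1 : 0 < Real.pi * z.re := mul_pos Real.pi_pos hz
    have h2 := ((integrable_norm_rpow_mul_exp (n := n) hs (half_pos h1)).const_mul
      (|D| * Real.exp (c ^ 2 / (2 * (Real.pi * z.re)))))
    refine h2.mono' ((hGm.norm.mul_const _).mul (by fun_prop)).aestronglyMeasurable ?_
    filter_upwards [ae_ne_zero] with x hx
    rw [norm_mul, norm_mul, norm_norm, hGn x hx, Real.norm_eq_abs, Real.norm_eq_abs, Real.abs_exp]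
    have h3 : Real.exp (-(Real.pi * z.re) * ‖x‖ ^ 2) * Real.exp (c * ‖x‖) ≤
        Real.exp (c ^ 2 / (2 * (Real.pi * z.re))) *
          Real.exp (-(Real.pi * z.re / 2) * ‖x‖ ^ 2) := by
      rw [← Real.exp_add, ← Real.exp_add, Real.exp_le_exp]
      generalize Real.pi * z.re = p at h1
      have h4 : c ^ 2 / (2 * p) + -(p / 2) * ‖x‖ ^ 2 - (-p * ‖x‖ ^ 2 + c * ‖x‖) =
          (c - p * ‖x‖) ^ 2 / (2 * p) := by field_simp; ring
      have h5 : 0 ≤ (c - p * ‖x‖) ^ 2 / (2 * p) := by positivity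
      linarith
    calc _ = ‖x‖ ^ (s.re - n) * |D| * (Real.exp (-(Real.pi * z.re) * ‖x‖ ^ 2) *
          Real.exp (c * ‖x‖)) := by ring
      _ ≤ ‖x‖ ^ (s.re - n) * |D| * (Real.exp (c ^ 2 / (2 * (Real.pi * z.re))) *
          Real.exp (-(Real.pi * z.re / 2) * ‖x‖ ^ 2)) := by gcongr
      _ = _ := by ring
  · simp only [mul_smul]
    exact (hasSum_moment hc _ b).const_smul (G x)

/-- The Mellin transform of a Gaussian with `Re z > 0` is, up to elementary factors, a Kummer
function. -/
theorem exists_integral_gauss_smul_nu_eq_kummer (hπ : IsSpherical π) (hv₀ : v₀ ≠ 0)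
    (hfix : IsFixedByStabilizer π v₀) : ∃ (l : ℕ) (A : ℂ), A ≠ 0 ∧
      (l = 0 → moment π v₀ 0 (e₁ n) ≠ 0) ∧
      ∀ (b : E n) (z s : ℂ), 0 < z.re → 0 < s.re → ∫ x : E n, gauss z b x • nu π v₀ (s - n) x =
        (A * Complex.Gamma ((s + l) / 2) * (Real.pi * z) ^ (-((s + l) / 2)) *
          kummer ((s + l) / 2) (n / 2 + l) (-(Real.pi * ‖b‖ ^ 2 / z))) •
            ((‖b‖ : ℂ) ^ l • π (rot b) v₀) := by
  obtain ⟨l, q, hl, -, hq, hq0, hqf⟩ := exists_moment_formula hπ hv₀ hfix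
  have hn := NeZero.pos n
  have hβ : (0 : ℝ) < n / 2 + l := by positivity
  set N : ℂ := n * (volume : Measure (E n)).real (Metric.ball 0 1) / 2 with hN
  have hN0 : N ≠ 0 := by
    have h1 : (volume : Measure (E n)).real (Metric.ball 0 1) ≠ 0 :=
      (ENNReal.toReal_pos (Metric.measure_ball_pos _ _ one_pos).ne' measure_ball_lt_top.ne).ne'
    have h2 : (n : ℂ) ≠ 0 := by exact_mod_cast hn.ne'
    have h3 : ((volume : Measure (E n)).real (Metric.ball 0 1) : ℂ) ≠ 0 := by exact_mod_cast h1
    exact div_ne_zero (mul_ne_zero h2 h3) two_ne_zero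
  have hfac : (l.factorial : ℂ) ≠ 0 := by exact_mod_cast l.factorial_ne_zero
  have h2pi : (-2 * Real.pi * Complex.I : ℂ) ≠ 0 := by simp [Real.pi_ne_zero]
  refine ⟨l, N * ((-2 * Real.pi * Complex.I) ^ l * (q l / l.factorial)),
    mul_ne_zero hN0 (mul_ne_zero (pow_ne_zero _ h2pi) (div_ne_zero hl hfac)), ?_, ?_⟩
  · rintro rfl
    rw [hq, norm_e₁]
    have hrot : π (rot (e₁ n)) v₀ = v₀ := by
      refine hfix _ ?_
      simpa using norm_smul_rot (e₁ n)
    rw [hrot]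
    simpa using ⟨hl, hv₀⟩
  intro b z s hz hs
  have hz0 : z ≠ 0 := by rintro rfl; simp at hz
  have hpz : (Real.pi * z : ℂ) ≠ 0 := mul_ne_zero (by exact_mod_cast Real.pi_ne_zero) hz0
  set α := (s + l) / 2 with hα
  have hαre : 0 < α.re := by
    rw [hα, Complex.div_ofNat_re, Complex.add_re, Complex.natCast_re]; positivity
  have hΓ : ∀ j : ℕ, Complex.Gamma (α + j) = Complex.Gamma α * ∏ i ∈ Finset.range j, (α + i) := by
    intro j
    induction j with
    | zero => simp
    | succ j ih =>
      have h1 : α + j ≠ 0 := by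
        intro h
        have h2 := congrArg Complex.re h
        rw [Complex.add_re, Complex.natCast_re, Complex.zero_re] at h2
        have : (0 : ℝ) ≤ j := j.cast_nonneg
        linarith
      rw [Nat.cast_succ, ← add_assoc, Complex.Gamma_add_one _ h1, ih, Finset.prod_range_succ]
      ring
  have hsum := hasSum_integral_gauss_smul_nu (v₀ := v₀) hπ.continuous hfix b hz hs
  rw [← hN] at hsum
  have hinj : Function.Injective fun j : ℕ => l + 2 * j := fun i j h => by
    have : l + 2 * i = l + 2 * j := h
    omega
  rw [← hinj.hasSum_iff] at hsum
  swap
  · intro m hm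
    rw [hq, hq0 m fun j h => hm ⟨j, h.symm⟩, zero_mul, zero_smul, smul_zero]
  refine hsum.unique ?_
  have hk := ((hasSum_kummer α hβ (-(Real.pi * ‖b‖ ^ 2 / z))).mul_left
    (N * ((-2 * Real.pi * Complex.I) ^ l * (q l / l.factorial)) * Complex.Gamma α *
      (Real.pi * z) ^ (-α))).smul_const ((‖b‖ : ℂ) ^ l • π (rot b) v₀)
  refine hk.congr_fun fun j => ?_
  have hexp : (s + ((l + 2 * j : ℕ) : ℂ)) / 2 = α + j := by
    rw [hα]; push_cast; ring
  rw [Function.comp_apply, hq, hexp, hΓ, neg_add, Complex.cpow_add _ _ hpz, Complex.cpow_neg _ (j : ℂ),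
    Complex.cpow_natCast, smul_smul, smul_smul]
  congr 1
  have hf2 : ((l + 2 * j).factorial : ℂ) ≠ 0 := by exact_mod_cast (l + 2 * j).factorial_ne_zero
  have hqj : q (l + 2 * j) = ((l + 2 * j).factorial : ℂ) * (q l / l.factorial *
        ∏ i ∈ Finset.range j, (4 * ((i : ℂ) + 1) * (((n / 2 + l : ℝ) : ℂ) + i))⁻¹) := by
    rw [← hqf, mul_div_cancel₀ _ hf2]
  have hprod : kummerCoeff α (n / 2 + l) j = (∏ i ∈ Finset.range j, (α + i)) * (4 ^ j *
      ∏ i ∈ Finset.range j, (4 * ((i : ℂ) + 1) * (((n / 2 + l : ℝ) : ℂ) + i))⁻¹) := by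
    have h4 : (4 : ℂ) ^ j = ∏ i ∈ Finset.range j, 4 := by simp
    rw [kummerCoeff, h4, ← Finset.prod_mul_distrib, ← Finset.prod_mul_distrib]
    refine Finset.prod_congr rfl fun i _ => ?_
    rw [mul_inv, mul_inv, mul_assoc (4 : ℂ)⁻¹, mul_inv_cancel_left₀ (by norm_num), div_eq_mul_inv,
      mul_inv, mul_comm ((i : ℂ) + 1)⁻¹]
  rw [hqj, hprod]
  generalize ∏ i ∈ Finset.range j, (4 * ((i : ℂ) + 1) * (((n / 2 + l : ℝ) : ℂ) + i))⁻¹ = Q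
  generalize ∏ i ∈ Finset.range j, (α + i) = R
  clear_value N
  have hI : (-2 * Real.pi * Complex.I : ℂ) ^ (l + 2 * j) =
      (-2 * Real.pi * Complex.I) ^ l * (-1) ^ j * (4 * Real.pi ^ 2) ^ j := by
    rw [pow_add, pow_mul, mul_assoc (_ ^ l), ← mul_pow]
    congr 2
    linear_combination 4 * (Real.pi : ℂ) ^ 2 * Complex.I_sq
  have hW : (-(Real.pi * (‖b‖ : ℂ) ^ 2 / z)) ^ j =
      (-1) ^ j * (Real.pi ^ 2) ^ j * (‖b‖ : ℂ) ^ (2 * j) * ((Real.pi * z) ^ j)⁻¹ := by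
    rw [← inv_pow, pow_mul, ← mul_pow, ← mul_pow, ← mul_pow]
    congr 1
    have : (Real.pi : ℂ) ≠ 0 := by exact_mod_cast Real.pi_ne_zero
    field_simp
  rw [hI, hW, mul_pow (4 : ℂ), pow_add]
  field_simp

end GaussMellin

/-! ### Schur's lemma and the spherical vector -/

section Schur

variable {n : ℕ} [NeZero n] {V : Type*} [NormedAddCommGroup V] [NormedSpace ℂ V]
  [FiniteDimensional ℂ V] {π : Representation ℂ (K n) V} {v₀ : V}

omit [NeZero n] in
theorem exists_eq_smul_of_commute (hπ : π.IsIrreducible) {T : V →ₗ[ℂ] V}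
    (hT : ∀ k v, T (π k v) = π k (T v)) : ∃ c : ℂ, ∀ v, T v = c • v := by
  obtain ⟨c, hc⟩ := (Representation.IsIrreducible.algebraMap_intertwiningMap_bijective_of_isAlgClosed
    (ρ := π)).2 ⟨T, fun k => LinearMap.ext (hT k)⟩
  refine ⟨c, fun v => ?_⟩
  have := congrArg (fun f : Representation.IntertwiningMap π π => f v) hc
  exact this.symm

omit [NeZero n] [FiniteDimensional ℂ V] in
theorem isTrivial_of_fixed (hπ : π.IsIrreducible) {v : V} (hv : v ≠ 0) (hfix : ∀ k, π k v = v) :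
    π.IsTrivial := by
  let S : Subrepresentation π :=
    { toSubmodule := ⨅ k, LinearMap.eqLocus (π k) LinearMap.id
      apply_mem_toSubmodule := fun g w hw => by
        simp only [Submodule.mem_iInf, LinearMap.mem_eqLocus, LinearMap.id_apply] at hw ⊢
        intro k
        rw [hw g, hw k] }
  have hvS : v ∈ S.toSubmodule := by
    simp only [S, Submodule.mem_iInf, LinearMap.mem_eqLocus, LinearMap.id_apply]
    exact hfix
  rcases hπ.eq_bot_or_eq_top S with h | h
  · rw [h] at hvS
    exact absurd hvS hv
  · refine ⟨fun g => LinearMap.ext fun w => ?_⟩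
    have hw : w ∈ S.toSubmodule := by rw [h]; trivial
    simp only [S, Submodule.mem_iInf, LinearMap.mem_eqLocus, LinearMap.id_apply] at hw
    exact hw g

omit [NeZero n] in
theorem continuous_apply_apply (hc : ∀ v : V, Continuous fun k : K n => π k v) {X : Type*}
    [TopologicalSpace X] {f : X → K n} {g : X → V} (hf : Continuous f) (hg : Continuous g) :
    Continuous fun x => π (f x) (g x) :=
  ((continuous_piL hc).comp hf).clm_apply hg

omit [NeZero n] in
theorem apply_integral (m : K n) {f : K n → V}
    (hf : Continuous f) : π m (∫ k, f k ∂haarK n) = ∫ k, π m (f k) ∂haarK n := by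
  have := FiniteDimensional.complete ℂ V
  exact ((piL π m).integral_comp_comm (integrable_haarK hf)).symm

omit [NeZero n] in
/-- Schur's orthogonality relation. -/
theorem finrank_smul_integral_inv_smul (hc : ∀ v : V, Continuous fun k : K n => π k v)
    (hπ : π.IsIrreducible) (θ : V →L[ℂ] ℂ) (v x : V) :
    (Module.finrank ℂ V : ℂ) • ∫ k, θ (π k⁻¹ x) • π k v ∂haarK n = θ v • x := by
  have := FiniteDimensional.complete ℂ V
  have hcont : ∀ x, Continuous fun k : K n => θ (π k⁻¹ x) • π k v := fun x =>
    (θ.continuous.comp (continuous_apply_apply hc continuous_inv continuous_const)).smul (hc v)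
  let T : V →ₗ[ℂ] V :=
    { toFun := fun x => ∫ k, θ (π k⁻¹ x) • π k v ∂haarK n
      map_add' := fun x y => by
        rw [← integral_add (integrable_haarK (hcont x)) (integrable_haarK (hcont y))]
        simp only [map_add, add_smul]
      map_smul' := fun c x => by
        rw [RingHom.id_apply, ← integral_smul]
        simp only [map_smul, smul_eq_mul, mul_smul] }
  have hT : ∀ k x, T (π k x) = π k (T x) := by
    intro m x
    change ∫ k, θ (π k⁻¹ (π m x)) • π k v ∂haarK n = π m (∫ k, θ (π k⁻¹ x) • π k v ∂haarK n)
    rw [apply_integral m (hcont x), ← integral_mul_left_eq_self _ m]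
    congr 1
    funext k
    rw [map_smul, mul_inv_rev, map_mul π k⁻¹, Module.End.mul_apply, ← Module.End.mul_apply (π m⁻¹),
      ← map_mul, inv_mul_cancel, map_one, Module.End.one_apply, map_mul, Module.End.mul_apply]
  obtain ⟨c, hTc⟩ := exists_eq_smul_of_commute hπ hT
  -- The scalar is found by taking the trace.
  let e := Module.finBasis ℂ V
  have htr : (Module.finrank ℂ V : ℂ) * c = θ v := by
    have h1 : ∀ i, e.repr (T (e i)) i = c := fun i => by
      rw [hTc]; simp
    have h2 : ∑ i, e.repr (T (e i)) i = θ v := by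
      have h3 : ∀ i, e.repr (T (e i)) i = ∫ k, θ (π k⁻¹ (e i)) * e.repr (π k v) i ∂haarK n := by
        intro i
        have h4 := (LinearMap.toContinuousLinearMap (e.coord i)).integral_comp_comm
          (integrable_haarK (hcont (e i)))
        simp only [LinearMap.coe_toContinuousLinearMap', map_smul, smul_eq_mul,
          Module.Basis.coord_apply] at h4
        exact h4.symm
      simp only [h3]
      rw [← integral_finsetSum]
      · have h5 : ∀ k : K n, ∑ i, θ (π k⁻¹ (e i)) * e.repr (π k v) i = θ v := by
          intro k
          have h6 := congrArg (fun w => θ (π k⁻¹ w)) (e.sum_repr (π k v))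
          simp only [map_sum, map_smul, smul_eq_mul] at h6
          rw [← Module.End.mul_apply, ← map_mul, inv_mul_cancel, map_one, Module.End.one_apply] at h6
          rw [← h6]
          exact Finset.sum_congr rfl fun i _ => mul_comm _ _
        simp only [h5, integral_const, probReal_univ, one_smul]
      · intro i _
        exact integrable_haarK ((θ.continuous.comp
          (continuous_apply_apply hc continuous_inv continuous_const)).mul
          ((LinearMap.toContinuousLinearMap (e.coord i)).continuous.comp (hc v)))
    rw [← h2]
    simp [h1]
  change (Module.finrank ℂ V : ℂ) • T x = _
  rw [hTc, smul_smul, htr]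

/-- The average of `π(k)²` is a non-zero scalar. This is the non-vanishing of the Frobenius–Schur
indicator; it holds because `k⁻¹` lies in the double coset of `k` for the stabiliser of `e₁`. -/
theorem exists_integral_apply_apply_eq_smul (hπ : IsSpherical π) (hv₀ : v₀ ≠ 0)
    (hfix : IsFixedByStabilizer π v₀) :
    ∃ c : ℂ, c ≠ 0 ∧ ∀ v, ∫ k, π k (π k v) ∂haarK n = c • v := by
  have := FiniteDimensional.complete ℂ V
  have hc := hπ.continuous
  have hcont : ∀ v, Continuous fun k : K n => π k (π k v) := fun v =>
    continuous_apply_apply hc continuous_id (hc v)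
  let T : V →ₗ[ℂ] V :=
    { toFun := fun v => ∫ k, π k (π k v) ∂haarK n
      map_add' := fun x y => by
        rw [← integral_add (integrable_haarK (hcont x)) (integrable_haarK (hcont y))]
        simp only [map_add]
      map_smul' := fun c x => by
        rw [RingHom.id_apply, ← integral_smul]
        simp only [map_smul] }
  have hT : ∀ k x, T (π k x) = π k (T x) := by
    intro m x
    change ∫ k, π k (π k (π m x)) ∂haarK n = π m (∫ k, π k (π k x) ∂haarK n)
    rw [apply_integral m (hcont x), ← integral_mul_left_eq_self _ m,
      ← integral_mul_right_eq_self _ m⁻¹]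
    congr 1
    funext k
    simp only [← Module.End.mul_apply, ← map_mul]
    congr 2
    group
  obtain ⟨c, hTc⟩ := exists_eq_smul_of_commute hπ.irreducible hT
  refine ⟨c, ?_, hTc⟩
  -- A functional `η` invariant under the stabiliser of `e₁`, with `η v₀ ≠ 0`.
  obtain ⟨m, hm⟩ := exists_moment_ne_zero hc hv₀ hfix
  obtain ⟨q, hq⟩ : ∃ q : ℂ, moment π v₀ m (e₁ n) = q • v₀ :=
    hπ.exists_eq_smul hv₀ hfix fun k hk => by rw [← moment_act hc, hk]
  obtain ⟨θ, hθ⟩ := SeparatingDual.exists_eq_one (R := ℂ) hv₀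
  let ηl : V →ₗ[ℂ] ℂ :=
    { toFun := fun v => θ (moment π v m (e₁ n))
      map_add' := fun x y => by
        rw [← map_add, moment, moment, moment, ← integral_add
          (integrable_haarK (continuous_moment_integrand hc _ _))
          (integrable_haarK (continuous_moment_integrand hc _ _))]
        simp only [map_add, smul_add]
      map_smul' := fun c x => by
        rw [RingHom.id_apply, ← map_smul, moment, moment, ← integral_smul]
        simp only [map_smul, smul_comm c] }
  let η : V →L[ℂ] ℂ := LinearMap.toContinuousLinearMap ηl
  have hη : ∀ v, η v = θ (moment π v m (e₁ n)) := fun v => rfl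
  have hη0 : η v₀ ≠ 0 := by
    rw [hη, hq, map_smul, hθ, smul_eq_mul, mul_one]
    rintro rfl
    exact hm (by rw [hq, zero_smul])
  have hηinv : ∀ k : K n, act (k : Mat n) (e₁ n) = e₁ n → ∀ v, η (π k v) = η v := by
    intro k hk v
    rw [hη, hη, moment, moment, ← integral_mul_right_eq_self _ k⁻¹]
    congr 2
    funext k'
    have h1 : act ((k⁻¹ : K n) : Mat n) (e₁ n) = e₁ n := by
      conv_lhs => rw [← hk]
      rw [act_inv_act]
    rw [act_coe_mul, h1, ← Module.End.mul_apply, ← map_mul, inv_mul_cancel_right]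
  have hηsymm : ∀ k : K n, η (π k⁻¹ v₀) = η (π k v₀) := by
    intro k
    obtain ⟨m₁, m₂, h1, h2, h3⟩ := exists_inv_eq_mul_mul k
    rw [h3, map_mul, map_mul, Module.End.mul_apply, Module.End.mul_apply, hfix m₂ h2, hηinv m₁ h1]
  -- The vector `w = ∫ η(π(k) v₀) π(k) v₀ dk` is a non-zero multiple of `v₀`, and `T w = w / dim V`.
  have hwc : Continuous fun k : K n => η (π k v₀) • π k v₀ :=
    (η.continuous.comp (hc v₀)).smul (hc v₀)
  have hw : (Module.finrank ℂ V : ℂ) • ∫ k, η (π k v₀) • π k v₀ ∂haarK n = η v₀ • v₀ := by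
    rw [← finrank_smul_integral_inv_smul hc hπ.irreducible η v₀ v₀]
    simp only [hηsymm]
  have hTw : (Module.finrank ℂ V : ℂ) • T (∫ k, η (π k v₀) • π k v₀ ∂haarK n) =
      ∫ k, η (π k v₀) • π k v₀ ∂haarK n := by
    have h1 : ∀ m : K n, π m (π m (∫ k, η (π k v₀) • π k v₀ ∂haarK n)) =
        ∫ k, η (π m⁻¹ (π k v₀)) • π m (π k v₀) ∂haarK n := by
      intro m
      rw [apply_integral m hwc, apply_integral m (continuous_apply_apply hc continuous_const hwc),
        ← integral_mul_left_eq_self _ m⁻¹]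
      congr 1
      funext k
      simp only [map_smul, ← Module.End.mul_apply, ← map_mul]
      rw [mul_inv_cancel_left]
    change _ • ∫ m, π m (π m (∫ k, η (π k v₀) • π k v₀ ∂haarK n)) ∂haarK n = _
    simp only [h1]
    rw [integral_integral_swap_of_hasCompactSupport _ (HasCompactSupport.of_compactSpace _),
      ← integral_smul]
    · congr 1
      funext k
      exact finrank_smul_integral_inv_smul hc hπ.irreducible η (π k v₀) (π k v₀)
    · have hk : Continuous fun p : K n × K n => π p.2 v₀ := (hc v₀).comp continuous_snd
      exact (η.continuous.comp (continuous_apply_apply hc (continuous_inv.comp continuous_fst)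
        hk)).smul (continuous_apply_apply hc continuous_fst hk)
  rintro rfl
  rw [hTc, zero_smul, smul_zero] at hTw
  rw [← hTw, smul_zero] at hw
  exact smul_ne_zero hη0 hv₀ hw.symm

end Schur

/-! ### Hecke operators concentrated near the orthogonal group -/

section Bump

variable {n : ℕ}

/-- The square of the Frobenius norm of a matrix. -/
def sumSq (m : Mat n) : ℝ := ∑ i, ∑ j, m i j ^ 2

theorem sumSq_eq_trace (m : Mat n) : sumSq m = (m * m.transpose).trace := by
  simp only [sumSq, Matrix.trace, Matrix.diag, Matrix.mul_apply, Matrix.transpose_apply, sq]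

theorem transpose_mul_coe (k : K n) : (k : Mat n).transpose * (k : Mat n) = 1 := by
  simpa [Matrix.star_eq_conjTranspose] using (Matrix.mem_orthogonalGroup_iff' (Fin n) ℝ).1 k.2

theorem coe_mul_transpose (k : K n) : (k : Mat n) * (k : Mat n).transpose = 1 := by
  simpa [Matrix.star_eq_conjTranspose] using (Matrix.mem_orthogonalGroup_iff (Fin n) ℝ).1 k.2

theorem sumSq_mul_mul (k k' : K n) (m : Mat n) : sumSq ((k : Mat n) * m * (k' : Mat n)) = sumSq m := by
  rw [sumSq_eq_trace, sumSq_eq_trace, Matrix.transpose_mul, Matrix.transpose_mul, Matrix.trace_mul_comm]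
  have : (k' : Mat n).transpose * (m.transpose * (k : Mat n).transpose) * ((k : Mat n) * m * (k' : Mat n)) =
      (k' : Mat n).transpose * (m.transpose * ((k : Mat n).transpose * (k : Mat n)) * m) * (k' : Mat n) := by
    simp only [Matrix.mul_assoc]
  rw [this, transpose_mul_coe, Matrix.mul_one, Matrix.trace_mul_comm, ← Matrix.mul_assoc,
    coe_mul_transpose, Matrix.one_mul, Matrix.trace_mul_comm]

theorem norm_le_of_sumSq_le {m : Fin n → Fin n → ℝ} {r : ℝ} (hr : 0 ≤ r)
    (h : sumSq (Matrix.of m) ≤ r ^ 2) : ‖m‖ ≤ r := by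
  refine (pi_norm_le_iff_of_nonneg hr).2 fun i => (pi_norm_le_iff_of_nonneg hr).2 fun j => ?_
  rw [Real.norm_eq_abs]
  refine abs_le_of_sq_le_sq ?_ hr
  refine le_trans ?_ h
  refine le_trans ?_ (Finset.single_le_sum (f := fun i => ∑ j, Matrix.of m i j ^ 2)
    (fun i _ => Finset.sum_nonneg fun j _ => sq_nonneg _) (Finset.mem_univ i))
  exact Finset.single_le_sum (f := fun j => Matrix.of m i j ^ 2)
    (fun j _ => sq_nonneg _) (Finset.mem_univ j)

theorem contDiff_sumSq : ContDiff ℝ ∞ fun m : Fin n → Fin n → ℝ => sumSq (Matrix.of m) :=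
  ContDiff.sum fun i _ => ContDiff.sum fun j _ => (contDiff_entry i j).pow 2

theorem continuous_sumSq : Continuous (sumSq : Mat n → ℝ) :=
  (contDiff_sumSq (n := n)).continuous

/-- A smooth `K`-bi-invariant bump function on matrices, supported where `c · sumSq ≤ 1`. -/
def bump (c : ℝ) (m : Mat n) : ℝ := Real.smoothTransition (1 - c * sumSq m)

theorem bump_nonneg (c : ℝ) (m : Mat n) : 0 ≤ bump c m := Real.smoothTransition.nonneg _

theorem bump_mul_mul (c : ℝ) (k k' : K n) (m : Mat n) :
    bump c ((k : Mat n) * m * (k' : Mat n)) = bump c m := by rw [bump, sumSq_mul_mul, bump]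

theorem bump_eq_zero {c : ℝ} {m : Mat n} (h : ¬ c * sumSq m ≤ 1) : bump c m = 0 :=
  Real.smoothTransition.zero_of_nonpos (by linarith [not_le.1 h])

theorem contDiff_bump (c : ℝ) : ContDiff ℝ ∞ fun m : Fin n → Fin n → ℝ => bump c (Matrix.of m) :=
  Real.smoothTransition.contDiff.comp (contDiff_const.sub (contDiff_const.mul contDiff_sumSq))

theorem continuous_bump (c : ℝ) : Continuous (bump c : Mat n → ℝ) :=
  (contDiff_bump (n := n) c).continuous

theorem isCompact_sumSq_le {c : ℝ} (hc : 0 < c) : IsCompact {m : Mat n | c * sumSq m ≤ 1} := by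
  have hcl : IsClosed {m : Fin n → Fin n → ℝ | c * sumSq (Matrix.of m) ≤ 1} :=
    isClosed_le (continuous_const.mul contDiff_sumSq.continuous) continuous_const
  have := (isCompact_closedBall (0 : Fin n → Fin n → ℝ) (Real.sqrt c⁻¹)).of_isClosed_subset hcl
    fun m (hm : c * sumSq (Matrix.of m) ≤ 1) => by
      rw [mem_closedBall_zero_iff]
      refine norm_le_of_sumSq_le (Real.sqrt_nonneg _) ?_
      rw [Real.sq_sqrt (by positivity), ← one_div, le_div_iff₀ hc]
      linarith
  exact this

theorem isCompact_sumSq_sub_le {c : ℝ} (hc : 0 < c) :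
    IsCompact {g : Mat n | ∃ k : K n, c * sumSq (g - (k : Mat n)) ≤ 1} := by
  have h := ((isCompact_univ (X := K n)).prod (isCompact_sumSq_le (n := n) hc)).image
    (f := fun p : K n × Mat n => (p.1 : Mat n) + p.2)
    ((continuous_subtype_val.comp continuous_fst).add continuous_snd)
  convert h using 1
  ext g
  constructor
  · rintro ⟨k, hk⟩
    exact ⟨(k, g - k), ⟨mem_univ _, hk⟩, add_sub_cancel _ _⟩
  · rintro ⟨⟨k, m⟩, ⟨-, hm⟩, rfl⟩
    exact ⟨k, by simpa using hm⟩

theorem det_ne_zero_of_sumSq_sub_le {c : ℝ}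
    (hdet : ∀ h : Mat n, c * sumSq (h - 1) ≤ 1 → h.det ≠ 0) {g : Mat n} {k : K n}
    (hg : c * sumSq (g - (k : Mat n)) ≤ 1) : g.det ≠ 0 := by
  have h1 : ((k⁻¹ : K n) : Mat n) * (g - (k : Mat n)) * ((1 : K n) : Mat n) =
      ((k⁻¹ : K n) : Mat n) * g - 1 := by
    rw [Submonoid.coe_one, Matrix.mul_one, Matrix.mul_sub, ← Submonoid.coe_mul, inv_mul_cancel,
      Submonoid.coe_one]
  rw [← sumSq_mul_mul k⁻¹ 1, h1] at hg
  have := hdet _ hg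
  rw [Matrix.det_mul] at this
  exact right_ne_zero_of_mul this

variable {V : Type*} [NormedAddCommGroup V] [NormedSpace ℂ V]
  [FiniteDimensional ℂ V] {π : Representation ℂ (K n) V}

variable (π) in
/-- The element `g ↦ ∫_K bump(g - k) π(k) dk` of the Hecke algebra. -/
def heckeBump (c : ℝ) (g : Mat n) : V →L[ℂ] V :=
  ∫ k : K n, bump c (g - (k : Mat n)) • piL π k ∂haarK n

theorem continuous_bump_sub_smul_piL (hc : ∀ v : V, Continuous fun k : K n => π k v) (c : ℝ)
    (g : Mat n) : Continuous fun k : K n => bump c (g - (k : Mat n)) • piL π k :=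
  ((continuous_bump c).comp (continuous_const.sub continuous_subtype_val)).smul (continuous_piL hc)

theorem heckeBump_apply (hc : ∀ v : V, Continuous fun k : K n => π k v) (c : ℝ) (g : Mat n)
    (v : V) : heckeBump π c g v = ∫ k : K n, bump c (g - (k : Mat n)) • π k v ∂haarK n := by
  have := FiniteDimensional.complete ℂ V
  rw [heckeBump, ContinuousLinearMap.integral_apply
    (integrable_haarK (continuous_bump_sub_smul_piL hc c g))]
  rfl

/-- `heckeBump` is the convolution of a smooth compactly supported function with the image of the
measure `π(k) dk` in the space of matrices. -/
theorem contDiff_heckeBump (hc : ∀ v : V, Continuous fun k : K n => π k v) {c : ℝ} (hc0 : 0 < c) :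
    ContDiff ℝ ∞ fun g : Fin n → Fin n → ℝ => heckeBump π c (Matrix.of g) := by
  have := FiniteDimensional.complete ℂ V
  let ι : K n → Fin n → Fin n → ℝ := fun k => (k : Mat n)
  have hι : Continuous ι := continuous_subtype_val
  have hinj : Function.Injective ι := Subtype.val_injective
  have hemb : MeasurableEmbedding ι := (hι.isClosedEmbedding hinj).measurableEmbedding
  have hext : ∀ k, Function.extend ι (piL π) 0 (ι k) = piL π k := hinj.extend_apply _ _
  have hint : Integrable (Function.extend ι (piL π) 0) ((haarK n).map ι) := by
    rw [hemb.integrable_map_iff]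
    refine (integrable_haarK (continuous_piL hc)).congr (ae_of_all _ fun k => ?_)
    rw [Function.comp_apply, hext]
  have hsupp : HasCompactSupport fun m : Fin n → Fin n → ℝ => bump c (Matrix.of m) :=
    HasCompactSupport.intro (isCompact_sumSq_le hc0) fun m hm => bump_eq_zero hm
  have h := hsupp.contDiff_convolution_right (μ := (haarK n).map ι)
    (ContinuousLinearMap.lsmul ℝ ℝ : ℝ →L[ℝ] (V →L[ℂ] V) →L[ℝ] (V →L[ℂ] V)).flip
    hint.locallyIntegrable (contDiff_bump c)
  convert! h using 2 with g
  rw [convolution_def, hemb.integral_map]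
  simp only [hext]
  rfl

theorem isHecke_heckeBump (hc : ∀ v : V, Continuous fun k : K n => π k v) {c : ℝ} (hc0 : 0 < c)
    (hdet : ∀ h : Mat n, c * sumSq (h - 1) ≤ 1 → h.det ≠ 0) : IsHecke π (heckeBump π c) := by
  have hzero : ∀ g : Mat n, g ∉ {g : Mat n | ∃ k : K n, c * sumSq (g - (k : Mat n)) ≤ 1} →
      heckeBump π c g = 0 := by
    intro g hg
    rw [heckeBump]
    refine integral_eq_zero_of_ae (ae_of_all _ fun k => ?_)
    beta_reduce
    rw [bump_eq_zero fun h => hg ⟨k, h⟩, zero_smul]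
    rfl
  have hcpt := isCompact_sumSq_sub_le (n := n) hc0
  refine ⟨contDiff_heckeBump hc hc0, HasCompactSupport.intro hcpt fun g hg => hzero g hg, ?_, ?_⟩
  · have h1 : tsupport (heckeBump π c) ⊆
        {g : Mat n | ∃ k : K n, c * sumSq (g - (k : Mat n)) ≤ 1} :=
      closure_minimal (fun g hg => by_contra fun h => hg (hzero g h)) hcpt.isClosed
    intro g hg
    obtain ⟨k, hk⟩ := h1 hg
    exact det_ne_zero_of_sumSq_sub_le hdet hk
  · intro k₁ k₂ g v
    rw [heckeBump_apply hc, heckeBump_apply hc, apply_integral]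
    · rw [← integral_mul_left_eq_self _ k₁, ← integral_mul_right_eq_self _ k₂]
      congr 1
      funext k
      rw [Submonoid.coe_mul, Submonoid.coe_mul]
      have : (k₁ : Mat n) * g * (k₂ : Mat n) - (k₁ : Mat n) * ((k : Mat n) * (k₂ : Mat n)) =
          (k₁ : Mat n) * (g - k) * (k₂ : Mat n) := by
        simp only [Matrix.mul_sub, Matrix.sub_mul, Matrix.mul_assoc]
      rw [this, bump_mul_mul, map_mul, map_mul, LinearMap.map_smul_of_tower]
      rfl
    · exact ((continuous_bump c).comp (continuous_const.sub continuous_subtype_val)).smul (hc _)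

end Bump

/-! ### Non-vanishing of a Hecke eigenvalue -/

section Eigenvalue

variable {n : ℕ} [NeZero n] {V : Type*} [NormedAddCommGroup V] [NormedSpace ℂ V]
  [FiniteDimensional ℂ V] {π : Representation ℂ (K n) V} {v₀ : V}

omit [FiniteDimensional ℂ V] in
theorem lamVector_heckeStar_eq_integral (φ : Mat n → V →L[ℂ] V) (F : E n → V) (x : E n) :
    lamVector (heckeStar φ) F x = ∫ h : Fin n → Fin n → ℝ,
      (|(Matrix.of h).det| ^ n)⁻¹ • (|(Matrix.of h).det| • φ (Matrix.of h) (F (act (Matrix.of h) x))) := by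
  rw [← integral_comp_inv fun h : Mat n => |h.det| • φ h (F (act h x)), lamVector]
  congr 1
  funext g
  rw [heckeStar, Matrix.det_nonsing_inv, Ring.inverse_eq_inv', abs_inv]
  rfl

omit [NeZero n] in
theorem act_ne_zero {h : Mat n} (hh : h.det ≠ 0) {x : E n} (hx : x ≠ 0) : act h x ≠ 0 := by
  intro h0
  have h1 : act h⁻¹ (act h x) = x := by
    rw [← act_mul, Matrix.nonsing_inv_mul _ (isUnit_iff_ne_zero.2 hh), act_one']
  rw [h0] at h1
  exact hx (by rw [← h1]; simp [act])

omit [NeZero n] in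
theorem continuous_of : Continuous fun h : Fin n → Fin n → ℝ => (Matrix.of h : Mat n) :=
  continuous_id

variable (π v₀) in
/-- The integrand of `λ(φ*)ν_{s,π}`, for `φ` the scalar bump function near the unit matrix. -/
def bumpIntegrand (c : ℝ) (s : ℂ) (x : E n) (h : Mat n) : V :=
  ((|h.det| ^ n)⁻¹ * |h.det| * bump c (h - 1)) • nu π v₀ s (act h x)

omit [NeZero n] in
theorem continuousOn_det_weight :
    ContinuousOn (fun h : Mat n => (|h.det| ^ n)⁻¹ * |h.det|) {h | h.det ≠ 0} := by
  have hdet : Continuous fun h : Mat n => |h.det| := (continuous_id.matrix_det).abs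
  exact ((hdet.pow n).continuousOn.inv₀ fun h hh => pow_ne_zero _ (abs_ne_zero.2 hh)).mul
    hdet.continuousOn

omit [FiniteDimensional ℂ V] in
theorem continuousOn_nu_act (hc : ∀ v : V, Continuous fun k : K n => π k v)
    (hfix : IsFixedByStabilizer π v₀) (s : ℂ) {x : E n} (hx : x ≠ 0) :
    ContinuousOn (fun h : Mat n => nu π v₀ s (act h x)) {h | h.det ≠ 0} :=
  (continuousOn_nu hc hfix s).comp (Continuous.act continuous_id continuous_const).continuousOn
    fun _ hh => act_ne_zero hh hx

omit [FiniteDimensional ℂ V] in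
theorem integrable_bumpIntegrand (hc : ∀ v : V, Continuous fun k : K n => π k v)
    (hfix : IsFixedByStabilizer π v₀) {c : ℝ} (hc0 : 0 < c)
    (hdet : ∀ h : Mat n, c * sumSq (h - 1) ≤ 1 → h.det ≠ 0) (s : ℂ) {x : E n} (hx : x ≠ 0) :
    Integrable fun h : Fin n → Fin n → ℝ => bumpIntegrand π v₀ c s x (Matrix.of h) := by
  let S : Set (Fin n → Fin n → ℝ) := {h | ∃ k : K n, c * sumSq (Matrix.of h - (k : Mat n)) ≤ 1}
  have hS : IsCompact S := isCompact_sumSq_sub_le hc0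
  have hSdet : ∀ h ∈ S, (Matrix.of h).det ≠ 0 := fun h ⟨k, hk⟩ => det_ne_zero_of_sumSq_sub_le hdet hk
  have hcont : ContinuousOn (fun h : Fin n → Fin n → ℝ => bumpIntegrand π v₀ c s x (Matrix.of h)) S := by
    have h1 := (continuousOn_det_weight.comp continuous_of.continuousOn hSdet).mul
      ((continuous_bump c).comp (continuous_of.sub (continuous_const (y := 1)))).continuousOn
    exact h1.smul ((continuousOn_nu_act hc hfix s hx).comp continuous_of.continuousOn hSdet)
  refine (integrableOn_iff_integrable_of_support_subset fun h hh => ?_).1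
    (hcont.integrableOn_compact hS)
  by_contra hcon
  refine hh ?_
  have : bump c (Matrix.of h - 1) = 0 := bump_eq_zero fun h1 => hcon ⟨1, h1⟩
  simp only [bumpIntegrand, this, mul_zero, zero_smul]

omit [FiniteDimensional ℂ V] in
theorem bumpIntegrand_mul (hfix : IsFixedByStabilizer π v₀) {c : ℝ}
    (hdet : ∀ h : Mat n, c * sumSq (h - 1) ≤ 1 → h.det ≠ 0) (s : ℂ) {x : E n} (hx : x ≠ 0)
    (k : K n) (h : Mat n) :
    bumpIntegrand π v₀ c s (act (k : Mat n) x) ((k : Mat n) * h * ((k⁻¹ : K n) : Mat n)) =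
      π k (bumpIntegrand π v₀ c s x h) := by
  have h1 : (k : Mat n) * h * ((k⁻¹ : K n) : Mat n) - 1 =
      (k : Mat n) * (h - 1) * ((k⁻¹ : K n) : Mat n) := by
    rw [Matrix.mul_sub, Matrix.sub_mul, Matrix.mul_one, ← Submonoid.coe_mul, mul_inv_cancel,
      Submonoid.coe_one]
  have h2 : |((k : Mat n) * h * ((k⁻¹ : K n) : Mat n)).det| = |h.det| := by
    rw [Matrix.det_mul, Matrix.det_mul, abs_mul, abs_mul, abs_det_coe, abs_det_coe, one_mul, mul_one]
  rw [bumpIntegrand, bumpIntegrand, h1, h2, bump_mul_mul, act_mul, act_inv_act, act_mul,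
    LinearMap.map_smul_of_tower]
  by_cases hh : c * sumSq (h - 1) ≤ 1
  · rw [nu_act hfix s k (act_ne_zero (hdet h hh) hx)]
  · rw [bump_eq_zero hh, mul_zero, zero_smul, zero_smul]

/-- Averaging the bump function near the unit matrix over left multiplication by `K`. -/
theorem lamVector_heckeStar_heckeBump (hc : ∀ v : V, Continuous fun k : K n => π k v)
    (hfix : IsFixedByStabilizer π v₀) {c : ℝ} (hc0 : 0 < c)
    (hdet : ∀ h : Mat n, c * sumSq (h - 1) ≤ 1 → h.det ≠ 0) (s : ℂ) {x : E n} (hx : x ≠ 0) :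
    lamVector (heckeStar (heckeBump π c)) (nu π v₀ s) x =
      ∫ k, π k (π k (∫ h : Fin n → Fin n → ℝ, bumpIntegrand π v₀ c s x (Matrix.of h))) ∂haarK n := by
  have := FiniteDimensional.complete ℂ V
  let G : (Fin n → Fin n → ℝ) → K n → V := fun h k =>
    ((|(Matrix.of h).det| ^ n)⁻¹ * |(Matrix.of h).det| * bump c (Matrix.of h - (k : Mat n))) •
      π k (nu π v₀ s (act (Matrix.of h) x))
  have h1 : lamVector (heckeStar (heckeBump π c)) (nu π v₀ s) x = ∫ h, ∫ k, G h k ∂haarK n := by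
    rw [lamVector_heckeStar_eq_integral]
    congr 1
    funext h
    rw [heckeBump_apply hc, smul_smul, ← integral_smul]
    simp only [smul_smul, G]
  let S : Set (Fin n → Fin n → ℝ) := {h | ∃ k : K n, c * sumSq (Matrix.of h - (k : Mat n)) ≤ 1}
  have hS : IsCompact S := isCompact_sumSq_sub_le hc0
  have hSdet : ∀ h ∈ S, (Matrix.of h).det ≠ 0 := fun h ⟨k, hk⟩ => det_ne_zero_of_sumSq_sub_le hdet hk
  have hG : Integrable (Function.uncurry G) (volume.prod (haarK n)) := by
    have hcont : ContinuousOn (Function.uncurry G) (S ×ˢ univ) := by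
      have hfst : MapsTo (fun p : (Fin n → Fin n → ℝ) × K n => (Matrix.of p.1 : Mat n)) (S ×ˢ univ)
          {h | h.det ≠ 0} := fun p hp => hSdet _ hp.1
      have hfc : Continuous fun p : (Fin n → Fin n → ℝ) × K n => (Matrix.of p.1 : Mat n) :=
        continuous_of.comp continuous_fst
      have h1 := (continuousOn_det_weight.comp hfc.continuousOn hfst).mul
        ((continuous_bump c).comp (hfc.sub
          (continuous_subtype_val.comp continuous_snd))).continuousOn
      exact h1.smul <| ((continuous_piL hc).comp continuous_snd).continuousOn.clm_apply
          ((continuousOn_nu_act hc hfix s hx).comp hfc.continuousOn hfst)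
    refine (integrableOn_iff_integrable_of_support_subset fun p hp => ?_).1
      (hcont.integrableOn_compact (hS.prod isCompact_univ))
    refine ⟨?_, mem_univ _⟩
    by_contra hcon
    refine hp ?_
    have : bump c (Matrix.of p.1 - (p.2 : Mat n)) = 0 := bump_eq_zero fun h1 => hcon ⟨p.2, h1⟩
    simp only [Function.uncurry, G, this, mul_zero, zero_smul]
  rw [h1, integral_integral_swap hG]
  congr 1
  funext k
  let Gk : Mat n → V := fun h =>
    ((|h.det| ^ n)⁻¹ * |h.det| * bump c (h - (k : Mat n))) • π k (nu π v₀ s (act h x))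
  refine (integral_comp_mul_orthogonal k 1 Gk).symm.trans ?_
  simp only [Gk]
  rw [← piL_apply, ← piL_apply,
    ← ContinuousLinearMap.comp_apply,
    ← ContinuousLinearMap.integral_comp_comm _ (integrable_bumpIntegrand hc hfix hc0 hdet s hx)]
  congr 1
  funext h
  have h3 : (k : Mat n) * Matrix.of h * ((1 : K n) : Mat n) - (k : Mat n) =
      (k : Mat n) * (Matrix.of h - 1) * ((1 : K n) : Mat n) := by
    rw [Submonoid.coe_one, Matrix.mul_one, Matrix.mul_one, Matrix.mul_sub, Matrix.mul_one]
  rw [h3, bump_mul_mul, Submonoid.coe_one, Matrix.mul_one, Matrix.det_mul, abs_mul, abs_det_coe,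
    one_mul, act_mul, ContinuousLinearMap.comp_apply, bumpIntegrand, piL_apply, piL_apply,
    LinearMap.map_smul_of_tower, LinearMap.map_smul_of_tower]
  by_cases hh : c * sumSq (Matrix.of h - 1) ≤ 1
  · rw [nu_act hfix s k (act_ne_zero (hdet _ hh) hx)]
  · rw [bump_eq_zero hh, mul_zero, zero_smul, zero_smul]

omit [FiniteDimensional ℂ V] in
/-- Near the unit matrix the determinant does not vanish and `ν_{s,π}(h e₁)` is close to `v₀`. -/
theorem exists_pos_sumSq_le (hc : ∀ v : V, Continuous fun k : K n => π k v) (hv₀ : v₀ ≠ 0)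
    (hfix : IsFixedByStabilizer π v₀) (s : ℂ) : ∃ c : ℝ, 0 < c ∧
      (∀ h : Mat n, c * sumSq (h - 1) ≤ 1 → h.det ≠ 0) ∧
      ∀ h : Mat n, c * sumSq (h - 1) ≤ 1 → ‖nu π v₀ s (act h (e₁ n)) - v₀‖ ≤ ‖v₀‖ / 2 := by
  have he : e₁ n ≠ 0 := by
    rw [← norm_ne_zero_iff, norm_e₁]; exact one_ne_zero
  have hopen : {h : Mat n | h.det ≠ 0} ∈ 𝓝 (1 : Mat n) :=
    (continuous_id.matrix_det).isOpen_preimage {0}ᶜ isOpen_compl_singleton |>.mem_nhds (by simp)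
  have hnu : ContinuousAt (fun h : Mat n => nu π v₀ s (act h (e₁ n))) 1 :=
    (continuousOn_nu_act hc hfix s he).continuousAt hopen
  have hev : ∀ᶠ h : Mat n in 𝓝 1, h.det ≠ 0 ∧ ‖nu π v₀ s (act h (e₁ n)) - v₀‖ ≤ ‖v₀‖ / 2 := by
    refine Filter.Eventually.and hopen ?_
    have h1 : Tendsto (fun h : Mat n => ‖nu π v₀ s (act h (e₁ n)) - v₀‖) (𝓝 1) (𝓝 0) := by
      have := (hnu.tendsto.sub_const v₀).norm
      rwa [act_one', nu_e₁ hfix, sub_self, norm_zero] at this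
    exact (h1.eventually_lt_const (half_pos (norm_pos_iff.2 hv₀))).mono fun h hh => hh.le
  have hev' : ∀ᶠ m : Fin n → Fin n → ℝ in 𝓝 0, (1 + Matrix.of m).det ≠ 0 ∧
      ‖nu π v₀ s (act (1 + Matrix.of m) (e₁ n)) - v₀‖ ≤ ‖v₀‖ / 2 := by
    have h2 : Tendsto (fun m : Fin n → Fin n → ℝ => (1 : Mat n) + Matrix.of m) (𝓝 0) (𝓝 1) := by
      have h3 : Continuous fun m : Fin n → Fin n → ℝ => (1 : Mat n) + Matrix.of m :=
        continuous_const.add continuous_of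
      have h4 := h3.tendsto 0
      rwa [Matrix.of_zero, add_zero] at h4
    exact h2.eventually hev
  obtain ⟨ε, hε, hball⟩ := Metric.eventually_nhds_iff.1 hev'
  have key : ∀ h : Mat n, (4 / ε ^ 2) * sumSq (h - 1) ≤ 1 →
      h.det ≠ 0 ∧ ‖nu π v₀ s (act h (e₁ n)) - v₀‖ ≤ ‖v₀‖ / 2 := by
    intro h hh
    have h1 : ‖Matrix.of.symm (h - 1)‖ ≤ ε / 2 := by
      refine norm_le_of_sumSq_le (by positivity) ?_
      rw [div_mul_eq_mul_div, div_le_one (by positivity)] at hh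
      rw [Equiv.apply_symm_apply]
      linarith
    have h2 := hball (y := Matrix.of.symm (h - 1)) (by rw [dist_zero_right]; linarith)
    rwa [Equiv.apply_symm_apply, add_sub_cancel] at h2
  exact ⟨4 / ε ^ 2, by positivity, fun h hh => (key h hh).1, fun h hh => (key h hh).2⟩

/-- For every `s` some element of the Hecke algebra has a non-zero eigenvalue on `ν_{s,π}`; hence
a weak Mellin transform is unique. -/
theorem exists_isHecke_isEigenvalue_ne_zero (hπ : IsSpherical π) (hv₀ : v₀ ≠ 0)
    (hfix : IsFixedByStabilizer π v₀) (s : ℂ) :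
    ∃ (φ : Mat n → V →L[ℂ] V) (ξ : ℂ), IsHecke π φ ∧ ξ ≠ 0 ∧
      IsEigenvalue π v₀ s (heckeStar φ) ξ := by
  have := FiniteDimensional.complete ℂ V
  have hc := hπ.continuous
  have he : e₁ n ≠ 0 := by
    rw [← norm_ne_zero_iff, norm_e₁]; exact one_ne_zero
  obtain ⟨c, hc0, hdet, hnear⟩ := exists_pos_sumSq_le hc hv₀ hfix s
  obtain ⟨d, hd, hdv⟩ := exists_integral_apply_apply_eq_smul hπ hv₀ hfix
  let R : E n → V := fun x => ∫ h : Fin n → Fin n → ℝ, bumpIntegrand π v₀ c s x (Matrix.of h)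
  have hRact : ∀ (k : K n) (x : E n), x ≠ 0 → R (act (k : Mat n) x) = π k (R x) := by
    intro k x hx
    simp only [R]
    rw [← integral_comp_mul_orthogonal k k⁻¹, ← piL_apply,
      ← ContinuousLinearMap.integral_comp_comm _ (integrable_bumpIntegrand hc hfix hc0 hdet s hx)]
    congr 1
    funext h
    exact bumpIntegrand_mul hfix hdet s hx k _
  obtain ⟨ρ, hρ⟩ : ∃ ρ : ℂ, R (e₁ n) = ρ • v₀ :=
    hπ.exists_eq_smul hv₀ hfix fun k hk => by rw [← hRact k _ he, hk]
  have hRx : ∀ x : E n, x ≠ 0 → R x = ρ • nu π v₀ s x := by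
    intro x hx
    obtain ⟨r, k, hr, rfl⟩ := exists_eq_smul_act hx
    have h1 : R (r • act (k : Mat n) (e₁ n)) = ((r : ℂ) ^ s) • R (act (k : Mat n) (e₁ n)) := by
      simp only [R]
      rw [← integral_smul]
      congr 1
      funext h
      rw [bumpIntegrand, bumpIntegrand, act_smul']
      by_cases hh : c * sumSq (Matrix.of h - 1) ≤ 1
      · have hk : act (k : Mat n) (e₁ n) ≠ 0 := by
          rw [← norm_ne_zero_iff, norm_act, norm_e₁]; exact one_ne_zero
        rw [nu_smul hfix s hr (act_ne_zero (hdet _ hh) hk), smul_comm]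
      · rw [bump_eq_zero hh, mul_zero, zero_smul, zero_smul, smul_zero]
    rw [h1, hRact k _ he, hρ, nu_eq π v₀ hfix s r hr, map_smul, smul_comm]
  have hρ0 : ρ ≠ 0 := by
    rintro rfl
    rw [zero_smul] at hρ
    let w : (Fin n → Fin n → ℝ) → ℝ := fun h =>
      (|(Matrix.of h).det| ^ n)⁻¹ * |(Matrix.of h).det| * bump c (Matrix.of h - 1)
    have hw0 : ∀ h, 0 ≤ w h := fun h => mul_nonneg (by positivity) (bump_nonneg _ _)
    have hwint : Integrable w := by
      let S : Set (Fin n → Fin n → ℝ) := {h | ∃ k : K n, c * sumSq (Matrix.of h - (k : Mat n)) ≤ 1}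
      have hS : IsCompact S := isCompact_sumSq_sub_le hc0
      have hSdet : ∀ h ∈ S, (Matrix.of h).det ≠ 0 :=
        fun h ⟨k, hk⟩ => det_ne_zero_of_sumSq_sub_le hdet hk
      have hcont : ContinuousOn w S :=
        (continuousOn_det_weight.comp continuous_of.continuousOn hSdet).mul
          ((continuous_bump c).comp (continuous_of.sub continuous_const)).continuousOn
      refine (integrableOn_iff_integrable_of_support_subset fun h hh => ?_).1
        (hcont.integrableOn_compact hS)
      by_contra hcon
      refine hh ?_
      have : bump c (Matrix.of h - 1) = 0 := bump_eq_zero fun h1 => hcon ⟨1, h1⟩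
      simp only [w, this, mul_zero]
    have hwpos : 0 < ∫ h, w h := by
      rw [integral_pos_iff_support_of_nonneg hw0 hwint]
      have hopen : IsOpen {h : Fin n → Fin n → ℝ | c * sumSq (Matrix.of h - 1) < 1} :=
        isOpen_lt (continuous_const.mul (continuous_sumSq.comp (continuous_of.sub continuous_const)))
          continuous_const
      refine lt_of_lt_of_le (hopen.measure_pos _ ⟨Matrix.of.symm 1, ?_⟩) (measure_mono fun h hh => ?_)
      · simp [sumSq]
      · have hh' : c * sumSq (Matrix.of h - 1) < 1 := hh
        have h1 := abs_pos.2 (hdet _ hh'.le)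
        have h2 : 0 < bump c (Matrix.of h - 1) :=
          Real.smoothTransition.pos_of_pos (by linarith)
        exact (show 0 < w h by positivity).ne'
    have h1 : ‖∫ h, (bumpIntegrand π v₀ c s (e₁ n) (Matrix.of h) - w h • v₀)‖ ≤
        ∫ h, w h * (‖v₀‖ / 2) := by
      refine norm_integral_le_of_norm_le (hwint.mul_const _) (ae_of_all _ fun h => ?_)
      have h2 : bumpIntegrand π v₀ c s (e₁ n) (Matrix.of h) - w h • v₀ =
          w h • (nu π v₀ s (act (Matrix.of h) (e₁ n)) - v₀) := by rw [smul_sub]; rfl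
      rw [h2, norm_smul, Real.norm_of_nonneg (hw0 h)]
      by_cases hh : c * sumSq (Matrix.of h - 1) ≤ 1
      · exact mul_le_mul_of_nonneg_left (hnear _ hh) (hw0 h)
      · have : w h = 0 := by simp only [w, bump_eq_zero hh, mul_zero]
        rw [this, zero_mul, zero_mul]
    rw [integral_sub (integrable_bumpIntegrand hc hfix hc0 hdet s he) (hwint.smul_const _),
      integral_smul_const, integral_mul_const,
      show ∫ h : Fin n → Fin n → ℝ, bumpIntegrand π v₀ c s (e₁ n) (Matrix.of h) = 0 from hρ,
      zero_sub, norm_neg, norm_smul, Real.norm_of_nonneg hwpos.le] at h1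
    have h2 := norm_pos_iff.2 hv₀
    nlinarith [mul_pos hwpos h2]
  refine ⟨heckeBump π c, d * ρ, isHecke_heckeBump hc hc0 hdet, mul_ne_zero hd hρ0, fun x hx => ?_⟩
  rw [lamVector_heckeStar_heckeBump hc hfix hc0 hdet s hx, hdv, mul_smul]
  congr 1
  exact hRx x hx

theorem IsWeakMellin.unique (hπ : IsSpherical π) (hv₀ : v₀ ≠ 0) (hfix : IsFixedByStabilizer π v₀)
    {f : E n → ℂ} {s : ℂ} {Z Z' : V} (h : IsWeakMellin π v₀ f s Z)
    (h' : IsWeakMellin π v₀ f s Z') : Z = Z' := by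
  obtain ⟨φ, ξ, hφ, hξ, heig⟩ := exists_isHecke_isEigenvalue_ne_zero hπ hv₀ hfix (s - n)
  exact smul_right_injective V hξ (((h φ hφ).2 ξ heig).symm.trans ((h' φ hφ).2 ξ heig))

end Eigenvalue

/-! ### The zeta function of a second degree character -/

section Zeta

variable {V : Type*} [NormedAddCommGroup V] [NormedSpace ℂ V]

/-- The identity theorem for meromorphic functions in normal form that agree on `Re s > 0`. -/
theorem eq_of_meromorphicNFOn_univ {f g : ℂ → V} (hf : MeromorphicNFOn f univ)
    (hg : MeromorphicNFOn g univ) (h : ∀ s : ℂ, 0 < s.re → f s = g s) : f = g := by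
  have hmer : MeromorphicOn (f - g) univ := fun z hz =>
    (hf hz).meromorphicAt.sub (hg hz).meromorphicAt
  have h1 : meromorphicOrderAt (f - g) 1 = ⊤ := by
    rw [meromorphicOrderAt_eq_top_iff]
    refine Filter.Eventually.filter_mono nhdsWithin_le_nhds ?_
    have hopen : IsOpen {z : ℂ | 0 < z.re} := isOpen_lt continuous_const Complex.continuous_re
    filter_upwards [hopen.mem_nhds (show (1 : ℂ) ∈ {z : ℂ | 0 < z.re} by simp)] with z hz
    rw [Pi.sub_apply, h z hz, sub_self]
  funext s
  have h2 : meromorphicOrderAt (f - g) s = ⊤ := by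
    by_contra hs
    exact hmer.meromorphicOrderAt_ne_top_of_isPreconnected isPreconnected_univ (mem_univ s)
      (mem_univ 1) hs h1
  rw [meromorphicOrderAt_eq_top_iff] at h2
  have h3 : f =ᶠ[𝓝[≠] s] g := h2.mono fun z hz => sub_eq_zero.1 hz
  exact (((hf (mem_univ s)).eventuallyEq_nhdsNE_iff_eventuallyEq_nhds (hg (mem_univ s))).1
    h3).eq_of_nhds

/-- Mathlib's `Gamma` takes the value `0` exactly at its poles, the zeros of the entire function
`1/Γ`, and these are isolated. -/
theorem eventually_Gamma_ne_zero (l : ℕ) (s : ℂ) :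
    ∀ᶠ w in 𝓝[≠] s, Complex.Gamma ((w + l) / 2) ≠ 0 := by
  have hd : Differentiable ℂ fun w : ℂ => (Complex.Gamma ((w + l) / 2))⁻¹ :=
    Complex.differentiable_one_div_Gamma.comp (f := fun w : ℂ => (w + l) / 2) (by fun_prop)
  have han : AnalyticOnNhd ℂ (fun w : ℂ => (Complex.Gamma ((w + l) / 2))⁻¹) univ :=
    fun w _ => hd.analyticAt w
  rcases (han s (mem_univ s)).eventually_eq_zero_or_eventually_ne_zero with h | h
  · have h1 := han.eqOn_zero_of_preconnected_of_eventuallyEq_zero isPreconnected_univ (mem_univ s) h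
      (mem_univ (2 - l : ℂ))
    simp at h1
  · exact h.mono fun w hw h0 => hw (by rw [h0, inv_zero])

variable {n : ℕ} [NeZero n] [FiniteDimensional ℂ V] {π : Representation ℂ (K n) V} {v₀ : V}

/-- The explicit weak Mellin transform of a second degree character, the limit of the Mellin
transforms of the Gaussians `gauss z b` as `z → ia` from the right half plane. -/
theorem isWeakMellin_secondDegree (hπ : IsSpherical π) (hfix : IsFixedByStabilizer π v₀) {a : ℝ}
    (ha : a ≠ 0) (b : E n) {s : ℂ} (hs : 0 < s.re) {I : ℂ → V}
    (hI : ∀ z : ℂ, 0 < z.re → ∫ x : E n, gauss z b x • nu π v₀ (s - n) x = I z)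
    (hcont : ContinuousAt I (Complex.I * a)) :
    IsWeakMellin π v₀ (secondDegree a b) s (I (Complex.I * a)) := by
  intro φ hφ
  have hz0 : Complex.I * (a : ℂ) ≠ 0 := mul_ne_zero Complex.I_ne_zero (by exact_mod_cast ha)
  rw [secondDegree_eq_gauss]
  refine ⟨integrable_mellinIntegrand hπ.continuous hfix hφ b (by simp) hz0 hs, fun ξ hξ => ?_⟩
  let u : ℕ → ℂ := fun j => ((1 / ((j : ℝ) + 1) : ℝ) : ℂ) + Complex.I * a
  have hure : ∀ j, 0 < (u j).re := fun j => by
    have : 0 < 1 / ((j : ℝ) + 1) := by positivity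
    simpa only [u, Complex.add_re, Complex.ofReal_re, Complex.I_mul_re, Complex.ofReal_im, neg_zero,
      add_zero] using this
  have hu : Tendsto u atTop (𝓝 (Complex.I * a)) := by
    have h1 := (Complex.continuous_ofReal.tendsto 0).comp
      (tendsto_one_div_add_atTop_nhds_zero_nat (𝕜 := ℝ))
    simpa only [Complex.ofReal_zero, zero_add, Function.comp_def] using
      h1.add_const (Complex.I * (a : ℂ))
  refine tendsto_nhds_unique
    (tendsto_mellin_lamScalar_gauss hπ.continuous hfix hφ b hu hz0 (fun j => (hure j).le) hs) ?_
  refine ((hcont.tendsto.comp hu).const_smul ξ).congr fun j => ?_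
  rw [mellin_lamScalar_gauss hπ.continuous hfix hφ b (hure j) hs hξ, hI _ (hure j),
    Function.comp_apply]

/-- Near every point, the zeta function is a Gamma factor times the entire function
`s ↦ A (πia)^{-(s+l)/2} ₁F₁((s+l)/2; n/2+l; iπ‖b‖²/a) ‖b‖^l π(k_b) v₀`, where `l` is the least
order of a non-vanishing moment of `v₀`. -/
theorem exists_isZeta_secondDegree (hπ : IsSpherical π) (hv₀ : v₀ ≠ 0)
    (hfix : IsFixedByStabilizer π v₀) {a : ℝ} (ha : a ≠ 0) (b : E n) :
    ∃ (l : ℕ) (A c : ℂ) (ζ : ℂ → V), A ≠ 0 ∧ c ≠ 0 ∧ (l = 0 → moment π v₀ 0 (e₁ n) ≠ 0) ∧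
      IsZeta π v₀ (secondDegree a b) ζ ∧
      ∀ s, ζ =ᶠ[𝓝[≠] s] fun s => Complex.Gamma ((s + l) / 2) •
        ((A * c ^ (-((s + l) / 2)) * kummer ((s + l) / 2) (n / 2 + l)
          (Complex.I * ((Real.pi * ‖b‖ ^ 2 / a : ℝ) : ℂ))) • ((‖b‖ : ℂ) ^ l • π (rot b) v₀)) := by
  have := FiniteDimensional.complete ℂ V
  obtain ⟨l, A, hA, hl, hform⟩ := exists_integral_gauss_smul_nu_eq_kummer hπ hv₀ hfix
  have hn := NeZero.pos n
  have hβ : (0 : ℝ) < n / 2 + l := by positivity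
  set z₀ : ℂ := Complex.I * a
  have ha' : (a : ℂ) ≠ 0 := by exact_mod_cast ha
  have hz0 : z₀ ≠ 0 := mul_ne_zero Complex.I_ne_zero ha'
  have hc0 : (Real.pi * z₀ : ℂ) ≠ 0 := mul_ne_zero (by exact_mod_cast Real.pi_ne_zero) hz0
  have hw : Complex.I * ((Real.pi * ‖b‖ ^ 2 / a : ℝ) : ℂ) = -(Real.pi * ‖b‖ ^ 2 / z₀) := by
    simp only [z₀]
    push_cast
    field_simp
    linear_combination (‖b‖ ^ 2 : ℂ) * Complex.I_sq
  set u : V := (‖b‖ : ℂ) ^ l • π (rot b) v₀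
  let H : ℂ → V := fun s => (A * (Real.pi * z₀) ^ (-((s + l) / 2)) *
    kummer ((s + l) / 2) (n / 2 + l) (Complex.I * ((Real.pi * ‖b‖ ^ 2 / a : ℝ) : ℂ))) • u
  have hH : Differentiable ℂ H := by
    have h1 : Differentiable ℂ fun s : ℂ => (Real.pi * z₀) ^ (-((s + l) / 2)) := fun s =>
      DifferentiableAt.const_cpow (by fun_prop) (Or.inl hc0)
    have h2 : Differentiable ℂ fun s : ℂ => kummer ((s + l) / 2) (n / 2 + l)
        (Complex.I * ((Real.pi * ‖b‖ ^ 2 / a : ℝ) : ℂ)) :=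
      (differentiable_kummer_left hβ _).comp (f := fun s : ℂ => (s + l) / 2) (by fun_prop)
    exact ((h1.const_mul A).mul h2).smul_const u
  let F : ℂ → V := fun s => Complex.Gamma ((s + l) / 2) • H s
  have hFmer : MeromorphicOn F univ := fun s _ => by
    have h1 : MeromorphicAt (fun s : ℂ => Complex.Gamma ((s + l) / 2)) s :=
      (Meromorphic.Gamma ((s + l) / 2)).comp_analyticAt (g := fun s : ℂ => (s + l) / 2)
        ((by fun_prop : Differentiable ℂ fun s : ℂ => (s + l) / 2).analyticAt s)
    exact h1.smul (hH.analyticAt s).meromorphicAt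
  have hopen : IsOpen {s : ℂ | 0 < s.re} := isOpen_lt continuous_const Complex.continuous_re
  have hαre : ∀ s : ℂ, 0 < s.re → 0 < ((s + l) / 2).re := fun s hs => by
    rw [Complex.div_ofNat_re, Complex.add_re, Complex.natCast_re]; positivity
  have hFdiff : DifferentiableOn ℂ F {s : ℂ | 0 < s.re} := by
    intro s hs
    have h1 : DifferentiableAt ℂ (fun s : ℂ => Complex.Gamma ((s + l) / 2)) s := by
      refine DifferentiableAt.comp s (g := Complex.Gamma) (f := fun s : ℂ => (s + l) / 2)
        (Complex.differentiableAt_Gamma _ fun m h => ?_) (by fun_prop)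
      have h2 := hαre s hs
      rw [h, Complex.neg_re, Complex.natCast_re] at h2
      have : (0 : ℝ) ≤ m := m.cast_nonneg
      linarith
    exact (h1.smul (hH s)).differentiableWithinAt
  let ζ := toMeromorphicNFOn F univ
  have hζF : ∀ s, ζ =ᶠ[𝓝[≠] s] F := fun s =>
    hFmer.toMeromorphicNFOn_eq_self_on_nhdsNE (mem_univ s)
  have hζNF : MeromorphicNFOn ζ univ := meromorphicNFOn_toMeromorphicNFOn F univ
  have hζeq : ∀ s : ℂ, 0 < s.re → ζ =ᶠ[𝓝 s] F := fun s hs =>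
    ((hζNF (mem_univ s)).eventuallyEq_nhdsNE_iff_eventuallyEq_nhds
      (hFdiff.analyticAt (hopen.mem_nhds hs)).meromorphicNFAt).1 (hζF s)
  refine ⟨l, A, Real.pi * z₀, ζ, hA, hc0, hl, ⟨fun s hs => ?_, fun s hs => ?_, hζNF⟩, hζF⟩
  · rw [(hζeq s hs).eq_of_nhds]
    have h1 : F s = (fun z : ℂ => (A * Complex.Gamma ((s + l) / 2) *
        (Real.pi * z) ^ (-((s + l) / 2)) * kummer ((s + l) / 2) (n / 2 + l)
          (-(Real.pi * ‖b‖ ^ 2 / z))) • u) z₀ := by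
      simp only [F, H]
      rw [smul_smul, hw]
      congr 1
      ring
    rw [h1]
    refine isWeakMellin_secondDegree hπ hfix ha b hs (fun z hz => hform b z s hz hs) ?_
    have h2 : ContinuousAt (fun z : ℂ => (Real.pi * z) ^ (-((s + l) / 2))) z₀ := by
      refine ContinuousAt.cpow (by fun_prop) continuousAt_const (Or.inr ?_)
      rw [Complex.im_ofReal_mul, Complex.I_mul_im, Complex.ofReal_re]
      exact mul_ne_zero Real.pi_ne_zero ha
    have h3 : ContinuousAt (fun z : ℂ => kummer ((s + l) / 2) (n / 2 + l)
        (-(Real.pi * ‖b‖ ^ 2 / z))) z₀ :=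
      (continuous_kummer _ hβ).continuousAt.comp
        (f := fun z : ℂ => -(Real.pi * (‖b‖ : ℂ) ^ 2 / z))
        ((continuousAt_const.div continuousAt_id hz0).neg)
    exact ((h2.const_mul _).mul h3).smul_const u
  · exact (hFdiff s hs).congr_of_eventuallyEq ((hζeq s hs).filter_mono nhdsWithin_le_nhds)
      (hζeq s hs).eq_of_nhds

theorem IsZeta.unique (hπ : IsSpherical π) (hv₀ : v₀ ≠ 0) (hfix : IsFixedByStabilizer π v₀)
    {f : E n → ℂ} {ζ ζ' : ℂ → V} (h : IsZeta π v₀ f ζ) (h' : IsZeta π v₀ f ζ') : ζ = ζ' :=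
  eq_of_meromorphicNFOn_univ h.meromorphic h'.meromorphic fun s hs =>
    (h.weakMellin s hs).unique hπ hv₀ hfix (h'.weakMellin s hs)

theorem isTrivial_of_moment_zero_ne_zero (hπ : IsSpherical π) (h : moment π v₀ 0 (e₁ n) ≠ 0) :
    π.IsTrivial := by
  refine isTrivial_of_fixed hπ.irreducible h fun k => ?_
  rw [← moment_act hπ.continuous]
  simp only [moment, pow_zero]

end Zeta

end

end WeakMellin

open WeakMellin Filter Topology in
theorem mainTheorem8 {n : ℕ} [NeZero n]
    {V : Type*} [NormedAddCommGroup V] [NormedSpace ℂ V] [FiniteDimensional ℂ V]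
    (π : Representation ℂ (WeakMellin.K n) V) (hπ : WeakMellin.IsSpherical π)
    (v₀ : V) (hv₀ : v₀ ≠ 0) (hfix : WeakMellin.IsFixedByStabilizer π v₀)
    (a : ℝ) (ha : a ≠ 0) (b : WeakMellin.E n) :
    (∃! ζ : ℂ → V, WeakMellin.IsZeta π v₀ (WeakMellin.secondDegree a b) ζ) ∧
    ∀ ζ : ℂ → V, WeakMellin.IsZeta π v₀ (WeakMellin.secondDegree a b) ζ →
      (b = 0 → ¬ π.IsTrivial → ∀ s : ℂ, ζ s = 0) ∧
      (b ≠ 0 → ∀ s : ℂ, WeakMellin.IsZero ζ s → s.re = n / 2) := by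
  obtain ⟨l, A, c, ζ₀, hA, hc, hl, hζ₀, hform⟩ := exists_isZeta_secondDegree hπ hv₀ hfix ha b
  refine ⟨⟨ζ₀, hζ₀, fun ζ hζ => hζ.unique hπ hv₀ hfix hζ₀⟩, fun ζ hζ => ?_⟩
  obtain rfl := hζ.unique hπ hv₀ hfix hζ₀
  have hβ : (0 : ℝ) < n / 2 + l := by
    have := NeZero.pos n
    positivity
  constructor
  · rintro rfl hnt s
    have hl0 : l ≠ 0 := fun h => hnt (isTrivial_of_moment_zero_ne_zero hπ (hl h))
    have h1 : ζ =ᶠ[𝓝[≠] s] fun _ => 0 := (hform s).trans (Eventually.of_forall fun w => by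
      simp [hl0])
    have h2 : MeromorphicNFAt (fun _ : ℂ => (0 : V)) s := analyticAt_const.meromorphicNFAt
    exact (((hζ.meromorphic (Set.mem_univ s)).eventuallyEq_nhdsNE_iff_eventuallyEq_nhds h2).1
      h1).eq_of_nhds
  · rintro hb s ⟨han, hs0⟩
    set y : ℝ := Real.pi * ‖b‖ ^ 2 / a
    have hb' := norm_pos_iff.2 hb
    have hy : y ≠ 0 := div_ne_zero (by positivity) ha
    set u : V := (‖b‖ : ℂ) ^ l • π (rot b) v₀ with hu
    have hu0 : u ≠ 0 := by
      refine smul_ne_zero (pow_ne_zero _ (by exact_mod_cast hb'.ne')) fun h => hv₀ ?_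
      have h1 := congrArg (π (rot b)⁻¹) h
      rwa [← Module.End.mul_apply, ← map_mul, inv_mul_cancel, map_one, Module.End.one_apply,
        map_zero] at h1
    let H : ℂ → V := fun s =>
      (A * c ^ (-((s + l) / 2)) * kummer ((s + l) / 2) (n / 2 + l) (Complex.I * y)) • u
    have hH : Continuous H := by
      have h1 : Continuous fun s : ℂ => c ^ (-((s + l) / 2)) :=
        Continuous.const_cpow (by fun_prop) (Or.inl hc)
      have h2 : Continuous fun s : ℂ => kummer ((s + l) / 2) (n / 2 + l) (Complex.I * y) :=
        (differentiable_kummer_left hβ _).continuous.comp (by fun_prop)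
      exact ((h1.const_mul A).mul h2).smul continuous_const
    -- The Gamma factor has no zeros, so a zero of `ζ` is a zero of the entire factor `H`.
    have hg : Continuous fun w : ℂ => (Complex.Gamma ((w + l) / 2))⁻¹ :=
      Complex.differentiable_one_div_Gamma.continuous.comp (by fun_prop)
    have h1 : Tendsto H (𝓝[≠] s) (𝓝 0) := by
      have h2 : Tendsto (fun w => (Complex.Gamma ((w + l) / 2))⁻¹ • ζ w) (𝓝[≠] s) (𝓝 0) := by
        have h3 := (hg.continuousAt (x := s)).smul han.continuousAt
        have h4 := h3.tendsto.mono_left (nhdsWithin_le_nhds (s := {s}ᶜ))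
        rwa [Pi.smul_apply', hs0, smul_zero] at h4
      refine h2.congr' ?_
      filter_upwards [hform s, eventually_Gamma_ne_zero l s] with w hw1 hw2
      rw [hw1, inv_smul_smul₀ hw2]
    have h2 : H s = 0 :=
      tendsto_nhds_unique (hH.continuousAt.tendsto.mono_left nhdsWithin_le_nhds) h1
    have h3 := (smul_eq_zero.1 h2).resolve_right hu0
    have h4 : A * c ^ (-((s + l) / 2)) ≠ 0 :=
      mul_ne_zero hA fun h => hc ((Complex.cpow_eq_zero_iff _ _).1 h).1
    have h5 := re_eq_of_kummer_eq_zero hβ hy ((mul_eq_zero.1 h3).resolve_left h4)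
    rw [Complex.div_ofNat_re, Complex.add_re, Complex.natCast_re] at h5
    linarith
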